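/- **Models.** Let $M$ be a partial bijection between finite user sets $\mathcal U,\mathcal V$ with $|M|=|\mathcal U|=n$ (so every user of $\mathcal U$ is mapped); $M$ is arbitrary and unknown. Consider either of the following two problems. - *Planted matching.* One observes a matrix $W\in\mathbb R^{\mathcal U\times\mathcal V}$ with independent Gaussian entries of variance $1$ and mean $\mu>0$ at the pairs mapped by $M$, mean $0$ at all other pairs. The signal strength is $\zeta=\mu^2/2$, and the score matrix is $S=\mu W$. - *Alignment of correlated Gaussian databases.* One observes jointly Gaussian feature vectors $A(u)\in\mathbb R^{\mathcal D_a}$ ($u\in\mathcal U$) and $B(v)\in\mathbb R^{\mathcal D_b}$ ($v\in\mathcal V$), where the $A(u)$ are i.i.d. with mean $\mu_a$ and covariance $\Sigma_a$, the $B(v)$ are i.i.d. with mean $\mu_b$ and covariance $\Sigma_b$, $\mathrm{Cov}(A(u),B(v))=\Sigma_{ab}$ if $u,v$ are mapped to each other by $M$ and $0$ otherwise, and $\begin{pmatrix}\Sigma_a&\Sigma_{ab}\\ \Sigma_{ab}^\top&\Sigma_b\end{pmatrix}$ is positive definite. With $f_{XY},f_X,f_Y$ the joint and marginal densities of a correlated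 feature pair, the signal strength is the mutual information $\zeta=\int f_{XY}\log\frac{f_{XY}}{f_Xf_Y}$, and the score matrix is $S_{u,v}=\log\frac{f_{XY}(A(u),B(v))}{f_X(A(u))f_Y(B(v))}$. **Algorithms.** Given $\tau\in\mathbb R$, each algorithm returns an integer-valued maximizer $m$ (ties broken arbitrarily and measurably) of $\sum_{u,v}(S_{u,v}-\tau)m_{u,v}$ over real matrices with $m_{u,v}\in[0,1]$ and, in addition: no further constraint for *threshold testing*; $\sum_v m_{u,v}=1$ for all $u$ for *maximum row estimation*; $\sum_v m_{u,v}=1$ for all $u$ and $\sum_u m_{u,v}\le1$ for all $v$ for *maximum likelihood estimation*. The value of $\tau$ is arbitrary for the last two algorithms; for threshold testing the claim is that there is a suitable choice of $\tau$ depending only on the problem and on $(n,|\mathcal V|,\zeta)$. A user of $\mathcal U$ or of $\mathcal V$ is *misaligned* if its row or column in $m$ differs from that in the $0/1$ matrix of $M$. *Exact alignment* means that the expected number of misaligned users is $o(1)$, and *almost-exact alignment* that it is $o(n)$. **Theorem.** Consider a sequence of instances of one of the two problems with $n\to\infty$. Let $\alpha=\frac{\log(|\mathcal V|-n)}{\log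 n}$ if $|\mathcal V|>n$, and assume that $\alpha$ is bounded above along the sequence. 1. $\zeta\ge c\log n+\omega(1)$ is a sufficient condition for exact alignment, where $c$ is $$\begin{array}{l|c|c|c} & |\mathcal V|=n & n<|\mathcal V|\le n+o(n) & |\mathcal V|\ge n+\Omega(n)\\\hline \text{threshold testing} & (1+\sqrt2)^2 & (1+\sqrt2)^2 & (1+\sqrt{1+\alpha})^2\\ \text{maximum row estimation} & 4 & 4 & (1+\sqrt\alpha)^2\\ \text{maximum likelihood estimation} & 2 & 2(\alpha+1) & (1+\sqrt\alpha)^2 \end{array}$$ 2. $\zeta\ge\max\{\alpha,1\}\log n+\omega(\sqrt{\log n})$ (with $\max\{\alpha,1\}$ read as $1$ if $|\mathcal V|=n$) is a sufficient condition for almost-exact alignment, for each of the three algorithms. -/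

import Mathlib

open Filter Topology MeasureTheory ProbabilityTheory Asymptotics

universe u v w

noncomputable section

/-- Two finite sets of users `U` and `V`, an underlying partial mapping `M` between them (a bijection
between a subset of `U` and a subset of `V`), and the probability space `(Ω, P)` on which the
observations live. The mapping is an arbitrary fixed one, so all probabilities and expectations are
those given `M`. -/
structure AlignmentSetting where
  U : Type u
  V : Type u
  [fintypeU : Fintype U]
  [fintypeV : Fintype V]
  M : U ≃. V
  Ω : Type v
  [measurableSpaceΩ : MeasurableSpace Ω]
  P : Measure Ω
  [isProbabilityMeasure : IsProbabilityMeasure P]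

attribute [instance] AlignmentSetting.fintypeU AlignmentSetting.fintypeV
  AlignmentSetting.measurableSpaceΩ AlignmentSetting.isProbabilityMeasure

namespace AlignmentSetting

/-- `|U|`. -/
def sizeU (X : AlignmentSetting.{u, v}) : ℕ := Fintype.card X.U

/-- `|V|`. -/
def sizeV (X : AlignmentSetting.{u, v}) : ℕ := Fintype.card X.V

/-- `|M|`, the number of mapped pairs. -/
def sizeM (X : AlignmentSetting.{u, v}) : ℕ := Set.ncard {p : X.U × X.V | p.2 ∈ X.M p.1}

open Classical in
/-- The matrix encoding of `M`, with entry `1` at mapped pairs and `0` elsewhere. -/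
def trueMatrix (X : AlignmentSetting.{u, v}) : Matrix X.U X.V ℝ := X.M.toMatrix

/-- `α = log (|V| - n) / log n` where `n = |U|` (only meaningful if `|V| > n`; it is `0` if
`|V| = n`). -/
def alpha (X : AlignmentSetting.{u, v}) : ℝ :=
  Real.log ((X.sizeV : ℝ) - X.sizeU) / Real.log X.sizeU

/-- The number of users, in either user set, that are not matched by `m` exactly as by `M`: the users
`u ∈ U` whose row in `m` is wrong and the users `v ∈ V` whose column in `m` is wrong. -/
def misaligned (X : AlignmentSetting.{u, v}) (m : Matrix X.U X.V ℝ) : ℕ :=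
  Set.ncard {u : X.U | ∃ v, m u v ≠ X.trueMatrix u v} +
    Set.ncard {v : X.V | ∃ u, m u v ≠ X.trueMatrix u v}

/-- Expected number of users misaligned by the random estimate `m`. -/
def expectedMisaligned (X : AlignmentSetting.{u, v}) (m : X.Ω → Matrix X.U X.V ℝ) : ℝ :=
  ∫ ω, (X.misaligned (m ω) : ℝ) ∂X.P

end AlignmentSetting

/-- Planted matching on a Gaussian bigraph: independent Gaussian edge weights of unit variance, with
mean `μ > 0` at true pairs and mean `0` elsewhere. -/
structure PlantedMatching extends AlignmentSetting.{u, v} where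
  μ : ℝ
  μ_pos : 0 < μ
  W : U → V → Ω → ℝ
  indep : iIndepFun (fun (p : U × V) => W p.1 p.2) P
  law_mapped : ∀ u v, v ∈ M u → HasLaw (W u v) (gaussianReal μ 1) P
  law_unmapped : ∀ u v, v ∉ M u → HasLaw (W u v) (gaussianReal 0 1) P

/-- The signal strength `μ² / 2`. -/
def PlantedMatching.signal (X : PlantedMatching.{u, v}) : ℝ := X.μ ^ 2 / 2

/-- The score matrix `μ W`. -/
def PlantedMatching.score (X : PlantedMatching.{u, v}) (ω : X.Ω) : Matrix X.U X.V ℝ :=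
  fun u v => X.μ * X.W u v ω

/-- The density of the Gaussian distribution on `ℝ^ι` with mean `μ` and covariance matrix `S`. -/
def gaussianDensity {ι : Type*} [Fintype ι] [DecidableEq ι] (μ : ι → ℝ) (S : Matrix ι ι ℝ)
    (x : ι → ℝ) : ℝ :=
  (√((2 * Real.pi) ^ Fintype.card ι * S.det))⁻¹ *
    Real.exp (-(1 / 2) * ((x - μ) ⬝ᵥ S⁻¹.mulVec (x - μ)))

/-- A pair of correlated Gaussian databases `A : U → ℝ^Da` and `B : V → ℝ^Db`, with means `μa`, `μb`
and positive definite covariance matrix `[Σa, Σab; Σabᵀ, Σb]`. -/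
structure CorrelatedGaussianDatabases extends AlignmentSetting.{u, v} where
  Da : Type w
  Db : Type w
  [fintypeDa : Fintype Da]
  [fintypeDb : Fintype Db]
  [decidableEqDa : DecidableEq Da]
  [decidableEqDb : DecidableEq Db]
  μa : Da → ℝ
  μb : Db → ℝ
  Sa : Matrix Da Da ℝ
  Sab : Matrix Da Db ℝ
  Sb : Matrix Db Db ℝ
  posDef : (Matrix.fromBlocks Sa Sab Sab.transpose Sb).PosDef
  A : U → Ω → Da → ℝ
  B : V → Ω → Db → ℝ
  /- all entries are jointly Gaussian -/
  gaussian : HasGaussianLaw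
    (fun ω => ((fun u => A u ω, fun v => B v ω) : (U → Da → ℝ) × (V → Db → ℝ))) P
  /- the feature vectors in each database are i.i.d. with the given mean and covariance -/
  indepA : iIndepFun A P
  indepB : iIndepFun B P
  meanA : ∀ u i, ∫ ω, A u ω i ∂P = μa i
  meanB : ∀ v j, ∫ ω, B v ω j ∂P = μb j
  covA : ∀ u i i', covariance (fun ω => A u ω i) (fun ω => A u ω i') P = Sa i i'
  covB : ∀ v j j', covariance (fun ω => B v ω j) (fun ω => B v ω j') P = Sb j j'
  /- exactly the mapped pairs are correlated across the databases -/
  cov_mapped : ∀ u v, v ∈ M u → ∀ i j,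
    covariance (fun ω => A u ω i) (fun ω => B v ω j) P = Sab i j
  cov_unmapped : ∀ u v, v ∉ M u → ∀ i j,
    covariance (fun ω => A u ω i) (fun ω => B v ω j) P = 0

attribute [instance] CorrelatedGaussianDatabases.fintypeDa CorrelatedGaussianDatabases.fintypeDb
  CorrelatedGaussianDatabases.decidableEqDa CorrelatedGaussianDatabases.decidableEqDb

namespace CorrelatedGaussianDatabases

/-- Density of the features of a user in `U`. -/
def fX (X : CorrelatedGaussianDatabases.{u, v, w}) (x : X.Da → ℝ) : ℝ :=
  gaussianDensity X.μa X.Sa x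

/-- Density of the features of a user in `V`. -/
def fY (X : CorrelatedGaussianDatabases.{u, v, w}) (y : X.Db → ℝ) : ℝ :=
  gaussianDensity X.μb X.Sb y

/-- Joint density of a pair of correlated features. -/
def fXY (X : CorrelatedGaussianDatabases.{u, v, w}) (x : X.Da → ℝ) (y : X.Db → ℝ) : ℝ :=
  gaussianDensity (Sum.elim X.μa X.μb) (Matrix.fromBlocks X.Sa X.Sab X.Sab.transpose X.Sb)
    (Sum.elim x y)

/-- The information density `log (f_XY(x,y) / (f_X(x) f_Y(y)))`. -/
def infoDensity (X : CorrelatedGaussianDatabases.{u, v, w}) (x : X.Da → ℝ) (y : X.Db → ℝ) : ℝ :=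
  Real.log (X.fXY x y / (X.fX x * X.fY y))

/-- The signal strength: the mutual information `∫ f_XY log (f_XY / (f_X f_Y))` between the features
of a correlated pair. -/
def signal (X : CorrelatedGaussianDatabases.{u, v, w}) : ℝ :=
  ∫ p : (X.Da → ℝ) × (X.Db → ℝ), X.fXY p.1 p.2 * X.infoDensity p.1 p.2

/-- The score matrix `G`, the log-likelihood ratios of "mapped" versus "not mapped". -/
def score (X : CorrelatedGaussianDatabases.{u, v, w}) (ω : X.Ω) : Matrix X.U X.V ℝ :=
  fun u v => X.infoDensity (X.A u ω) (X.B v ω)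

end CorrelatedGaussianDatabases

/-- The three algorithms. -/
inductive Algorithm
  | thresholdTesting
  | maxRow
  | maxLikelihood

namespace Algorithm

/-- The constraints of the linear program: `m u v ∈ [0, 1]` for all three algorithms, row sums equal
to `1` for maximum row and maximum likelihood estimation, and column sums at most `1` for maximum
likelihood estimation only. -/
def Feasible {U V : Type*} [Fintype U] [Fintype V] (alg : Algorithm) (m : Matrix U V ℝ) : Prop :=
  (∀ u v, m u v ∈ Set.Icc (0 : ℝ) 1) ∧
  (alg = maxRow ∨ alg = maxLikelihood → ∀ u, ∑ v, m u v = 1) ∧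
  (alg = maxLikelihood → ∀ v, ∑ u, m u v ≤ 1)

/-- The objective `⟨S - τ, m⟩` for the score matrix `S` and the threshold `τ`. -/
def objective {U V : Type*} [Fintype U] [Fintype V] (S : Matrix U V ℝ) (τ : ℝ)
    (m : Matrix U V ℝ) : ℝ :=
  ∑ u, ∑ v, (S u v - τ) * m u v

/-- `m` is an output of the algorithm on the score matrix `S` with threshold `τ`: an integer-valued
solution of the linear program (ties may be broken arbitrarily). -/
def IsOutput {U V : Type*} [Fintype U] [Fintype V] (alg : Algorithm) (S : Matrix U V ℝ) (τ : ℝ)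
    (m : Matrix U V ℝ) : Prop :=
  (∀ u v, m u v = 0 ∨ m u v = 1) ∧ alg.Feasible m ∧
    ∀ m' : Matrix U V ℝ, alg.Feasible m' → objective S τ m' ≤ objective S τ m

/-- The random matrix `m` is almost surely an output of the algorithm on the random scores `S`. -/
def IsEstimator (alg : Algorithm) (X : AlignmentSetting.{u, v}) (S : X.Ω → Matrix X.U X.V ℝ)
    (τ : ℝ) (m : X.Ω → Matrix X.U X.V ℝ) : Prop :=
  (∀ u v, AEMeasurable (fun ω => m ω u v) X.P) ∧ ∀ᵐ ω ∂X.P, alg.IsOutput (S ω) τ (m ω)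

end Algorithm

/-- The regimes for the size of `V`: `|V| = n`, `n < |V| ≤ n + o(n)`, `|V| ≥ n + Ω(n)`. -/
inductive SizeRegime
  | equal
  | slightlyLarger
  | larger

/-- The sequences `n` and `N` (the sizes of `U` and `V`) are in the given regime. -/
def SizeRegime.Holds (n N : ℕ → ℕ) : SizeRegime → Prop
  | equal => ∀ᶠ k in atTop, N k = n k
  | slightlyLarger => (∀ᶠ k in atTop, n k < N k) ∧
      (fun k => (N k : ℝ) - n k) =o[atTop] fun k => (n k : ℝ)
  | larger => ∃ ε : ℝ, 0 < ε ∧ ∀ᶠ k in atTop, (n k : ℝ) + ε * n k ≤ N k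

/-- The constant `c` of the sufficient condition `ζ ≥ c log n + ω(1)` for exact alignment. -/
def exactConstant : Algorithm → SizeRegime → ℝ → ℝ
  | .thresholdTesting, .equal, _ => (1 + √2) ^ 2
  | .thresholdTesting, .slightlyLarger, _ => (1 + √2) ^ 2
  | .thresholdTesting, .larger, α => (1 + √(1 + α)) ^ 2
  | .maxRow, .equal, _ => 4
  | .maxRow, .slightlyLarger, _ => 4
  | .maxRow, .larger, α => (1 + √α) ^ 2
  | .maxLikelihood, .equal, _ => 2
  | .maxLikelihood, .slightlyLarger, α => 2 * (α + 1)
  | .maxLikelihood, .larger, α => (1 + √α) ^ 2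

end

/-! ### Products of measures -/

/-! Both models enter only through a matrix G of log-likelihood ratios of "mapped" against
"unmapped": the information density for databases, μW − ζ for planted matching. All that is used
about G is a short list of exponential moments, `ScoreBounds`, with z = ζ: for one false score, for
one true score, for a false and the true score of the same row, and for the total gain of an
injection σ over the hidden injection ι. The last says E exp(gain/2) ≤ exp(−zd/2) when σ and ι
differ at d users.

For planted matching these are moment generating functions of independent Gaussians. For databases,
integrals of exponentials of quadratic forms are inverse square roots of determinants, all functions
of the squared canonical correlation matrix L (`corrSq`), whose eigenvalues lie in [0,1), and det(1
− L) = exp(−2ζ) (`det_eq_exp`). Scalar inequalities on the eigenvalues compare them with powers of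
det(1 − L). For the gain of σ, Finner's inequality `lintegral_pi_prod_rpow_le` replaces the
determinants of arbitrarily long paths and cycles by that of one 4-cycle.

For the errors, cut the scores at the level y = z(2t − 1). A true score below y costs exp(−z(1−t)²)
and a false score above y costs exp(−zt²). Threshold testing errs only through such entries, so √z ≥
√log n + √(log n + log N) is the borderline. Row maximization errs at u only if the true score is
below y or a false score beats a true score above y; the latter costs exp(−z(1−t)² − zt²), and the
borderline drops to √log n + √log N.

For maximum likelihood, `exists_swapMaps` splits the optimal σ into users that move individually to
an unmapped value, which are row events, and a remaining injection in which unmapped values are no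
more numerous than moves to other mapped values. A weighted count gives at most (2d√κ)^d such
injections for each set of d changed users, where κ ≥ 1 and κ ≥ N − n, so their total contribution
is of order n√κ·exp(−z/2). This vanishes beyond (2 + α) log n. The row events are controlled as
above if N − n is of order at least n, and by a union bound over the N − n unmapped values
otherwise.

For almost-exact alignment the error is divided by n, so it suffices that exp(−z(1−t)²) and
N·exp(−zt²) vanish, which some t achieves once z exceeds log N by ω(√log n). For the two optimizing
algorithms, `card_ne_le_of_sum_nonneg` turns global optimality into the same entrywise exponentials.
Finally log N ≤ max(α,1) log n + log 2. -/

theorem lmarginal_prod_eq {ι : Type*} [Fintype ι] [DecidableEq ι] {E : ι → Type*}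
    [∀ i, MeasurableSpace (E i)] (μ : ∀ i, Measure (E i)) [∀ i, SigmaFinite (μ i)]
    {f : ∀ i, E i → ENNReal} (hf : ∀ i, Measurable (f i)) (s : Finset ι) (x : ∀ i, E i) :
    lmarginal μ s (fun x => ∏ i, f i (x i)) x =
      ∏ i, if i ∈ s then ∫⁻ y, f i y ∂μ i else f i (x i) := by
  have hm : Measurable fun x : ∀ i, E i => ∏ i, f i (x i) :=
    Finset.measurable_fun_prod _ fun i _ => (hf i).comp (measurable_pi_apply i)
  induction s using Finset.induction generalizing x with
  | empty => simp
  | insert i s hi ih =>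
    rw [lmarginal_insert _ hm hi]
    simp_rw [ih]
    have : ∀ y, (∏ j, if j ∈ s then ∫⁻ y, f j y ∂μ j else f j (Function.update x i y j)) =
        f i y * ∏ j ∈ Finset.univ.erase i, if j ∈ s then ∫⁻ y, f j y ∂μ j else f j (x j) := by
      intro y
      rw [← Finset.mul_prod_erase _ _ (Finset.mem_univ i)]
      congr 1
      · simp [hi]
      · refine Finset.prod_congr rfl fun j hj => ?_
        rw [Function.update_of_ne (Finset.ne_of_mem_erase hj)]
    simp_rw [this]
    rw [lintegral_mul_const _ (hf i), ← Finset.mul_prod_erase _ _ (Finset.mem_univ i)]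
    congr 1
    · simp
    · refine Finset.prod_congr rfl fun j hj => ?_
      simp [Finset.mem_insert, Finset.ne_of_mem_erase hj]

theorem lintegral_pi_prod_eq {ι : Type*} [Fintype ι] {E : ι → Type*}
    [∀ i, MeasurableSpace (E i)] (μ : ∀ i, Measure (E i)) [∀ i, SigmaFinite (μ i)]
    {f : ∀ i, E i → ENNReal} (hf : ∀ i, Measurable (f i)) :
    ∫⁻ x, ∏ i, f i (x i) ∂Measure.pi μ = ∏ i, ∫⁻ y, f i y ∂μ i := by
  classical
  by_cases h : Nonempty (∀ i, E i)
  · obtain ⟨x⟩ := h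
    rw [lintegral_eq_lmarginal_univ x, lmarginal_prod_eq μ hf]
    simp
  · have h1 : ∃ i, IsEmpty (E i) := by
      by_contra! h2
      exact h ⟨fun i => (h2 i).some⟩
    obtain ⟨i, hi⟩ := h1
    rw [not_nonempty_iff] at h
    rw [lintegral_of_isEmpty, Finset.prod_eq_zero (Finset.mem_univ i)]
    rw [lintegral_of_isEmpty]

theorem pi_withDensity {ι : Type*} [Fintype ι] {E : ι → Type*}
    [∀ i, MeasurableSpace (E i)] (μ : ∀ i, Measure (E i)) [∀ i, SigmaFinite (μ i)]
    {f : ∀ i, E i → ENNReal} (hf : ∀ i, Measurable (f i))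
    [∀ i, SigmaFinite ((μ i).withDensity (f i))] :
    Measure.pi (fun i => (μ i).withDensity (f i)) =
      (Measure.pi μ).withDensity (fun x => ∏ i, f i (x i)) := by
  refine Measure.pi_eq (μ := fun i => (μ i).withDensity (f i)) fun s hs => ?_
  rw [withDensity_apply _ (MeasurableSet.univ_pi hs),
    ← lintegral_indicator (MeasurableSet.univ_pi hs)]
  have : (fun x : ∀ i, E i => (Set.univ.pi s).indicator (fun x => ∏ i, f i (x i)) x) =
      fun x => ∏ i, (s i).indicator (f i) (x i) := by
    ext x
    by_cases hx : x ∈ Set.univ.pi s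
    · rw [Set.indicator_of_mem hx]
      refine Finset.prod_congr rfl fun i _ => ?_
      rw [Set.indicator_of_mem (hx i (Set.mem_univ i))]
    · rw [Set.indicator_of_notMem hx]
      simp only [Set.mem_pi, Set.mem_univ, true_imp_iff, not_forall] at hx
      obtain ⟨i, hi⟩ := hx
      rw [Finset.prod_eq_zero (Finset.mem_univ i)]
      rw [Set.indicator_of_notMem hi]
  rw [this, lintegral_pi_prod_eq μ fun i => (hf i).indicator (hs i)]
  refine Finset.prod_congr rfl fun i _ => ?_
  rw [lintegral_indicator (hs i), withDensity_apply _ (hs i)]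

theorem map_withDensity_comp {α β : Type*} [MeasurableSpace α] [MeasurableSpace β] (μ : Measure α)
    {φ : α → β} (hφ : Measurable φ) {f : β → ENNReal} (hf : Measurable f) :
    (μ.withDensity (fun x => f (φ x))).map φ = (μ.map φ).withDensity f := by
  ext s hs
  rw [Measure.map_apply hφ hs, withDensity_apply _ (hφ hs), withDensity_apply _ hs,
    setLIntegral_map hs hf hφ]

/-! ### Finner's inequality -/

/-- Hölder with exponents summing to less than one: the missing exponent is given to the constant
function 1, whose integral is 1 on a probability space. -/
theorem lintegral_prod_rpow_le {α κ : Type*} [MeasurableSpace α] (μ : Measure α)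
    [IsProbabilityMeasure μ] (s : Finset κ) {f : κ → α → ENNReal}
    (hf : ∀ j ∈ s, Measurable (f j)) {p : κ → ℝ} (hp : ∀ j ∈ s, 0 ≤ p j)
    (hsum : ∑ j ∈ s, p j ≤ 1) :
    ∫⁻ a, ∏ j ∈ s, f j a ^ p j ∂μ ≤ ∏ j ∈ s, (∫⁻ a, f j a ∂μ) ^ p j := by
  have := ENNReal.lintegral_mul_prod_norm_pow_le (μ := μ) s (g := fun _ => 1)
    aemeasurable_const (fun j hj => (hf j hj).aemeasurable) (1 - ∑ j ∈ s, p j)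
    (p := p) (by ring) (by linarith) hp
  simpa using this

/-- Finner's generalized Hölder inequality for functions of finitely many independent variables:
`f j` depends only on the variables in `T j`, and each variable is covered with total weight at
most one. -/
theorem lintegral_pi_prod_rpow_le {ι κ : Type*} [Fintype ι] [Fintype κ]
    {E : ι → Type*} [∀ i, MeasurableSpace (E i)] (μ : ∀ i, Measure (E i))
    [∀ i, IsProbabilityMeasure (μ i)] {f : κ → (∀ i, E i) → ENNReal}
    (hf : ∀ j, Measurable (f j)) (T : κ → Set ι) (hT : ∀ j, DependsOn (f j) (T j))
    {p : κ → ℝ} (hp : ∀ j, 0 ≤ p j)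
    (hsum : ∀ i, ∀ s : Finset κ, (∀ j ∈ s, i ∈ T j) → ∑ j ∈ s, p j ≤ 1) :
    ∫⁻ x, ∏ j, f j x ^ p j ∂Measure.pi μ ≤ ∏ j, (∫⁻ x, f j x ∂Measure.pi μ) ^ p j := by
  classical
  have hm : Measurable fun x : ∀ i, E i => ∏ j, f j x ^ p j :=
    Finset.measurable_fun_prod _ fun j _ => (hf j).pow_const _
  have hupd : ∀ j (s : Finset ι) i (x : ∀ i, E i) y, i ∉ T j →
      lmarginal μ s (f j) (Function.update x i y) = lmarginal μ s (f j) x := by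
    intro j s i x y hij
    refine lintegral_congr fun z => hT j fun k hk => ?_
    have hki : k ≠ i := fun h => hij (h ▸ hk)
    by_cases hks : k ∈ s
    · simp [Function.updateFinset, hks]
    · simp [Function.updateFinset, hks, Function.update_of_ne hki]
  -- Coordinates are integrated out one at a time. Factors not depending on the new coordinate come
  -- out as constants; the others carry total weight at most one, so the one-variable Hölder
  -- inequality applies to them.
  have key : ∀ s : Finset ι, ∀ x, lmarginal μ s (fun x => ∏ j, f j x ^ p j) x ≤
      ∏ j, (lmarginal μ s (f j) x) ^ p j := by
    intro s
    induction s using Finset.induction with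
    | empty => intro x; simp
    | insert i s hi ih =>
      intro x
      rw [lmarginal_insert _ hm hi]
      calc ∫⁻ y, lmarginal μ s (fun x => ∏ j, f j x ^ p j) (Function.update x i y) ∂μ i
          ≤ ∫⁻ y, ∏ j, (lmarginal μ s (f j) (Function.update x i y)) ^ p j ∂μ i :=
            lintegral_mono fun y => ih _
        _ = ∫⁻ y, (∏ j ∈ Finset.univ.filter (fun j => i ∈ T j),
              (lmarginal μ s (f j) (Function.update x i y)) ^ p j) *
            ∏ j ∈ Finset.univ.filter (fun j => ¬ i ∈ T j), (lmarginal μ s (f j) x) ^ p j ∂μ i := by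
            refine lintegral_congr fun y => ?_
            rw [← Finset.prod_filter_mul_prod_filter_not Finset.univ (fun j => i ∈ T j)]
            congr 1
            refine Finset.prod_congr rfl fun j hj => ?_
            rw [hupd j s i x y (Finset.mem_filter.1 hj).2]
        _ = (∫⁻ y, (∏ j ∈ Finset.univ.filter (fun j => i ∈ T j),
              (lmarginal μ s (f j) (Function.update x i y)) ^ p j) ∂μ i) *
            ∏ j ∈ Finset.univ.filter (fun j => ¬ i ∈ T j), (lmarginal μ s (f j) x) ^ p j := by
            rw [lintegral_mul_const]
            refine Finset.measurable_fun_prod _ fun j _ => Measurable.pow_const ?_ _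
            exact ((hf j).lmarginal μ).comp (measurable_update x)
        _ ≤ (∏ j ∈ Finset.univ.filter (fun j => i ∈ T j),
              (lmarginal μ (insert i s) (f j) x) ^ p j) *
            ∏ j ∈ Finset.univ.filter (fun j => ¬ i ∈ T j),
              (lmarginal μ (insert i s) (f j) x) ^ p j := by
            refine mul_le_mul' ?_ (le_of_eq ?_)
            · refine (lintegral_prod_rpow_le (μ i) _ (fun j _ =>
                ((hf j).lmarginal μ).comp (measurable_update x)) (fun j _ => hp j)
                (hsum i _ fun j hj => (Finset.mem_filter.1 hj).2)).trans (le_of_eq ?_)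
              refine Finset.prod_congr rfl fun j _ => ?_
              rw [lmarginal_insert _ (hf j) hi]
              rfl
            · refine Finset.prod_congr rfl fun j hj => ?_
              rw [lmarginal_insert _ (hf j) hi]
              simp [hupd j s i x _ (Finset.mem_filter.1 hj).2]
        _ = _ := Finset.prod_filter_mul_prod_filter_not Finset.univ (fun j => i ∈ T j) _
  by_cases h : Nonempty (∀ i, E i)
  · obtain ⟨x⟩ := h
    rw [lintegral_eq_lmarginal_univ x]
    refine (key Finset.univ x).trans (le_of_eq ?_)
    simp
  · rw [not_nonempty_iff] at h
    rw [lintegral_of_isEmpty]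
    exact zero_le

/-! ### Densities of Gaussian vectors -/

open scoped MatrixOrder in
-- The positive square root serves as T. Only the factorization matters later: T⁻¹ whitens a
-- Gaussian vector.
theorem Matrix.PosDef.exists_eq_mul_transpose {ι : Type*} [Fintype ι] [DecidableEq ι]
    {S : Matrix ι ι ℝ} (hS : S.PosDef) : ∃ T : Matrix ι ι ℝ, S = T * T.transpose ∧ T.det ≠ 0 := by
  have h1 : CFC.sqrt S * CFC.sqrt S = S := CFC.sqrt_mul_sqrt_self S hS.posSemidef.nonneg
  have h2 : (CFC.sqrt S).transpose = CFC.sqrt S := by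
    simpa [Matrix.IsHermitian] using (Matrix.nonneg_iff_posSemidef.1 (CFC.sqrt_nonneg S)).isHermitian
  refine ⟨CFC.sqrt S, by rw [h2, h1], fun h => ?_⟩
  have := hS.det_pos
  rw [← h1, Matrix.det_mul, h] at this
  simp at this

theorem continuous_gaussianDensity {ι : Type*} [Fintype ι] [DecidableEq ι] (μ : ι → ℝ)
    (S : Matrix ι ι ℝ) : Continuous (gaussianDensity μ S) := by
  unfold gaussianDensity
  have h : Continuous fun x : ι → ℝ => S⁻¹.mulVec (x - μ) := by
    exact Continuous.matrix_mulVec continuous_const (by fun_prop)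
  have h2 : Continuous fun x : ι → ℝ => (x - μ) ⬝ᵥ S⁻¹.mulVec (x - μ) :=
    Continuous.dotProduct (by fun_prop) h
  fun_prop

theorem gaussianDensity_pos {ι : Type*} [Fintype ι] [DecidableEq ι] (μ : ι → ℝ)
    {S : Matrix ι ι ℝ} (hS : S.PosDef) (x : ι → ℝ) : 0 < gaussianDensity μ S x := by
  unfold gaussianDensity
  have := hS.det_pos
  positivity

theorem gaussianDensity_mulVec {ι : Type*} [Fintype ι] [DecidableEq ι] (μ : ι → ℝ)
    {S T : Matrix ι ι ℝ} (hST : S = T * T.transpose) (hT : T.det ≠ 0) (z : ι → ℝ) :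
    gaussianDensity μ S (T.mulVec z) =
      |T.det|⁻¹ * ∏ i, gaussianPDFReal (T⁻¹.mulVec μ i) 1 (z i) := by
  have hu : IsUnit T.det := isUnit_iff_ne_zero.2 hT
  have h1 : T.mulVec z - μ = T.mulVec (z - T⁻¹.mulVec μ) := by
    rw [Matrix.mulVec_sub, Matrix.mulVec_mulVec, Matrix.mul_nonsing_inv _ hu, Matrix.one_mulVec]
  have h2 : (T.mulVec z - μ) ⬝ᵥ S⁻¹.mulVec (T.mulVec z - μ) =
      ∑ i, (z i - T⁻¹.mulVec μ i) ^ 2 := by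
    rw [h1, hST, Matrix.mul_inv_rev, Matrix.mulVec_mulVec, Matrix.mul_assoc,
      Matrix.nonsing_inv_mul _ hu, Matrix.mul_one, Matrix.dotProduct_mulVec,
      ← Matrix.vecMul_transpose, Matrix.vecMul_vecMul, ← Matrix.transpose_nonsing_inv,
      ← Matrix.transpose_mul, Matrix.nonsing_inv_mul _ hu, Matrix.transpose_one, Matrix.vecMul_one]
    simp [dotProduct, sq]
  unfold gaussianDensity gaussianPDFReal
  rw [h2, hST, Matrix.det_mul, Matrix.det_transpose, Finset.prod_mul_distrib, ← Real.exp_sum]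
  simp only [NNReal.coe_one, mul_one, Finset.prod_const, Finset.card_univ]
  rw [Real.sqrt_mul (by positivity), Real.sqrt_mul_self_eq_abs, mul_inv, Finset.mul_sum]
  have h3 : √((2 * Real.pi) ^ Fintype.card ι) = √(2 * Real.pi) ^ Fintype.card ι := by
    rw [Real.sqrt_eq_iff_mul_self_eq (by positivity) (by positivity), ← mul_pow,
      Real.mul_self_sqrt (by positivity)]
  rw [h3, inv_pow, mul_comm _ (|T.det|⁻¹), mul_assoc]
  congr 3
  refine Finset.sum_congr rfl fun i _ => ?_
  ring

/-- Linear change of variables x = Tz: in the z coordinates the density is a product of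
unit-variance densities, up to the Jacobian |det T|. Multivariate Gaussian facts thus reduce to
one-dimensional ones. -/
theorem volume_withDensity_gaussianDensity {ι : Type*} [Fintype ι] [DecidableEq ι] (μ : ι → ℝ)
    {S T : Matrix ι ι ℝ} (hST : S = T * T.transpose) (hT : T.det ≠ 0) :
    (volume : Measure (ι → ℝ)).withDensity (fun x => ENNReal.ofReal (gaussianDensity μ S x)) =
      (Measure.pi fun i => gaussianReal (T⁻¹.mulVec μ i) 1).map (Matrix.toLin' T) := by
  have hφ : Measurable (Matrix.toLin' T) := (LinearMap.continuous_of_finiteDimensional _).measurable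
  have hg : Measurable fun x => ENNReal.ofReal (gaussianDensity μ S x) :=
    (continuous_gaussianDensity μ S).measurable.ennreal_ofReal
  have hpi : (Measure.pi fun i => gaussianReal (T⁻¹.mulVec μ i) 1) =
      (volume : Measure (ι → ℝ)).withDensity
        (fun z => ∏ i, gaussianPDF (T⁻¹.mulVec μ i) 1 (z i)) := by
    have h : ∀ i, gaussianReal (T⁻¹.mulVec μ i) 1 =
        volume.withDensity (gaussianPDF (T⁻¹.mulVec μ i) 1) := fun i =>
      gaussianReal_of_var_ne_zero _ one_ne_zero
    have : ∀ i, SigmaFinite ((volume : Measure ℝ).withDensity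
        (gaussianPDF (T⁻¹.mulVec μ i) 1)) := fun i => by rw [← h]; infer_instance
    simp_rw [h]
    rw [pi_withDensity _ fun i => measurable_gaussianPDF _ _]
    rfl
  have hdens : (fun z => ∏ i, gaussianPDF (T⁻¹.mulVec μ i) 1 (z i)) =
      fun z => ENNReal.ofReal |T.det| * ENNReal.ofReal (gaussianDensity μ S (Matrix.toLin' T z)) := by
    ext z
    rw [Matrix.toLin'_apply, gaussianDensity_mulVec μ hST hT, ← ENNReal.ofReal_mul (abs_nonneg _),
      ← mul_assoc, mul_inv_cancel₀ (abs_ne_zero.2 hT), one_mul,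
      ENNReal.ofReal_prod_of_nonneg fun i _ => gaussianPDFReal_nonneg _ _ _]
    rfl
  rw [hpi, hdens, map_withDensity_comp volume hφ
    (f := fun x => ENNReal.ofReal |T.det| * ENNReal.ofReal (gaussianDensity μ S x))
    (hg.const_mul _), Real.map_matrix_volume_pi_eq_smul_volume_pi hT, withDensity_smul_measure]
  have : (fun x => ENNReal.ofReal |T.det| * ENNReal.ofReal (gaussianDensity μ S x)) =
      ENNReal.ofReal |T.det| • fun x => ENNReal.ofReal (gaussianDensity μ S x) := rfl
  rw [this, withDensity_smul _ hg, smul_smul, ← ENNReal.ofReal_mul (abs_nonneg _), abs_inv,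
    inv_mul_cancel₀ (abs_ne_zero.2 hT), ENNReal.ofReal_one, one_smul]

theorem lintegral_gaussianDensity {ι : Type*} [Fintype ι] [DecidableEq ι] (μ : ι → ℝ)
    {S : Matrix ι ι ℝ} (hS : S.PosDef) :
    ∫⁻ x : ι → ℝ, ENNReal.ofReal (gaussianDensity μ S x) = 1 := by
  obtain ⟨T, hST, hT⟩ := hS.exists_eq_mul_transpose
  have h := congrArg (fun ν => ν Set.univ) (volume_withDensity_gaussianDensity μ hST hT)
  have hφ : Measurable (Matrix.toLin' T) := (LinearMap.continuous_of_finiteDimensional _).measurable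
  simp only [withDensity_apply _ MeasurableSet.univ, Measure.restrict_univ] at h
  rw [h, Measure.map_apply hφ MeasurableSet.univ]
  simp

/-- The Gaussian integral of a positive definite quadratic form. -/
theorem lintegral_exp_neg_quadratic {ι : Type*} [Fintype ι] [DecidableEq ι] (μ : ι → ℝ)
    {Q : Matrix ι ι ℝ} (hQ : Q.PosDef) :
    ∫⁻ x : ι → ℝ, ENNReal.ofReal (Real.exp (-(1 / 2) * ((x - μ) ⬝ᵥ Q.mulVec (x - μ)))) =
      ENNReal.ofReal (√((2 * Real.pi) ^ Fintype.card ι * Q.det⁻¹)) := by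
  have h := lintegral_gaussianDensity μ hQ.inv
  have hd := hQ.det_pos
  have hdet : Q⁻¹.det = Q.det⁻¹ := by
    rw [Matrix.det_nonsing_inv, Ring.inverse_eq_inv']
  unfold gaussianDensity at h
  rw [Matrix.nonsing_inv_nonsing_inv _ (isUnit_iff_ne_zero.2 hd.ne'), hdet] at h
  have hc : 0 < √((2 * Real.pi) ^ Fintype.card ι * Q.det⁻¹) := by positivity
  simp_rw [ENNReal.ofReal_mul (inv_nonneg.2 hc.le)] at h
  rw [lintegral_const_mul' _ _ ENNReal.ofReal_ne_top, ENNReal.ofReal_inv_of_pos hc] at h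
  rw [← inv_inv (ENNReal.ofReal (√_))]
  exact ENNReal.eq_inv_of_mul_eq_one_left (by rw [mul_comm]; exact h)

/-- The vector T⁻¹X is jointly Gaussian with identity covariance, so its coordinates are independent
and its law is a product; applying T gives back X with the explicit density. -/
theorem ProbabilityTheory.HasGaussianLaw.hasLaw_gaussianDensity {ι : Type*} [Fintype ι]
    [DecidableEq ι] {Ω : Type*} [MeasurableSpace Ω] {P : Measure Ω} {X : Ω → ι → ℝ}
    (hX : HasGaussianLaw X P) {μ : ι → ℝ} {S : Matrix ι ι ℝ} (hS : S.PosDef)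
    (hmean : ∀ i, ∫ ω, X ω i ∂P = μ i)
    (hcov : ∀ i j, covariance (fun ω => X ω i) (fun ω => X ω j) P = S i j) :
    HasLaw X (volume.withDensity fun x => ENNReal.ofReal (gaussianDensity μ S x)) P := by
  have hP := hX.isProbabilityMeasure
  obtain ⟨T, hST, hT⟩ := hS.exists_eq_mul_transpose
  have hu : IsUnit T.det := isUnit_iff_ne_zero.2 hT
  have hφ : Measurable (Matrix.toLin' T) := (LinearMap.continuous_of_finiteDimensional _).measurable
  have hmem : ∀ i, MemLp (fun ω => X ω i) 2 P := fun i => (hX.eval i).memLp_two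
  have hZg : HasGaussianLaw (fun ω => T⁻¹.mulVec (X ω)) P :=
    hX.map_fun (LinearMap.toContinuousLinearMap (Matrix.toLin' T⁻¹))
  have hZc : ∀ i j, covariance (fun ω => T⁻¹.mulVec (X ω) i) (fun ω => T⁻¹.mulVec (X ω) j) P =
      (1 : Matrix ι ι ℝ) i j := by
    intro i j
    simp only [Matrix.mulVec, dotProduct]
    rw [covariance_fun_sum_fun_sum (fun k => (hmem k).const_mul _) fun k => (hmem k).const_mul _]
    simp_rw [covariance_const_mul_left, covariance_const_mul_right, hcov]
    have : (T⁻¹ * S * T⁻¹.transpose) i j = (1 : Matrix ι ι ℝ) i j := by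
      rw [hST, ← Matrix.mul_assoc, Matrix.nonsing_inv_mul _ hu, Matrix.one_mul,
        ← Matrix.transpose_mul, Matrix.nonsing_inv_mul _ hu, Matrix.transpose_one]
    rw [← this]
    simp only [Matrix.mul_apply, Finset.sum_mul, Matrix.transpose_apply]
    rw [Finset.sum_comm]
    refine Finset.sum_congr rfl fun k _ => Finset.sum_congr rfl fun l _ => ?_
    ring
  have hZi : iIndepFun (fun i ω => T⁻¹.mulVec (X ω) i) P := by
    refine HasGaussianLaw.iIndepFun_of_covariance_eq_zero hZg fun i j hij => ?_
    rw [hZc, Matrix.one_apply_ne hij]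
  have hZl : ∀ i, P.map (fun ω => T⁻¹.mulVec (X ω) i) = gaussianReal (T⁻¹.mulVec μ i) 1 := by
    intro i
    rw [(hZg.eval i).map_eq_gaussianReal]
    congr 1
    · simp only [Matrix.mulVec, dotProduct]
      rw [integral_finsetSum _ fun k _ => ((hmem k).integrable one_le_two).const_mul _]
      simp_rw [integral_const_mul, hmean]
    · rw [← covariance_self (hZg.eval i).aemeasurable, hZc]
      simp
  have hZ : P.map (fun ω => T⁻¹.mulVec (X ω)) =
      Measure.pi fun i => gaussianReal (T⁻¹.mulVec μ i) 1 := by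
    have := (iIndepFun_iff_map_fun_eq_pi_map fun i => (hZg.eval i).aemeasurable).1 hZi
    simp_rw [hZl] at this
    exact this
  refine ⟨hX.aemeasurable, ?_⟩
  rw [volume_withDensity_gaussianDensity μ hST hT, ← hZ,
    AEMeasurable.map_map_of_aemeasurable hφ.aemeasurable hZg.aemeasurable]
  congr 1
  ext ω : 1
  simp [Matrix.mul_nonsing_inv _ hu]

/-! ### Block covariance matrices -/

section BlockCovariance

open Matrix

variable {a b : Type*} [Fintype a] [Fintype b] [DecidableEq a] [DecidableEq b]

theorem dotProduct_fromBlocks_mulVec {a b : Type*} [Fintype a] [Fintype b]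
    (A : Matrix a a ℝ) (B : Matrix a b ℝ) (C : Matrix b a ℝ)
    (D : Matrix b b ℝ) (x : a → ℝ) (y : b → ℝ) :
    Sum.elim x y ⬝ᵥ (fromBlocks A B C D).mulVec (Sum.elim x y) =
      x ⬝ᵥ A.mulVec x + x ⬝ᵥ B.mulVec y + y ⬝ᵥ C.mulVec x + y ⬝ᵥ D.mulVec y := by
  rw [fromBlocks_mulVec, sumElim_dotProduct_sumElim]
  simp only [Sum.elim_comp_inl, Sum.elim_comp_inr, dotProduct_add]
  ring

/-- The squared canonical correlation matrix `Σa⁻¹ Σab Σb⁻¹ Σabᵀ`. -/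
noncomputable def corrSq (Sa : Matrix a a ℝ) (Sab : Matrix a b ℝ) (Sb : Matrix b b ℝ) : Matrix a a ℝ :=
  Sa⁻¹ * Sab * (Sb⁻¹ * Sab.transpose)

/-- The blocks `P`, `R`, `S` of the inverse of the covariance matrix `[Σa, Σab; Σabᵀ, Σb]`. -/
structure PrecisionBlocks (Sa : Matrix a a ℝ) (Sab : Matrix a b ℝ) (Sb : Matrix b b ℝ)
    (P : Matrix a a ℝ) (R : Matrix a b ℝ) (S : Matrix b b ℝ) : Prop where
  posDef : (fromBlocks Sa Sab Sab.transpose Sb).PosDef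
  inv_eq : (fromBlocks Sa Sab Sab.transpose Sb)⁻¹ = fromBlocks P R R.transpose S
  posDef_Sa : Sa.PosDef
  posDef_Sb : Sb.PosDef
  posDef_P : P.PosDef
  posDef_S : S.PosDef
  R_eq : R = -(Sa⁻¹ * Sab * S)
  R_transpose_eq : R.transpose = -(Sb⁻¹ * Sab.transpose * P)
  Sa_inv : Sa⁻¹ = (1 - corrSq Sa Sab Sb) * P
  Sb_inv : Sb⁻¹ = (1 - Sb⁻¹ * Sab.transpose * (Sa⁻¹ * Sab)) * S

/-- The four block equations of K·K⁻¹ = 1, each multiplied by Sa⁻¹ or Sb⁻¹. -/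
theorem Matrix.PosDef.exists_precisionBlocks {Sa : Matrix a a ℝ} {Sab : Matrix a b ℝ}
    {Sb : Matrix b b ℝ} (h : (fromBlocks Sa Sab Sab.transpose Sb).PosDef) :
    ∃ P R S, PrecisionBlocks Sa Sab Sb P R S := by
  set K := fromBlocks Sa Sab Sab.transpose Sb with hK
  have hSa : Sa.PosDef := by
    exact h.submatrix (e := Sum.inl) Sum.inl_injective
  have hSb : Sb.PosDef := by
    exact h.submatrix (e := Sum.inr) Sum.inr_injective
  set P := (K⁻¹).toBlocks₁₁ with hP
  set R := (K⁻¹).toBlocks₁₂ with hR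
  set S := (K⁻¹).toBlocks₂₂ with hS
  have hsymm : (K⁻¹).transpose = K⁻¹ := by
    simpa [Matrix.IsHermitian] using h.inv.isHermitian
  have hRT : (K⁻¹).toBlocks₂₁ = R.transpose := by
    ext i j
    rw [hR]
    simp only [toBlocks₂₁, toBlocks₁₂, of_apply, transpose_apply]
    conv_lhs => rw [← hsymm]
    rfl
  have hinv : K⁻¹ = fromBlocks P R R.transpose S := by
    rw [← hRT, fromBlocks_toBlocks]
  have hmul : K * fromBlocks P R R.transpose S = 1 := by
    rw [← hinv, mul_nonsing_inv _ (isUnit_iff_ne_zero.2 h.det_pos.ne')]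
  rw [hK, fromBlocks_multiply, ← fromBlocks_one, fromBlocks_inj] at hmul
  obtain ⟨h1, h2, h3, h4⟩ := hmul
  have ua : IsUnit Sa.det := isUnit_iff_ne_zero.2 hSa.det_pos.ne'
  have ub : IsUnit Sb.det := isUnit_iff_ne_zero.2 hSb.det_pos.ne'
  have hReq : R = -(Sa⁻¹ * Sab * S) := by
    have := congrArg (fun M => Sa⁻¹ * M) h2
    simp only [Matrix.mul_add, ← Matrix.mul_assoc, nonsing_inv_mul _ ua, Matrix.one_mul,
      Matrix.mul_zero] at this
    exact eq_neg_of_add_eq_zero_left this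
  have hRTeq : R.transpose = -(Sb⁻¹ * Sab.transpose * P) := by
    have := congrArg (fun M => Sb⁻¹ * M) h3
    simp only [Matrix.mul_add, ← Matrix.mul_assoc, nonsing_inv_mul _ ub, Matrix.one_mul,
      Matrix.mul_zero] at this
    exact eq_neg_of_add_eq_zero_right this
  refine ⟨P, R, S, h, hinv, hSa, hSb, ?_, ?_, hReq, hRTeq, ?_, ?_⟩
  · exact h.inv.submatrix (e := Sum.inl) Sum.inl_injective
  · exact h.inv.submatrix (e := Sum.inr) Sum.inr_injective
  · have := congrArg (fun M => Sa⁻¹ * M) h1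
    simp only [Matrix.mul_add, ← Matrix.mul_assoc, nonsing_inv_mul _ ua, Matrix.one_mul,
      Matrix.mul_one] at this
    rw [← this, hRTeq, corrSq, Matrix.sub_mul, Matrix.one_mul, Matrix.mul_neg, sub_eq_add_neg]
    simp only [Matrix.mul_assoc]
  · have := congrArg (fun M => Sb⁻¹ * M) h4
    simp only [Matrix.mul_add, ← Matrix.mul_assoc, nonsing_inv_mul _ ub, Matrix.one_mul,
      Matrix.mul_one] at this
    conv_lhs => rw [← this, hReq]
    rw [Matrix.sub_mul, Matrix.one_mul, Matrix.mul_neg, sub_eq_add_neg, add_comm]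
    simp only [Matrix.mul_assoc]

namespace PrecisionBlocks

variable {Sa : Matrix a a ℝ} {Sab : Matrix a b ℝ} {Sb : Matrix b b ℝ}
  {P : Matrix a a ℝ} {R : Matrix a b ℝ} {S : Matrix b b ℝ}

theorem posDef_fromBlocks (h : PrecisionBlocks Sa Sab Sb P R S) :
    (fromBlocks P R R.transpose S).PosDef := h.inv_eq ▸ h.posDef.inv

theorem quadratic_pos (h : PrecisionBlocks Sa Sab Sb P R S) {x : a → ℝ} {y : b → ℝ}
    (hxy : Sum.elim x y ≠ 0) :
    0 < Sum.elim x y ⬝ᵥ (fromBlocks P R R.transpose S).mulVec (Sum.elim x y) := by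
  simpa using h.posDef_fromBlocks.dotProduct_mulVec_pos hxy

theorem quadratic_nonneg (h : PrecisionBlocks Sa Sab Sb P R S) (x : a → ℝ) (y : b → ℝ) :
    0 ≤ Sum.elim x y ⬝ᵥ (fromBlocks P R R.transpose S).mulVec (Sum.elim x y) := by
  simpa using h.posDef_fromBlocks.posSemidef.dotProduct_mulVec_nonneg (Sum.elim x y)

/-- The marginal form is the minimum over y of the joint one. The difference is the K⁻¹-form at the
regression residual (0, y − SabᵀSa⁻¹x), hence nonnegative. It compensates the negative multiple of
Sa⁻¹ in `lintegral_exp_path_le`. -/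
theorem le_quadratic (h : PrecisionBlocks Sa Sab Sb P R S) (x : a → ℝ) (y : b → ℝ) :
    x ⬝ᵥ (Sa⁻¹).mulVec x ≤
      Sum.elim x y ⬝ᵥ (fromBlocks P R R.transpose S).mulVec (Sum.elim x y) := by
  set K := fromBlocks Sa Sab Sab.transpose Sb with hK
  set z := Sum.elim x y with hz
  -- Chosen so that Kp has first block x; then z − Kp is the residual.
  set p : a ⊕ b → ℝ := Sum.elim ((Sa⁻¹).mulVec x) 0 with hp
  have ua : IsUnit Sa.det := isUnit_iff_ne_zero.2 h.posDef_Sa.det_pos.ne'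
  have uK : IsUnit K.det := isUnit_iff_ne_zero.2 h.posDef.det_pos.ne'
  have h0 : 0 ≤ (z - K.mulVec p) ⬝ᵥ (K⁻¹).mulVec (z - K.mulVec p) := by
    simpa using h.posDef.inv.posSemidef.dotProduct_mulVec_nonneg (z - K.mulVec p)
  have hKT : K.transpose = K := by simpa [Matrix.IsHermitian] using h.posDef.isHermitian
  have h1 : (K.mulVec p) ⬝ᵥ (K⁻¹).mulVec z = p ⬝ᵥ z := by
    rw [← vecMul_transpose, hKT, ← dotProduct_mulVec, mulVec_mulVec, mul_nonsing_inv _ uK,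
      one_mulVec]
  have h2 : p ⬝ᵥ z = x ⬝ᵥ (Sa⁻¹).mulVec x := by
    rw [hp, hz, sumElim_dotProduct_sumElim]
    simp [dotProduct_comm]
  have h3 : p ⬝ᵥ K.mulVec p = x ⬝ᵥ (Sa⁻¹).mulVec x := by
    rw [hp, hK, dotProduct_fromBlocks_mulVec]
    simp [mulVec_mulVec, mul_nonsing_inv _ ua, dotProduct_comm]
  have h4 : (K⁻¹).mulVec (K.mulVec p) = p := by
    rw [mulVec_mulVec, nonsing_inv_mul _ uK, one_mulVec]
  rw [mulVec_sub, h4, sub_dotProduct, dotProduct_sub, dotProduct_sub, h1,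
    dotProduct_comm (K.mulVec p) p, h3, dotProduct_comm z p, h2] at h0
  rw [← h.inv_eq]
  linarith

theorem det_eq (h : PrecisionBlocks Sa Sab Sb P R S) :
    (fromBlocks Sa Sab Sab.transpose Sb).det = Sa.det * Sb.det * (1 - corrSq Sa Sab Sb).det := by
  have ua : IsUnit Sa.det := isUnit_iff_ne_zero.2 h.posDef_Sa.det_pos.ne'
  have ub : IsUnit Sb.det := isUnit_iff_ne_zero.2 h.posDef_Sb.det_pos.ne'
  have h1 : fromBlocks Sa Sab Sab.transpose Sb =
      fromBlocks Sa 0 0 Sb * fromBlocks 1 (Sa⁻¹ * Sab) (Sb⁻¹ * Sab.transpose) 1 := by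
    rw [fromBlocks_multiply]
    simp only [← Matrix.mul_assoc, mul_nonsing_inv _ ua, mul_nonsing_inv _ ub, Matrix.one_mul,
      Matrix.mul_one, Matrix.zero_mul, add_zero, zero_add]
  rw [h1, det_mul, det_fromBlocks_zero₂₁, det_fromBlocks_one₂₂, corrSq]

theorem det_corr_pos (h : PrecisionBlocks Sa Sab Sb P R S) :
    0 < (1 - corrSq Sa Sab Sb).det := by
  have h1 := h.posDef.det_pos
  rw [h.det_eq] at h1
  exact pos_of_mul_pos_right h1 (mul_pos h.posDef_Sa.det_pos h.posDef_Sb.det_pos).le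

theorem det_P (h : PrecisionBlocks Sa Sab Sb P R S) :
    Sa.det * P.det = ((1 - corrSq Sa Sab Sb).det)⁻¹ := by
  have h1 := congrArg det h.Sa_inv
  rw [det_mul, det_nonsing_inv, Ring.inverse_eq_inv'] at h1
  have h2 := h.posDef_Sa.det_pos.ne'
  have h3 := h.det_corr_pos.ne'
  field_simp at h1 ⊢
  linarith

theorem det_S (h : PrecisionBlocks Sa Sab Sb P R S) :
    Sb.det * S.det = ((1 - corrSq Sa Sab Sb).det)⁻¹ := by
  have h1 := congrArg det h.Sb_inv
  rw [det_mul, det_nonsing_inv, Ring.inverse_eq_inv', det_one_sub_mul_comm] at h1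
  change _ = (1 - corrSq Sa Sab Sb).det * _ at h1
  have h2 := h.posDef_Sb.det_pos.ne'
  have h3 := h.det_corr_pos.ne'
  field_simp at h1 ⊢
  linarith

/-- The l i are the squared canonical correlations. Whitening by a root of Sa makes `corrSq` similar
to a symmetric matrix N; N ≥ 0 gives l i ≥ 0, and positivity of the Schur complement, whitened to 1
− N, gives l i < 1. Every determinant below becomes a product over these numbers. -/
theorem exists_eigenvalues (h : PrecisionBlocks Sa Sab Sb P R S) :
    ∃ l : a → ℝ, (∀ i, 0 ≤ l i ∧ l i < 1) ∧
      ∀ c : ℝ, (1 - c • corrSq Sa Sab Sb).det = ∏ i, (1 - c * l i) := by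
  obtain ⟨T, hST, hT⟩ := h.posDef_Sa.exists_eq_mul_transpose
  have uT : IsUnit T.det := isUnit_iff_ne_zero.2 hT
  have ua : IsUnit Sa.det := isUnit_iff_ne_zero.2 h.posDef_Sa.det_pos.ne'
  have uTT : IsUnit T.transpose.det := by rwa [det_transpose]
  set N : Matrix a a ℝ := T⁻¹ * Sab * Sb⁻¹ * (T⁻¹ * Sab).transpose with hN
  have hconj : corrSq Sa Sab Sb = (T.transpose)⁻¹ * N * T.transpose := by
    rw [corrSq, hN, hST, Matrix.mul_inv_rev, transpose_mul, transpose_nonsing_inv]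
    simp only [Matrix.mul_assoc, nonsing_inv_mul _ uTT, Matrix.mul_one]
  have hdet : ∀ c : ℝ, (1 - c • corrSq Sa Sab Sb).det = (1 - c • N).det := by
    intro c
    have : 1 - c • corrSq Sa Sab Sb = (T.transpose)⁻¹ * (1 - c • N) * T.transpose := by
      rw [hconj, Matrix.mul_sub, Matrix.sub_mul, Matrix.mul_one, nonsing_inv_mul _ uTT,
        Matrix.mul_smul, Matrix.smul_mul]
    rw [this, det_mul, det_mul, mul_right_comm, ← det_mul, nonsing_inv_mul _ uTT, det_one, one_mul]
  have hNpos : N.PosSemidef := by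
    have := h.posDef_Sb.inv.posSemidef.mul_mul_conjTranspose_same (T⁻¹ * Sab)
    rwa [conjTranspose_eq_transpose_of_trivial] at this
  -- The Schur complement is P⁻¹, so it inherits positive definiteness from P.
  have hschur : (Sa - Sab * (Sb⁻¹ * Sab.transpose)).PosDef := by
    have h1 : (Sa - Sab * (Sb⁻¹ * Sab.transpose)) * P = 1 := by
      have := congrArg (fun M => Sa * M) h.Sa_inv
      simp only [mul_nonsing_inv _ ua, corrSq, ← Matrix.mul_assoc, Matrix.mul_sub, Matrix.mul_one,
        Matrix.one_mul] at this
      rw [this]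
      simp only [Matrix.mul_assoc]
    rw [← inv_eq_left_inv h1]
    exact h.posDef_P.inv
  have h1N : (1 - N).PosDef := by
    have h2 : 1 - N = T⁻¹ * (Sa - Sab * (Sb⁻¹ * Sab.transpose)) * (T⁻¹).conjTranspose := by
      rw [hN, Matrix.mul_sub, Matrix.sub_mul, hST, ← Matrix.mul_assoc T⁻¹ T, nonsing_inv_mul _ uT,
        Matrix.one_mul, conjTranspose_eq_transpose_of_trivial, ← transpose_mul,
        nonsing_inv_mul _ uT, transpose_one, transpose_mul]
      simp only [Matrix.mul_assoc]
    rw [h2]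
    refine hschur.mul_mul_conjTranspose_same fun x y hxy => ?_
    have := congrArg (fun v => v ᵥ* T) hxy
    simpa [vecMul_vecMul, nonsing_inv_mul _ uT] using this
  have hH := hNpos.isHermitian
  refine ⟨hH.eigenvalues, fun i => ⟨hNpos.eigenvalues_nonneg i, ?_⟩, fun c => ?_⟩
  · set e : a → ℝ := (hH.eigenvectorBasis i).ofLp with he
    have hee : N.mulVec e = hH.eigenvalues i • e := hH.mulVec_eigenvectorBasis i
    have hne : e ≠ 0 := by
      intro h0
      have h1 := hH.eigenvectorBasis.orthonormal.ne_zero i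
      apply h1
      ext j
      exact congrFun h0 j
    have h3 := h1N.dotProduct_mulVec_pos hne
    rw [sub_mulVec, one_mulVec, hee] at h3
    have h4 : 0 < (1 - hH.eigenvalues i) * (e ⬝ᵥ e) := by
      simpa [dotProduct_sub, sub_mul] using h3
    have h5 : 0 ≤ e ⬝ᵥ e := by simpa using dotProduct_star_self_nonneg e
    nlinarith
  · rw [hdet]
    have hs := hH.spectral_theorem
    rw [Unitary.conjStarAlgAut_apply] at hs
    set U := hH.eigenvectorUnitary with hU
    set D : Matrix a a ℝ := diagonal (RCLike.ofReal ∘ hH.eigenvalues) with hD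
    have h5 : 1 - c • N = (U : Matrix a a ℝ) * (1 - c • D) * (star U : Matrix a a ℝ) := by
      rw [Matrix.mul_sub, Matrix.sub_mul, Matrix.mul_one, Matrix.mul_smul, Matrix.smul_mul,
        ← hs]
      congr 1
      exact (Unitary.mul_star_self_of_mem U.2).symm
    have h6 : (U : Matrix a a ℝ).det * (star U : Matrix a a ℝ).det = 1 := by
      rw [← det_mul]
      have : (U : Matrix a a ℝ) * (star U : Matrix a a ℝ) = 1 := Unitary.mul_star_self_of_mem U.2
      rw [this, det_one]
    rw [h5, det_mul, det_mul, mul_right_comm, h6, one_mul]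
    have h7 : 1 - c • D = diagonal fun i => 1 - c * hH.eigenvalues i := by
      ext i j
      by_cases hij : i = j
      · subst hij
        simp [hD]
      · simp [hD, hij]
    rw [h7, det_diagonal]

end PrecisionBlocks

end BlockCovariance

/-! ### Determinant inequalities -/

theorem one_sub_rpow_le {x p : ℝ} (hx1 : x < 1) (hp0 : 0 ≤ p) (hp1 : p ≤ 1) :
    (1 - x) ^ p ≤ 1 - p * x := by
  have := rpow_one_add_le_one_add_mul_self (s := -x) (by linarith) hp0 hp1
  simpa [sub_eq_add_neg] using this

/-- Both sides agree at x = 0, and the logarithm of their ratio is monotone on [0,1). This is the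
eigenvalue inequality behind the path bound, with s = 1 − t. -/
theorem one_sub_rpow_two_mul_sq_le {x s : ℝ} (hx0 : 0 ≤ x) (hx1 : x < 1) (hs0 : 0 ≤ s)
    (hs1 : s ≤ 1 / 2) :
    (1 - x) ^ (2 * s ^ 2) ≤ (1 - s * x) * (1 + s * (1 - 2 * s) * x) := by
  set r := s * (1 - 2 * s) with hr
  have hr0 : 0 ≤ r := mul_nonneg hs0 (by linarith)
  set h : ℝ → ℝ := fun y =>
    Real.log (1 - s * y) + Real.log (1 + r * y) - 2 * s ^ 2 * Real.log (1 - y) with hh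
  have hp1 : ∀ y, 0 ≤ y → y < 1 → 0 < 1 - s * y := fun y hy0 hy1 => by nlinarith
  have hp2 : ∀ y, 0 ≤ y → 0 < 1 + r * y := fun y hy0 => by positivity
  have hd : ∀ y, 0 ≤ y → y < 1 →
      HasDerivAt h ((-s) / (1 - s * y) + r / (1 + r * y) - 2 * s ^ 2 * ((-1) / (1 - y))) y := by
    intro y hy0 hy1
    have e1 : HasDerivAt (fun y => 1 - s * y) (-s) y := by
      simpa using ((hasDerivAt_id y).const_mul s).const_sub 1
    have e2 : HasDerivAt (fun y => 1 + r * y) r y := by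
      simpa using ((hasDerivAt_id y).const_mul r).const_add 1
    have e3 : HasDerivAt (fun y : ℝ => 1 - y) (-1) y := by
      simpa using (hasDerivAt_id y).const_sub 1
    exact ((e1.log (hp1 y hy0 hy1).ne').add (e2.log (hp2 y hy0).ne')).sub
      ((e3.log (by linarith)).const_mul _)
  have hmono : MonotoneOn h (Set.Ico 0 1) := by
    refine monotoneOn_of_deriv_nonneg (convex_Ico 0 1) ?_ ?_ ?_
    · exact fun y hy => (hd y hy.1 hy.2).continuousAt.continuousWithinAt
    · rw [interior_Ico]
      exact fun y hy => (hd y hy.1.le hy.2).differentiableAt.differentiableWithinAt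
    · rw [interior_Ico]
      intro y hy
      rw [(hd y hy.1.le hy.2).deriv]
      have q1 := hp1 y hy.1.le hy.2
      have q2 := hp2 y hy.1.le
      have q3 : 0 < 1 - y := by linarith [hy.2]
      -- Over the common denominator, the terms of the numerator that are linear and quadratic in y
      -- have nonnegative coefficients exactly because 0 ≤ s ≤ 1/2; the constant term cancels.
      have : (-s) / (1 - s * y) + r / (1 + r * y) - 2 * s ^ 2 * ((-1) / (1 - y)) =
          2 * s ^ 2 * (2 * s * (1 - s) * y + (1 - 2 * s) * (1 - s ^ 2) * y ^ 2) /
            ((1 - s * y) * (1 + r * y) * (1 - y)) := by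
        rw [div_add_div _ _ q1.ne' q2.ne', ← mul_div_assoc,
          div_sub_div _ _ (mul_pos q1 q2).ne' q3.ne']
        congr 1
        rw [hr]
        ring
      rw [this]
      have hs2 : 0 ≤ 1 - 2 * s := by linarith
      have hs3 : 0 ≤ 1 - s := by linarith
      have hs4 : 0 ≤ 1 - s ^ 2 := by nlinarith
      have := hy.1
      positivity
  have h0 : h 0 ≤ h x := hmono ⟨le_rfl, zero_lt_one⟩ ⟨hx0, hx1⟩ hx0
  have q1 := hp1 x hx0 hx1
  have q2 := hp2 x hx0
  rw [Real.rpow_def_of_pos (by linarith), ← Real.exp_log (mul_pos q1 q2),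
    Real.log_mul q1.ne' q2.ne', Real.exp_le_exp]
  simp only [hh, mul_zero, sub_zero, add_zero, Real.log_one] at h0
  linarith

namespace PrecisionBlocks

open Matrix

variable {a b : Type*} [Fintype a] [Fintype b] [DecidableEq a] [DecidableEq b]
  {Sa : Matrix a a ℝ} {Sab : Matrix a b ℝ} {Sb : Matrix b b ℝ}
  {P : Matrix a a ℝ} {R : Matrix a b ℝ} {S : Matrix b b ℝ}

/-- Bernoulli's inequality at each eigenvalue. -/
theorem det_rpow_le (h : PrecisionBlocks Sa Sab Sb P R S) {s : ℝ} (hs0 : 0 ≤ s) (hs1 : s ≤ 1) :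
    (1 - corrSq Sa Sab Sb).det ^ (s ^ 2) ≤ (1 - s ^ 2 • corrSq Sa Sab Sb).det := by
  obtain ⟨l, hl, hdet⟩ := h.exists_eigenvalues
  have h1 := hdet 1
  simp only [one_smul, one_mul] at h1
  rw [h1, hdet, ← Real.finsetProd_rpow _ _ fun i _ => by linarith [(hl i).2]]
  exact Finset.prod_le_prod (fun i _ => Real.rpow_nonneg (by linarith [(hl i).2]) _)
    fun i _ => one_sub_rpow_le (hl i).2 (sq_nonneg s) (by nlinarith)

theorem det_rpow_two_mul_le (h : PrecisionBlocks Sa Sab Sb P R S) {s : ℝ} (hs0 : 0 ≤ s)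
    (hs1 : s ≤ 1 / 2) :
    (1 - corrSq Sa Sab Sb).det ^ (2 * s ^ 2) ≤ (1 - s • corrSq Sa Sab Sb).det *
      (1 + (s * (1 - 2 * s)) • corrSq Sa Sab Sb).det := by
  obtain ⟨l, hl, hdet⟩ := h.exists_eigenvalues
  have h1 := hdet 1
  have h2 := hdet (-(s * (1 - 2 * s)))
  simp only [one_smul, one_mul] at h1
  simp only [neg_smul, sub_neg_eq_add, neg_mul] at h2
  rw [h1, hdet, h2, ← Real.finsetProd_rpow _ _ fun i _ => by linarith [(hl i).2],
    ← Finset.prod_mul_distrib]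
  exact Finset.prod_le_prod (fun i _ => Real.rpow_nonneg (by linarith [(hl i).2]) _)
    fun i _ => one_sub_rpow_two_mul_sq_le (hl i).1 (hl i).2 hs0 hs1

theorem det_one_sub_smul_pos (h : PrecisionBlocks Sa Sab Sb P R S) {s : ℝ} (hs : s ≤ 1) :
    0 < (1 - s • corrSq Sa Sab Sb).det := by
  obtain ⟨l, hl, hdet⟩ := h.exists_eigenvalues
  rw [hdet]
  refine Finset.prod_pos fun i _ => ?_
  have := hl i
  nlinarith

end PrecisionBlocks

/-! ### Gaussian measures with density -/

section GaussianMeasure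

variable {ι : Type*} [Fintype ι] [DecidableEq ι]

/-- The Gaussian measure with density `gaussianDensity μ S`. -/
noncomputable def gaussianMeasure (μ : ι → ℝ) (S : Matrix ι ι ℝ) : Measure (ι → ℝ) :=
  volume.withDensity fun x => ENNReal.ofReal (gaussianDensity μ S x)

theorem measurable_ofReal_gaussianDensity (μ : ι → ℝ) (S : Matrix ι ι ℝ) :
    Measurable fun x => ENNReal.ofReal (gaussianDensity μ S x) :=
  (continuous_gaussianDensity μ S).measurable.ennreal_ofReal

theorem isProbabilityMeasure_gaussianMeasure (μ : ι → ℝ) {S : Matrix ι ι ℝ} (hS : S.PosDef) :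
    IsProbabilityMeasure (gaussianMeasure μ S) :=
  ⟨by simp [gaussianMeasure, lintegral_gaussianDensity μ hS]⟩

instance sigmaFinite_gaussianMeasure (μ : ι → ℝ) (S : Matrix ι ι ℝ) :
    SigmaFinite (gaussianMeasure μ S) := by
  unfold gaussianMeasure
  infer_instance

/-- The tilt replaces the precision D⁻¹ by Q in the exponent, while the normalization stays that of
D. Every exponential moment of the information density is an instance of this formula, so only det D
· det Q has to be computed. -/
theorem lintegral_gaussianMeasure_exp (μ : ι → ℝ) {D Q : Matrix ι ι ℝ} (hD : D.PosDef)
    (hQ : Q.PosDef) :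
    ∫⁻ x, ENNReal.ofReal (Real.exp (-(1 / 2) * ((x - μ) ⬝ᵥ Q.mulVec (x - μ) -
      (x - μ) ⬝ᵥ (D⁻¹).mulVec (x - μ)))) ∂gaussianMeasure μ D =
      ENNReal.ofReal (√(D.det * Q.det))⁻¹ := by
  have hd := hD.det_pos
  have hq := hQ.det_pos
  rw [gaussianMeasure, lintegral_withDensity_eq_lintegral_mul₀]
  rotate_left
  · exact (measurable_ofReal_gaussianDensity μ D).aemeasurable
  · have h2 : ∀ M : Matrix ι ι ℝ, Continuous fun x : ι → ℝ => (x - μ) ⬝ᵥ M.mulVec (x - μ) :=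
      fun M => Continuous.dotProduct (by fun_prop)
        (Continuous.matrix_mulVec continuous_const (by fun_prop))
    have := h2 Q
    have := h2 D⁻¹
    exact (by fun_prop : Continuous _).measurable.ennreal_ofReal.aemeasurable
  have : ∀ x : ι → ℝ, ((fun x => ENNReal.ofReal (gaussianDensity μ D x)) *
      fun x => ENNReal.ofReal (Real.exp (-(1 / 2) * ((x - μ) ⬝ᵥ Q.mulVec (x - μ) -
      (x - μ) ⬝ᵥ (D⁻¹).mulVec (x - μ))))) x =
      ENNReal.ofReal (√((2 * Real.pi) ^ Fintype.card ι * D.det))⁻¹ *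
        ENNReal.ofReal (Real.exp (-(1 / 2) * ((x - μ) ⬝ᵥ Q.mulVec (x - μ)))) := by
    intro x
    rw [Pi.mul_apply, ← ENNReal.ofReal_mul (gaussianDensity_pos μ hD x).le,
      ← ENNReal.ofReal_mul (by positivity), gaussianDensity, mul_assoc, ← Real.exp_add]
    congr 3
    ring
  simp_rw [this]
  rw [lintegral_const_mul' _ _ ENNReal.ofReal_ne_top, lintegral_exp_neg_quadratic μ hQ,
    ← ENNReal.ofReal_mul (by positivity), ← Real.sqrt_inv, ← Real.sqrt_mul (by positivity),
    ← Real.sqrt_inv]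
  congr 2
  field_simp

theorem Matrix.PosDef.inv_fromBlocks_zero {a b : Type*} [Fintype a] [Fintype b] [DecidableEq a]
    [DecidableEq b] {Sa : Matrix a a ℝ} {Sb : Matrix b b ℝ} (hSa : Sa.PosDef) (hSb : Sb.PosDef) :
    (Matrix.fromBlocks Sa 0 0 Sb)⁻¹ = Matrix.fromBlocks Sa⁻¹ 0 0 Sb⁻¹ := by
  have ua : IsUnit Sa.det := isUnit_iff_ne_zero.2 hSa.det_pos.ne'
  have ub : IsUnit Sb.det := isUnit_iff_ne_zero.2 hSb.det_pos.ne'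
  refine Matrix.inv_eq_left_inv ?_
  rw [Matrix.fromBlocks_multiply, Matrix.nonsing_inv_mul _ ua, Matrix.nonsing_inv_mul _ ub]
  simp

theorem gaussianDensity_sumElim {a b : Type*} [Fintype a] [Fintype b] [DecidableEq a]
    [DecidableEq b] (μa : a → ℝ) (μb : b → ℝ) {Sa : Matrix a a ℝ} {Sb : Matrix b b ℝ}
    (hSa : Sa.PosDef) (hSb : Sb.PosDef) (x : a → ℝ) (y : b → ℝ) :
    gaussianDensity (Sum.elim μa μb) (Matrix.fromBlocks Sa 0 0 Sb) (Sum.elim x y) =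
      gaussianDensity μa Sa x * gaussianDensity μb Sb y := by
  have ha := hSa.det_pos
  have hb := hSb.det_pos
  have hsub : Sum.elim x y - Sum.elim μa μb = Sum.elim (x - μa) (y - μb) := by
    ext (i | i) <;> rfl
  unfold gaussianDensity
  rw [hsub, hSa.inv_fromBlocks_zero hSb, dotProduct_fromBlocks_mulVec, Matrix.det_fromBlocks_zero₂₁, Fintype.card_sum,
    mul_mul_mul_comm, ← Real.exp_add, ← mul_inv, ← Real.sqrt_mul (by positivity)]
  congr 3
  · ring
  · simp
    ring

theorem Matrix.PosDef.fromBlocks_zero {a b : Type*} [Fintype a] [Fintype b] 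
    {Sa : Matrix a a ℝ} {Sb : Matrix b b ℝ} (hSa : Sa.PosDef) (hSb : Sb.PosDef) :
    (Matrix.fromBlocks Sa 0 0 Sb).PosDef := by
  refine Matrix.PosDef.of_dotProduct_mulVec_pos ?_ fun z hz => ?_
  · exact Matrix.IsHermitian.fromBlocks hSa.isHermitian (by simp) hSb.isHermitian
  · obtain ⟨x, y, rfl⟩ : ∃ x y, z = Sum.elim x y := ⟨_, _, (Sum.elim_comp_inl_inr z).symm⟩
    rw [star_trivial, dotProduct_fromBlocks_mulVec]
    have h1 := hSa.posSemidef.dotProduct_mulVec_nonneg x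
    have h2 := hSb.posSemidef.dotProduct_mulVec_nonneg y
    simp only [star_trivial] at h1 h2
    by_cases hx : x = 0
    · by_cases hy : y = 0
      · exfalso
        apply hz
        subst hx hy
        ext (i | i) <;> rfl
      · have := hSb.dotProduct_mulVec_pos hy
        simp only [star_trivial] at this
        simp
        linarith
    · have := hSa.dotProduct_mulVec_pos hx
      simp only [star_trivial] at this
      simp
      linarith

/-- Used to merge independent Gaussian vectors into one vector with block-diagonal covariance, to
which `lintegral_gaussianMeasure_exp` applies. -/
theorem gaussianMeasure_prod {a b : Type*} [Fintype a] [Fintype b] [DecidableEq a]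
    [DecidableEq b] (μa : a → ℝ) (μb : b → ℝ) {Sa : Matrix a a ℝ} {Sb : Matrix b b ℝ}
    (hSa : Sa.PosDef) (hSb : Sb.PosDef) :
    (gaussianMeasure μa Sa).prod (gaussianMeasure μb Sb) =
      (gaussianMeasure (Sum.elim μa μb) (Matrix.fromBlocks Sa 0 0 Sb)).map
        (MeasurableEquiv.sumPiEquivProdPi fun _ : a ⊕ b => ℝ) := by
  have hmp := volume_measurePreserving_sumPiEquivProdPi fun _ : a ⊕ b => ℝ
  have h1 : (gaussianMeasure μa Sa).prod (gaussianMeasure μb Sb) =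
      (volume : Measure ((a → ℝ) × (b → ℝ))).withDensity
        (fun p => ENNReal.ofReal (gaussianDensity μa Sa p.1) *
          ENNReal.ofReal (gaussianDensity μb Sb p.2)) :=
    prod_withDensity (measurable_ofReal_gaussianDensity μa Sa)
      (measurable_ofReal_gaussianDensity μb Sb)
  have h2 : gaussianMeasure (Sum.elim μa μb) (Matrix.fromBlocks Sa 0 0 Sb) =
      volume.withDensity (fun z => (fun p : (a → ℝ) × (b → ℝ) =>
        ENNReal.ofReal (gaussianDensity μa Sa p.1) * ENNReal.ofReal (gaussianDensity μb Sb p.2))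
          ((MeasurableEquiv.sumPiEquivProdPi fun _ : a ⊕ b => ℝ) z)) := by
    unfold gaussianMeasure
    congr 1
    ext z
    refine Eq.trans ?_ (ENNReal.ofReal_mul (gaussianDensity_pos μa hSa _).le)
    congr 1
    exact (congrArg _ (Sum.elim_comp_inl_inr z).symm).trans
      (gaussianDensity_sumElim μa μb hSa hSb _ _)
  have h3 := map_withDensity_comp volume hmp.measurable
    (((measurable_ofReal_gaussianDensity μa Sa).comp measurable_fst).mul
      ((measurable_ofReal_gaussianDensity μb Sb).comp measurable_snd))
  rw [hmp.map_eq] at h3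
  rw [h1, h2]
  exact h3.symm

theorem lintegral_gaussianMeasure_prod {a b : Type*} [Fintype a] [Fintype b] [DecidableEq a]
    [DecidableEq b] (μa : a → ℝ) (μb : b → ℝ) {Sa : Matrix a a ℝ} {Sb : Matrix b b ℝ}
    (hSa : Sa.PosDef) (hSb : Sb.PosDef) {f : (a → ℝ) × (b → ℝ) → ENNReal} :
    ∫⁻ p, f p ∂(gaussianMeasure μa Sa).prod (gaussianMeasure μb Sb) =
      ∫⁻ z, f (fun i => z (Sum.inl i), fun i => z (Sum.inr i))
        ∂gaussianMeasure (Sum.elim μa μb) (Matrix.fromBlocks Sa 0 0 Sb) := by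
  rw [gaussianMeasure_prod μa μb hSa hSb, lintegral_map_equiv]
  rfl

end GaussianMeasure

/-! ### Exponential moments of the information density -/

section InfoDensity

open Matrix

variable {a b : Type*} [Fintype a] [Fintype b] [DecidableEq a] [DecidableEq b]

/-- The log-likelihood ratio of the joint and the product Gaussian distributions. -/
noncomputable def gaussianInfoDensity (μa : a → ℝ) (μb : b → ℝ) (Sa : Matrix a a ℝ)
    (Sab : Matrix a b ℝ) (Sb : Matrix b b ℝ) (x : a → ℝ) (y : b → ℝ) : ℝ :=
  Real.log (gaussianDensity (Sum.elim μa μb) (fromBlocks Sa Sab Sab.transpose Sb) (Sum.elim x y) /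
    (gaussianDensity μa Sa x * gaussianDensity μb Sb y))

variable {Sa : Matrix a a ℝ} {Sab : Matrix a b ℝ} {Sb : Matrix b b ℝ}
  {P : Matrix a a ℝ} {R : Matrix a b ℝ} {S : Matrix b b ℝ}

namespace PrecisionBlocks

/-- The powers of 2π and the determinants of Sa and Sb cancel, leaving det(1 − L) and a difference
of three quadratic forms. -/
theorem gaussianInfoDensity_eq (h : PrecisionBlocks Sa Sab Sb P R S) (μa : a → ℝ) (μb : b → ℝ)
    (x : a → ℝ) (y : b → ℝ) :
    gaussianInfoDensity μa μb Sa Sab Sb x y =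
      -(1 / 2) * Real.log (1 - corrSq Sa Sab Sb).det -
      (1 / 2) * (Sum.elim (x - μa) (y - μb) ⬝ᵥ
          (fromBlocks P R R.transpose S).mulVec (Sum.elim (x - μa) (y - μb)) -
        (x - μa) ⬝ᵥ (Sa⁻¹).mulVec (x - μa) - (y - μb) ⬝ᵥ (Sb⁻¹).mulVec (y - μb)) := by
  have ha := h.posDef_Sa.det_pos
  have hb := h.posDef_Sb.det_pos
  have hd := h.det_corr_pos
  have hsub : Sum.elim x y - Sum.elim μa μb = Sum.elim (x - μa) (y - μb) := by
    ext (i | i) <;> rfl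
  rw [gaussianInfoDensity,
    Real.log_div (gaussianDensity_pos _ h.posDef _).ne'
      (mul_pos (gaussianDensity_pos _ h.posDef_Sa _) (gaussianDensity_pos _ h.posDef_Sb _)).ne',
    Real.log_mul (gaussianDensity_pos _ h.posDef_Sa _).ne' (gaussianDensity_pos _ h.posDef_Sb _).ne']
  unfold gaussianDensity
  rw [hsub, h.inv_eq, h.det_eq, Fintype.card_sum]
  have hl : ∀ (n : ℕ) (c r : ℝ), 0 < c → Real.log ((√((2 * Real.pi) ^ n * c))⁻¹ * Real.exp r) =
      -(1 / 2) * (n * Real.log (2 * Real.pi) + Real.log c) + r := by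
    intro n c r hc
    rw [Real.log_mul (by positivity) (Real.exp_pos r).ne', Real.log_exp, Real.log_inv,
      Real.log_sqrt (by positivity), Real.log_mul (by positivity) hc.ne', Real.log_pow]
    ring
  rw [hl _ _ _ (by positivity), hl _ _ _ ha, hl _ _ _ hb,
    Real.log_mul (by positivity) hd.ne', Real.log_mul ha.ne' hb.ne']
  push_cast
  ring

theorem continuous_gaussianInfoDensity (h : PrecisionBlocks Sa Sab Sb P R S) (μa : a → ℝ)
    (μb : b → ℝ) :
    Continuous fun p : (a → ℝ) × (b → ℝ) => gaussianInfoDensity μa μb Sa Sab Sb p.1 p.2 := by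
  unfold gaussianInfoDensity
  have h1 : Continuous fun p : (a → ℝ) × (b → ℝ) => (Sum.elim p.1 p.2 : a ⊕ b → ℝ) :=
    continuous_pi fun i => by rcases i with i | i <;> simp <;> fun_prop
  refine Continuous.log ?_ fun p => ?_
  · refine Continuous.div ((continuous_gaussianDensity _ _).comp h1)
      (((continuous_gaussianDensity _ _).comp continuous_fst).mul
        ((continuous_gaussianDensity _ _).comp continuous_snd)) fun p => ?_
    exact (mul_pos (gaussianDensity_pos _ h.posDef_Sa _) (gaussianDensity_pos _ h.posDef_Sb _)).ne'
  · exact (div_pos (gaussianDensity_pos _ h.posDef _)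
      (mul_pos (gaussianDensity_pos _ h.posDef_Sa _) (gaussianDensity_pos _ h.posDef_Sb _))).ne'

theorem exp_gaussianInfoDensity (h : PrecisionBlocks Sa Sab Sb P R S) (μa : a → ℝ) (μb : b → ℝ)
    (x : a → ℝ) (y : b → ℝ) :
    Real.exp (gaussianInfoDensity μa μb Sa Sab Sb x y) * (gaussianDensity μa Sa x *
      gaussianDensity μb Sb y) = gaussianDensity (Sum.elim μa μb)
        (fromBlocks Sa Sab Sab.transpose Sb) (Sum.elim x y) := by
  have h1 := gaussianDensity_pos μa h.posDef_Sa x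
  have h2 := gaussianDensity_pos μb h.posDef_Sb y
  have h3 := gaussianDensity_pos (Sum.elim μa μb) h.posDef (Sum.elim x y)
  rw [gaussianInfoDensity, Real.exp_log (by positivity)]
  field_simp

/-- Tilting the independent law by t times the information density gives precision Q = tK⁻¹ +
(1−t)D⁻¹ and det D · det Q = det(1 − (1−t)²L)/det(1 − L). `det_rpow_le` with s = 1 − t finishes.
With det(1 − L) = exp(−2ζ) the bound reads exp(−ζt(1−t)). -/
theorem lintegral_exp_mul_infoDensity_le (h : PrecisionBlocks Sa Sab Sb P R S) (μa : a → ℝ)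
    (μb : b → ℝ) {t : ℝ} (ht0 : 0 ≤ t) (ht1 : t ≤ 1) :
    ∫⁻ p, ENNReal.ofReal (Real.exp (t * gaussianInfoDensity μa μb Sa Sab Sb p.1 p.2))
      ∂(gaussianMeasure μa Sa).prod (gaussianMeasure μb Sb) ≤
      ENNReal.ofReal ((1 - corrSq Sa Sab Sb).det ^ (t * (1 - t) / 2)) := by
  set d := (1 - corrSq Sa Sab Sb).det with hd
  have hd0 : 0 < d := h.det_corr_pos
  set D := fromBlocks Sa 0 0 Sb with hD
  set K := fromBlocks Sa Sab Sab.transpose Sb with hK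
  have hDp : D.PosDef := h.posDef_Sa.fromBlocks_zero h.posDef_Sb
  have uD : IsUnit D.det := isUnit_iff_ne_zero.2 hDp.det_pos.ne'
  have uK : IsUnit K.det := isUnit_iff_ne_zero.2 h.posDef.det_pos.ne'
  set Q := t • K⁻¹ + (1 - t) • D⁻¹ with hQ
  have hQp : Q.PosDef := by
    rcases ht0.eq_or_lt with h0 | h0
    · simpa [hQ, ← h0] using hDp.inv
    · exact (h.posDef.inv.smul h0).add_posSemidef
        (hDp.inv.posSemidef.smul (by linarith : 0 ≤ 1 - t))
  have hdet : D.det * Q.det = (1 - (1 - t) ^ 2 • corrSq Sa Sab Sb).det / d := by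
    have h1 : Q = K⁻¹ * (t • D + (1 - t) • K) * D⁻¹ := by
      rw [Matrix.mul_add, Matrix.add_mul, Matrix.mul_smul, Matrix.mul_smul, nonsing_inv_mul _ uK,
        Matrix.smul_mul, Matrix.smul_mul, Matrix.mul_assoc, mul_nonsing_inv _ uD, Matrix.mul_one,
        Matrix.one_mul]
    have ua : IsUnit Sa.det := isUnit_iff_ne_zero.2 h.posDef_Sa.det_pos.ne'
    have ub : IsUnit Sb.det := isUnit_iff_ne_zero.2 h.posDef_Sb.det_pos.ne'
    have h2 : t • D + (1 - t) • K = D * fromBlocks 1 ((1 - t) • (Sa⁻¹ * Sab))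
        ((1 - t) • (Sb⁻¹ * Sab.transpose)) 1 := by
      rw [hD, hK, fromBlocks_multiply, fromBlocks_smul, fromBlocks_smul, fromBlocks_add]
      simp only [Matrix.mul_smul, ← Matrix.mul_assoc, mul_nonsing_inv _ ua, mul_nonsing_inv _ ub,
        Matrix.one_mul, Matrix.mul_one, Matrix.zero_mul, smul_zero, add_zero, zero_add,
        ← add_smul]
      simp
    rw [h1, h2, det_mul, det_mul, det_mul, det_fromBlocks_one₂₂, det_nonsing_inv, det_nonsing_inv,
      Ring.inverse_eq_inv', h.det_eq]
    have h3 : D.det = Sa.det * Sb.det := by rw [hD, det_fromBlocks_zero₂₁]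
    have h4 := h.posDef_Sa.det_pos.ne'
    have h5 := h.posDef_Sb.det_pos.ne'
    rw [h3, Matrix.smul_mul, Matrix.mul_smul, smul_smul, ← sq, ← corrSq, ← hd]
    field_simp
  rw [lintegral_gaussianMeasure_prod μa μb h.posDef_Sa h.posDef_Sb]
  have key : ∀ z : a ⊕ b → ℝ, ENNReal.ofReal (Real.exp (t * gaussianInfoDensity μa μb Sa Sab Sb
      (fun i => z (Sum.inl i)) fun i => z (Sum.inr i))) = ENNReal.ofReal (d ^ (-(t / 2))) *
      ENNReal.ofReal (Real.exp (-(1 / 2) * ((z - Sum.elim μa μb) ⬝ᵥ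
        Q.mulVec (z - Sum.elim μa μb) -
      (z - Sum.elim μa μb) ⬝ᵥ (D⁻¹).mulVec (z - Sum.elim μa μb)))) := by
    intro z
    have hz : z - Sum.elim μa μb =
        Sum.elim ((fun i => z (Sum.inl i)) - μa) ((fun i => z (Sum.inr i)) - μb) := by
      ext (i | i) <;> rfl
    rw [h.gaussianInfoDensity_eq, ← ENNReal.ofReal_mul (by positivity), Real.rpow_def_of_pos hd0,
      ← Real.exp_add, hz, hQ, add_mulVec, smul_mulVec, smul_mulVec, dotProduct_add,
      dotProduct_smul, dotProduct_smul, hK, h.inv_eq, hD, 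
      h.posDef_Sa.inv_fromBlocks_zero h.posDef_Sb, dotProduct_fromBlocks_mulVec Sa⁻¹]
    simp only [zero_mulVec, dotProduct_zero, add_zero, smul_eq_mul]
    congr 2
    rw [← hd]
    ring
  simp_rw [key]
  rw [lintegral_const_mul' _ _ ENNReal.ofReal_ne_top, lintegral_gaussianMeasure_exp _ hDp hQp,
    ← ENNReal.ofReal_mul (by positivity), hdet]
  refine ENNReal.ofReal_le_ofReal ?_
  have h6 := h.det_rpow_le (s := 1 - t) (by linarith) (by linarith)
  have h7 : d ^ ((1 - t) ^ 2 - 1) ≤ (1 - (1 - t) ^ 2 • corrSq Sa Sab Sb).det / d := by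
    rw [Real.rpow_sub hd0, Real.rpow_one]
    gcongr
  have h8 : (√((1 - (1 - t) ^ 2 • corrSq Sa Sab Sb).det / d))⁻¹ ≤
      (√(d ^ ((1 - t) ^ 2 - 1)))⁻¹ := by
    gcongr
  refine (mul_le_mul_of_nonneg_left h8 (by positivity)).trans (le_of_eq ?_)
  rw [Real.sqrt_eq_rpow, ← Real.rpow_mul hd0.le, ← Real.rpow_neg hd0.le, ← Real.rpow_add hd0]
  congr 1
  ring

end PrecisionBlocks

theorem lintegral_prod_gaussianMeasure_prod {α : Type*} [MeasurableSpace α] (ν : Measure α)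
    [SFinite ν] (μa : a → ℝ) (μb : b → ℝ) {Sa : Matrix a a ℝ} {Sb : Matrix b b ℝ}
    (hSa : Sa.PosDef) (hSb : Sb.PosDef) {f : α × (a → ℝ) × (b → ℝ) → ENNReal} (hf : Measurable f) :
    ∫⁻ p, f p ∂ν.prod ((gaussianMeasure μa Sa).prod (gaussianMeasure μb Sb)) =
      ∫⁻ p, f (p.1, fun i => p.2 (Sum.inl i), fun i => p.2 (Sum.inr i))
        ∂ν.prod (gaussianMeasure (Sum.elim μa μb) (fromBlocks Sa 0 0 Sb)) := by
  rw [gaussianMeasure_prod μa μb hSa hSb]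
  have h := Measure.map_prod_map ν (gaussianMeasure (Sum.elim μa μb) (fromBlocks Sa 0 0 Sb))
    measurable_id (MeasurableEquiv.sumPiEquivProdPi fun _ : a ⊕ b => ℝ).measurable
  rw [Measure.map_id] at h
  rw [h, lintegral_map hf (by fun_prop)]
  rfl

theorem lintegral_prod_prod_gaussianMeasure (μa : a → ℝ) (μb : b → ℝ) {Sa : Matrix a a ℝ}
    {Sb : Matrix b b ℝ} (hSa : Sa.PosDef) (hSb : Sb.PosDef)
    {f : ((a → ℝ) × (a → ℝ)) × (b → ℝ) × (b → ℝ) → ENNReal} (hf : Measurable f) :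
    ∫⁻ p, f p ∂((gaussianMeasure μa Sa).prod (gaussianMeasure μa Sa)).prod
        ((gaussianMeasure μb Sb).prod (gaussianMeasure μb Sb)) =
      ∫⁻ z, f ((fun i => z (Sum.inl (Sum.inl i)), fun i => z (Sum.inl (Sum.inr i))),
        (fun i => z (Sum.inr (Sum.inl i)), fun i => z (Sum.inr (Sum.inr i))))
        ∂gaussianMeasure (Sum.elim (Sum.elim μa μa) (Sum.elim μb μb))
          (fromBlocks (fromBlocks Sa 0 0 Sa) 0 0 (fromBlocks Sb 0 0 Sb)) := by
  have hg : Measurable fun q : (b ⊕ b → ℝ) × (a → ℝ) × (a → ℝ) =>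
      f (q.2, (fun i => q.1 (Sum.inl i), fun i => q.1 (Sum.inr i))) :=
    hf.comp (by fun_prop)
  rw [lintegral_prod_gaussianMeasure_prod _ μb μb hSb hSb hf, ← lintegral_prod_swap]
  refine (lintegral_prod_gaussianMeasure_prod _ μa μa hSa hSa hg).trans ?_
  rw [← lintegral_prod_swap, lintegral_gaussianMeasure_prod _ _ (hSa.fromBlocks_zero hSa)
    (hSb.fromBlocks_zero hSb)]
  rfl

namespace PrecisionBlocks

/-- The moment for one x shared by two values y and y'. Reweighting to the true law of one of the
pairs turns it into the bound for a false score against the true score of the same row. -/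
theorem lintegral_exp_path_le (h : PrecisionBlocks Sa Sab Sb P R S) (μa : a → ℝ)
    (μb : b → ℝ) {t : ℝ} (ht0 : 1 / 2 ≤ t) (ht1 : t ≤ 1) :
    ∫⁻ p, ENNReal.ofReal (Real.exp (t * gaussianInfoDensity μa μb Sa Sab Sb p.1 p.2.1 +
        t * gaussianInfoDensity μa μb Sa Sab Sb p.1 p.2.2))
      ∂(gaussianMeasure μa Sa).prod ((gaussianMeasure μb Sb).prod (gaussianMeasure μb Sb)) ≤
      ENNReal.ofReal ((1 - corrSq Sa Sab Sb).det ^ (t * (1 - t))) := by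
  set L := corrSq Sa Sab Sb with hL
  set d := (1 - L).det with hd
  have hd0 : 0 < d := h.det_corr_pos
  set D2 := fromBlocks Sb 0 0 Sb with hD2
  set D := fromBlocks Sa 0 0 D2 with hD
  have hD2p : D2.PosDef := h.posDef_Sb.fromBlocks_zero h.posDef_Sb
  have hDp : D.PosDef := h.posDef_Sa.fromBlocks_zero hD2p
  set Q := fromBlocks (t • P + t • P + (1 - 2 * t) • Sa⁻¹) (fromCols (t • R) (t • R))
    (fromRows (t • R.transpose) (t • R.transpose))
    (fromBlocks (t • S + (1 - t) • Sb⁻¹) 0 0 (t • S + (1 - t) • Sb⁻¹)) with hQ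
  have hquad : ∀ x y y', Sum.elim x (Sum.elim y y') ⬝ᵥ Q.mulVec (Sum.elim x (Sum.elim y y')) =
      t * (Sum.elim x y ⬝ᵥ (fromBlocks P R R.transpose S).mulVec (Sum.elim x y)) +
      t * (Sum.elim x y' ⬝ᵥ (fromBlocks P R R.transpose S).mulVec (Sum.elim x y')) +
      (1 - 2 * t) * (x ⬝ᵥ (Sa⁻¹).mulVec x) +
      (1 - t) * (y ⬝ᵥ (Sb⁻¹).mulVec y + y' ⬝ᵥ (Sb⁻¹).mulVec y') := by
    intro x y y'
    rw [hQ]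
    simp only [dotProduct_fromBlocks_mulVec, fromCols_mulVec_sumElim, fromRows_mulVec,
      sumElim_dotProduct_sumElim, add_mulVec, smul_mulVec, dotProduct_add, dotProduct_smul,
      zero_mulVec, dotProduct_zero, smul_eq_mul]
    ring
  have hQp : Q.PosDef := by
    refine Matrix.PosDef.of_dotProduct_mulVec_pos ?_ fun z hz => ?_
    · have hP : P.transpose = P := by simpa [Matrix.IsHermitian] using h.posDef_P.isHermitian
      have hS : S.transpose = S := by simpa [Matrix.IsHermitian] using h.posDef_S.isHermitian
      have hSa : (Sa⁻¹).transpose = Sa⁻¹ := by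
        simpa [Matrix.IsHermitian] using h.posDef_Sa.inv.isHermitian
      have hSb : (Sb⁻¹).transpose = Sb⁻¹ := by
        simpa [Matrix.IsHermitian] using h.posDef_Sb.inv.isHermitian
      rw [Matrix.IsHermitian, conjTranspose_eq_transpose_of_trivial, hQ, fromBlocks_transpose,
        fromBlocks_transpose, transpose_fromRows, transpose_fromCols]
      simp only [transpose_add, transpose_smul, hP, hS, hSa, hSb, transpose_transpose,
        transpose_zero]
    · obtain ⟨x, y, y', rfl⟩ : ∃ x y y', z = Sum.elim x (Sum.elim y y') :=
        ⟨fun i => z (Sum.inl i), fun i => z (Sum.inr (Sum.inl i)),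
          fun i => z (Sum.inr (Sum.inr i)), by ext (i | i | i) <;> rfl⟩
      rw [star_trivial, hquad]
      have l1 := h.le_quadratic x y
      have l2 := h.le_quadratic x y'
      -- The coefficient 1 − 2t of the Sa⁻¹-form is nonpositive. Bounding that form by the average
      -- of the two joint forms leaves at least half of their sum.
      have n1 := h.quadratic_nonneg x y
      have n2 := h.quadratic_nonneg x y'
      have m1 : 0 ≤ y ⬝ᵥ (Sb⁻¹).mulVec y := by
        simpa using h.posDef_Sb.inv.posSemidef.dotProduct_mulVec_nonneg y
      have m2 : 0 ≤ y' ⬝ᵥ (Sb⁻¹).mulVec y' := by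
        simpa using h.posDef_Sb.inv.posSemidef.dotProduct_mulVec_nonneg y'
      have m3 : 0 ≤ (1 - t) * (y ⬝ᵥ (Sb⁻¹).mulVec y + y' ⬝ᵥ (Sb⁻¹).mulVec y') :=
        mul_nonneg (by linarith) (by linarith)
      have hpos : 0 < Sum.elim x y ⬝ᵥ (fromBlocks P R R.transpose S).mulVec (Sum.elim x y) +
          Sum.elim x y' ⬝ᵥ (fromBlocks P R R.transpose S).mulVec (Sum.elim x y') := by
        by_cases h1 : Sum.elim x y = 0
        · have h2 : Sum.elim x y' ≠ 0 := by
            intro h2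
            apply hz
            ext (i | i | i)
            · exact congrFun h1 (Sum.inl i)
            · exact congrFun h1 (Sum.inr i)
            · exact congrFun h2 (Sum.inr i)
          linarith [h.quadratic_pos h2]
        · linarith [h.quadratic_pos h1]
      nlinarith
  set C1 := Sa⁻¹ * Sab with hC1
  set C2 := Sb⁻¹ * Sab.transpose with hC2
  have hL12 : C1 * C2 = L := rfl
  set N := 1 - (1 - t) • (C2 * C1) with hN
  have hNdet : N.det = (1 - (1 - t) • L).det := by
    rw [hN, ← Matrix.smul_mul, det_one_sub_mul_comm, Matrix.mul_smul, hL12]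
  have hNpos : 0 < (1 - (1 - t) • L).det := h.det_one_sub_smul_pos (by linarith)
  have hdet : D.det * Q.det = (1 - (1 - t) • L).det *
      (1 + ((1 - t) * (1 - 2 * (1 - t))) • L).det / d ^ 2 := by
    set Mid := fromBlocks (1 - (1 - 2 * t) • L) (fromCols (-(t • C1)) (-(t • C1)))
      (fromRows (-(t • C2)) (-(t • C2))) (fromBlocks N 0 0 N) with hMid
    have h1 : Q = Mid * fromBlocks P 0 0 (fromBlocks S 0 0 S) := by
      rw [hMid, hQ, fromBlocks_multiply, fromCols_mul_fromBlocks, fromRows_mul,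
        fromBlocks_multiply]
      have e1 : (1 - (1 - 2 * t) • L) * P = t • P + t • P + (1 - 2 * t) • Sa⁻¹ := by
        rw [h.Sa_inv, Matrix.sub_mul, Matrix.sub_mul, Matrix.smul_mul, Matrix.one_mul, ← hL]
        module
      have e2 : -(t • C1) * S = t • R := by
        rw [h.R_eq, Matrix.neg_mul, Matrix.smul_mul, smul_neg]
      have e3 : -(t • C2) * P = t • R.transpose := by
        rw [h.R_transpose_eq, Matrix.neg_mul, Matrix.smul_mul, smul_neg]
      have e4 : N * S = t • S + (1 - t) • Sb⁻¹ := by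
        rw [h.Sb_inv, hN, Matrix.sub_mul, Matrix.sub_mul, Matrix.smul_mul, Matrix.one_mul]
        module
      simp only [e1, e2, e3, e4, Matrix.mul_zero, Matrix.zero_mul, add_zero, zero_add]
    -- Column elimination without inverting N: the lower left block vanishes because C2(1 −
    -- (1−t)C1C2) = (1 − (1−t)C2C1)C2. The extra factor det(1 − (1−t)L) = det N is positive and
    -- cancels afterwards.
    have h2 : Mid * fromBlocks (1 - (1 - t) • L) 0 (fromRows (t • C2) (t • C2)) 1 =
        fromBlocks ((1 - L) * (1 + ((1 - t) * (1 - 2 * (1 - t))) • L))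
          (fromCols (-(t • C1)) (-(t • C1))) 0 (fromBlocks N 0 0 N) := by
      rw [hMid, fromBlocks_multiply, fromCols_mul_fromRows, fromBlocks_mul_fromRows, fromRows_mul]
      have e1 : (1 - (1 - 2 * t) • L) * (1 - (1 - t) • L) +
          (-(t • C1) * t • C2 + -(t • C1) * t • C2) =
          (1 - L) * (1 + ((1 - t) * (1 - 2 * (1 - t))) • L) := by
        simp only [Matrix.sub_mul, Matrix.mul_sub, Matrix.mul_add, Matrix.neg_mul, Matrix.smul_mul,
          Matrix.mul_smul, Matrix.one_mul, Matrix.mul_one, hL12]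
        module
      have e2 : -(t • C2) * (1 - (1 - t) • L) + N * (t • C2) = 0 := by
        rw [hN, ← hL12]
        simp only [Matrix.sub_mul, Matrix.mul_sub, Matrix.neg_mul, Matrix.smul_mul,
          Matrix.mul_smul, Matrix.one_mul, Matrix.mul_one, Matrix.mul_assoc]
        module
      rw [e1]
      congr 1
      · simp
      · ext (i | i) j
        · simpa using congrFun (congrFun e2 i) j
        · simpa using congrFun (congrFun e2 i) j
      · simp
    have h3 := congrArg det h2
    rw [det_mul, det_fromBlocks_zero₁₂, det_fromBlocks_zero₂₁, det_fromBlocks_zero₂₁, det_one,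
      mul_one, det_mul, hNdet] at h3
    have h4 : Mid.det = d * (1 + ((1 - t) * (1 - 2 * (1 - t))) • L).det *
        (1 - (1 - t) • L).det := by
      apply mul_right_cancel₀ hNpos.ne'
      rw [h3]
      ring
    rw [h1, det_mul, h4, hD, hD2]
    simp only [det_fromBlocks_zero₂₁]
    have hP := h.det_P
    have hS := h.det_S
    rw [← hL, ← hd] at hP hS
    calc Sa.det * (Sb.det * Sb.det) * (d * (1 + ((1 - t) * (1 - 2 * (1 - t))) • L).det *
          (1 - (1 - t) • L).det * (P.det * (S.det * S.det)))
        = (Sa.det * P.det) * (Sb.det * S.det) * (Sb.det * S.det) * d *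
          ((1 - (1 - t) • L).det * (1 + ((1 - t) * (1 - 2 * (1 - t))) • L).det) := by ring
      _ = _ := by
        rw [hP, hS]
        field_simp
  have hmeas : Measurable fun p : (a → ℝ) × (b → ℝ) × (b → ℝ) =>
      ENNReal.ofReal (Real.exp (t * gaussianInfoDensity μa μb Sa Sab Sb p.1 p.2.1 +
        t * gaussianInfoDensity μa μb Sa Sab Sb p.1 p.2.2)) := by
    have c1 := (h.continuous_gaussianInfoDensity μa μb).comp
      (by fun_prop : Continuous fun p : (a → ℝ) × (b → ℝ) × (b → ℝ) => (p.1, p.2.1))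
    have c2 := (h.continuous_gaussianInfoDensity μa μb).comp
      (by fun_prop : Continuous fun p : (a → ℝ) × (b → ℝ) × (b → ℝ) => (p.1, p.2.2))
    exact (Real.continuous_exp.comp ((c1.const_mul t).add
      (c2.const_mul t))).measurable.ennreal_ofReal
  rw [lintegral_prod_gaussianMeasure_prod _ μb μb h.posDef_Sb h.posDef_Sb hmeas,
    lintegral_gaussianMeasure_prod μa _ h.posDef_Sa hD2p]
  set m := Sum.elim μa (Sum.elim μb μb) with hm
  have key : ∀ z : a ⊕ (b ⊕ b) → ℝ, ENNReal.ofReal (Real.exp (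
      t * gaussianInfoDensity μa μb Sa Sab Sb (fun i => z (Sum.inl i))
        (fun i => z (Sum.inr (Sum.inl i))) +
      t * gaussianInfoDensity μa μb Sa Sab Sb (fun i => z (Sum.inl i))
        (fun i => z (Sum.inr (Sum.inr i))))) = ENNReal.ofReal (d ^ (-t)) *
      ENNReal.ofReal (Real.exp (-(1 / 2) * ((z - m) ⬝ᵥ Q.mulVec (z - m) -
      (z - m) ⬝ᵥ (D⁻¹).mulVec (z - m)))) := by
    intro z
    have hz : z - m = Sum.elim ((fun i => z (Sum.inl i)) - μa)
        (Sum.elim ((fun i => z (Sum.inr (Sum.inl i))) - μb)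
          ((fun i => z (Sum.inr (Sum.inr i))) - μb)) := by
      ext (i | i | i) <;> rfl
    rw [h.gaussianInfoDensity_eq, h.gaussianInfoDensity_eq, ← ENNReal.ofReal_mul (by positivity),
      Real.rpow_def_of_pos hd0, ← Real.exp_add, hz, hquad, hD,
      h.posDef_Sa.inv_fromBlocks_zero hD2p, dotProduct_fromBlocks_mulVec Sa⁻¹, hD2,
      h.posDef_Sb.inv_fromBlocks_zero h.posDef_Sb, dotProduct_fromBlocks_mulVec Sb⁻¹]
    simp only [zero_mulVec, dotProduct_zero, add_zero]
    congr 2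
    rw [← hd]
    ring
  simp_rw [key]
  rw [lintegral_const_mul' _ _ ENNReal.ofReal_ne_top, lintegral_gaussianMeasure_exp _ hDp hQp,
    ← ENNReal.ofReal_mul (by positivity), hdet]
  refine ENNReal.ofReal_le_ofReal ?_
  have h6 := h.det_rpow_two_mul_le (s := 1 - t) (by linarith) (by linarith)
  have h7 : d ^ (2 * (1 - t) ^ 2 - 2) ≤ (1 - (1 - t) • L).det *
      (1 + ((1 - t) * (1 - 2 * (1 - t))) • L).det / d ^ 2 := by
    rw [Real.rpow_sub hd0, Real.rpow_two]
    gcongr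
  have h8 : (√((1 - (1 - t) • L).det *
      (1 + ((1 - t) * (1 - 2 * (1 - t))) • L).det / d ^ 2))⁻¹ ≤
      (√(d ^ (2 * (1 - t) ^ 2 - 2)))⁻¹ := by
    gcongr
  refine (mul_le_mul_of_nonneg_left h8 (by positivity)).trans (le_of_eq ?_)
  rw [Real.sqrt_eq_rpow, ← Real.rpow_mul hd0.le, ← Real.rpow_neg hd0.le, ← Real.rpow_add hd0]
  congr 1
  ring

/-- Each vertex of the 4-cycle lies in two pairs of weight 1/2, so the marginal forms Sa⁻¹ and Sb⁻¹
drop out of the tilted precision. What remains has det D · det Q = det(1 − L)⁻³, and the moment is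
exactly exp(−ζ). -/
theorem lintegral_exp_cycle_eq (h : PrecisionBlocks Sa Sab Sb P R S) (μa : a → ℝ)
    (μb : b → ℝ) :
    ∫⁻ p, ENNReal.ofReal (Real.exp (1 / 2 * (gaussianInfoDensity μa μb Sa Sab Sb p.1.1 p.2.1 +
        gaussianInfoDensity μa μb Sa Sab Sb p.1.1 p.2.2 +
        gaussianInfoDensity μa μb Sa Sab Sb p.1.2 p.2.1 +
        gaussianInfoDensity μa μb Sa Sab Sb p.1.2 p.2.2)))
      ∂((gaussianMeasure μa Sa).prod (gaussianMeasure μa Sa)).prod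
        ((gaussianMeasure μb Sb).prod (gaussianMeasure μb Sb)) =
      ENNReal.ofReal ((1 - corrSq Sa Sab Sb).det ^ (1 / 2 : ℝ)) := by
  set L := corrSq Sa Sab Sb with hL
  set d := (1 - L).det with hd
  have hd0 : 0 < d := h.det_corr_pos
  set D1 := fromBlocks Sa 0 0 Sa with hD1
  set D2 := fromBlocks Sb 0 0 Sb with hD2
  set D := fromBlocks D1 0 0 D2 with hD
  have hD1p : D1.PosDef := h.posDef_Sa.fromBlocks_zero h.posDef_Sa
  have hD2p : D2.PosDef := h.posDef_Sb.fromBlocks_zero h.posDef_Sb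
  have hDp : D.PosDef := hD1p.fromBlocks_zero hD2p
  set r : ℝ := 1 / 2 with hr
  set Q := fromBlocks (fromBlocks P 0 0 P) (fromBlocks (r • R) (r • R) (r • R) (r • R))
    (fromBlocks (r • R.transpose) (r • R.transpose) (r • R.transpose) (r • R.transpose))
    (fromBlocks S 0 0 S) with hQ
  have hquad : ∀ x x' y y', Sum.elim (Sum.elim x x') (Sum.elim y y') ⬝ᵥ
      Q.mulVec (Sum.elim (Sum.elim x x') (Sum.elim y y')) =
      r * (Sum.elim x y ⬝ᵥ (fromBlocks P R R.transpose S).mulVec (Sum.elim x y)) +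
      r * (Sum.elim x y' ⬝ᵥ (fromBlocks P R R.transpose S).mulVec (Sum.elim x y')) +
      r * (Sum.elim x' y ⬝ᵥ (fromBlocks P R R.transpose S).mulVec (Sum.elim x' y)) +
      r * (Sum.elim x' y' ⬝ᵥ (fromBlocks P R R.transpose S).mulVec (Sum.elim x' y')) := by
    intro x x' y y'
    rw [hQ, dotProduct_fromBlocks_mulVec]
    simp only [fromBlocks_mulVec, Sum.elim_comp_inl,
      Sum.elim_comp_inr, sumElim_dotProduct_sumElim, smul_mulVec, dotProduct_add,
      dotProduct_smul, zero_mulVec, dotProduct_zero, smul_eq_mul]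
    rw [hr]
    ring
  have hQp : Q.PosDef := by
    refine Matrix.PosDef.of_dotProduct_mulVec_pos ?_ fun z hz => ?_
    · have hP : P.transpose = P := by simpa [Matrix.IsHermitian] using h.posDef_P.isHermitian
      have hS : S.transpose = S := by simpa [Matrix.IsHermitian] using h.posDef_S.isHermitian
      rw [Matrix.IsHermitian, conjTranspose_eq_transpose_of_trivial, hQ]
      simp only [fromBlocks_transpose, transpose_smul, hP, hS, transpose_transpose, transpose_zero]
    · obtain ⟨x, x', y, y', rfl⟩ : ∃ x x' y y', z = Sum.elim (Sum.elim x x') (Sum.elim y y') :=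
        ⟨fun i => z (Sum.inl (Sum.inl i)), fun i => z (Sum.inl (Sum.inr i)),
          fun i => z (Sum.inr (Sum.inl i)), fun i => z (Sum.inr (Sum.inr i)),
          by ext ((i | i) | i | i) <;> rfl⟩
      rw [star_trivial, hquad, hr]
      have n1 := h.quadratic_nonneg x y
      have n2 := h.quadratic_nonneg x y'
      have n3 := h.quadratic_nonneg x' y
      have n4 := h.quadratic_nonneg x' y'
      by_cases h1 : Sum.elim x y = 0
      · have h2 : Sum.elim x' y' ≠ 0 := by
          intro h2
          apply hz
          ext ((i | i) | i | i)
          · exact congrFun h1 (Sum.inl i)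
          · exact congrFun h2 (Sum.inl i)
          · exact congrFun h1 (Sum.inr i)
          · exact congrFun h2 (Sum.inr i)
        linarith [h.quadratic_pos h2]
      · linarith [h.quadratic_pos h1]
  set C1 := Sa⁻¹ * Sab with hC1
  set C2 := Sb⁻¹ * Sab.transpose with hC2
  have hL12 : C1 * C2 = L := rfl
  have hdet : D.det * Q.det = (d ^ 3)⁻¹ := by
    have h1 : Q = fromBlocks 1 (fromBlocks (-(r • C1)) (-(r • C1)) (-(r • C1)) (-(r • C1)))
        (fromBlocks (-(r • C2)) (-(r • C2)) (-(r • C2)) (-(r • C2))) 1 *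
        fromBlocks (fromBlocks P 0 0 P) 0 0 (fromBlocks S 0 0 S) := by
      have e2 : -(r • C1) * S = r • R := by
        rw [h.R_eq, Matrix.neg_mul, Matrix.smul_mul, smul_neg]
      have e3 : -(r • C2) * P = r • R.transpose := by
        rw [h.R_transpose_eq, Matrix.neg_mul, Matrix.smul_mul, smul_neg]
      rw [hQ]
      simp only [fromBlocks_multiply, Matrix.mul_zero, add_zero, zero_add, e2, e3,
        Matrix.one_mul]
    -- A unipotent column operation brings the matrix to a form whose Schur complement is 1 − L, so
    -- the determinant is det(1 − L).
    have h2 : (1 - fromBlocks (-(r • C1)) (-(r • C1)) (-(r • C1)) (-(r • C1)) *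
        fromBlocks (-(r • C2)) (-(r • C2)) (-(r • C2)) (-(r • C2))) * fromBlocks 1 0 (-1) 1 =
        fromBlocks 1 (-(r • L)) (-1) (1 - r • L) := by
      have e : -(r • C1) * -(r • C2) + -(r • C1) * -(r • C2) = r • L := by
        simp only [Matrix.neg_mul, Matrix.mul_neg, Matrix.smul_mul, Matrix.mul_smul, hL12]
        rw [hr]
        module
      rw [fromBlocks_multiply, e, ← fromBlocks_one, sub_eq_add_neg, fromBlocks_neg, fromBlocks_add,
        fromBlocks_multiply]
      congr 1 <;> simp [sub_eq_add_neg]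
    have h3 := congrArg det h2
    rw [det_mul, det_fromBlocks_zero₁₂, det_one, mul_one, mul_one,
      det_fromBlocks_one₁₁] at h3
    have h4 : (1 : Matrix a a ℝ) - r • L - -1 * -(r • L) = 1 - L := by
      rw [neg_mul_neg, one_mul, sub_sub, ← add_smul, hr]
      norm_num
    rw [h4, ← hd] at h3
    rw [h1, det_mul, det_fromBlocks_one₂₂, h3, hD, hD1, hD2]
    simp only [det_fromBlocks_zero₂₁]
    have hP := h.det_P
    have hS := h.det_S
    rw [← hL, ← hd] at hP hS
    calc Sa.det * Sa.det * (Sb.det * Sb.det) * (d * (P.det * P.det * (S.det * S.det)))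
        = (Sa.det * P.det) * (Sa.det * P.det) * (Sb.det * S.det) * (Sb.det * S.det) * d := by ring
      _ = _ := by
        rw [hP, hS]
        field_simp
  have hmeas : Measurable fun p : ((a → ℝ) × (a → ℝ)) × (b → ℝ) × (b → ℝ) =>
      ENNReal.ofReal (Real.exp (1 / 2 * (gaussianInfoDensity μa μb Sa Sab Sb p.1.1 p.2.1 +
        gaussianInfoDensity μa μb Sa Sab Sb p.1.1 p.2.2 +
        gaussianInfoDensity μa μb Sa Sab Sb p.1.2 p.2.1 +
        gaussianInfoDensity μa μb Sa Sab Sb p.1.2 p.2.2))) := by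
    have c := h.continuous_gaussianInfoDensity μa μb
    have c1 := c.comp (by fun_prop : Continuous fun p : ((a → ℝ) × (a → ℝ)) × (b → ℝ) × (b → ℝ) =>
      (p.1.1, p.2.1))
    have c2 := c.comp (by fun_prop : Continuous fun p : ((a → ℝ) × (a → ℝ)) × (b → ℝ) × (b → ℝ) =>
      (p.1.1, p.2.2))
    have c3 := c.comp (by fun_prop : Continuous fun p : ((a → ℝ) × (a → ℝ)) × (b → ℝ) × (b → ℝ) =>
      (p.1.2, p.2.1))
    have c4 := c.comp (by fun_prop : Continuous fun p : ((a → ℝ) × (a → ℝ)) × (b → ℝ) × (b → ℝ) =>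
      (p.1.2, p.2.2))
    exact (Real.continuous_exp.comp ((((c1.add c2).add c3).add c4).const_mul
      (1 / 2))).measurable.ennreal_ofReal
  rw [lintegral_prod_prod_gaussianMeasure μa μb h.posDef_Sa h.posDef_Sb hmeas]
  set m := Sum.elim (Sum.elim μa μa) (Sum.elim μb μb) with hm
  have key : ∀ z : (a ⊕ a) ⊕ (b ⊕ b) → ℝ, ENNReal.ofReal (Real.exp (1 / 2 * (
      gaussianInfoDensity μa μb Sa Sab Sb (fun i => z (Sum.inl (Sum.inl i)))
        (fun i => z (Sum.inr (Sum.inl i))) +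
      gaussianInfoDensity μa μb Sa Sab Sb (fun i => z (Sum.inl (Sum.inl i)))
        (fun i => z (Sum.inr (Sum.inr i))) +
      gaussianInfoDensity μa μb Sa Sab Sb (fun i => z (Sum.inl (Sum.inr i)))
        (fun i => z (Sum.inr (Sum.inl i))) +
      gaussianInfoDensity μa μb Sa Sab Sb (fun i => z (Sum.inl (Sum.inr i)))
        (fun i => z (Sum.inr (Sum.inr i)))))) = ENNReal.ofReal (d ^ (-1 : ℝ)) *
      ENNReal.ofReal (Real.exp (-(1 / 2) * ((z - m) ⬝ᵥ Q.mulVec (z - m) -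
      (z - m) ⬝ᵥ (D⁻¹).mulVec (z - m)))) := by
    intro z
    have hz : z - m = Sum.elim (Sum.elim ((fun i => z (Sum.inl (Sum.inl i))) - μa)
        ((fun i => z (Sum.inl (Sum.inr i))) - μa))
        (Sum.elim ((fun i => z (Sum.inr (Sum.inl i))) - μb)
          ((fun i => z (Sum.inr (Sum.inr i))) - μb)) := by
      ext ((i | i) | i | i) <;> rfl
    simp only [h.gaussianInfoDensity_eq]
    rw [← ENNReal.ofReal_mul (by positivity),
      Real.rpow_def_of_pos hd0, ← Real.exp_add, hz, hquad, hD,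
      hD1p.inv_fromBlocks_zero hD2p, dotProduct_fromBlocks_mulVec D1⁻¹, hD2, hD1,
      h.posDef_Sb.inv_fromBlocks_zero h.posDef_Sb, dotProduct_fromBlocks_mulVec Sb⁻¹,
      h.posDef_Sa.inv_fromBlocks_zero h.posDef_Sa, dotProduct_fromBlocks_mulVec Sa⁻¹]
    simp only [zero_mulVec, dotProduct_zero, add_zero]
    congr 2
    rw [← hd, hr]
    ring
  refine (lintegral_congr key).trans ?_
  rw [lintegral_const_mul' _ _ ENNReal.ofReal_ne_top, lintegral_gaussianMeasure_exp _ hDp hQp,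
    ← ENNReal.ofReal_mul (by positivity), hdet]
  congr 1
  rw [← Real.rpow_natCast, ← Real.rpow_neg hd0.le, Real.sqrt_eq_rpow, ← Real.rpow_mul hd0.le,
    ← Real.rpow_neg hd0.le, ← Real.rpow_add hd0]
  congr 1
  norm_num

end PrecisionBlocks

end InfoDensity

/-! ### Laws of the features -/

/-- The exponential of the information density is the density of the joint law against the
independent one. This change of measure turns moments under the true law into the integrals computed
above. -/
theorem PrecisionBlocks.map_gaussianMeasure {a b : Type*} [Fintype a] [Fintype b] [DecidableEq a]
    [DecidableEq b] {Sa : Matrix a a ℝ} {Sab : Matrix a b ℝ} {Sb : Matrix b b ℝ}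
    {P : Matrix a a ℝ} {R : Matrix a b ℝ} {S : Matrix b b ℝ} (h : PrecisionBlocks Sa Sab Sb P R S)
    (μa : a → ℝ) (μb : b → ℝ) :
    (gaussianMeasure (Sum.elim μa μb) (Matrix.fromBlocks Sa Sab Sab.transpose Sb)).map
        (MeasurableEquiv.sumPiEquivProdPi fun _ : a ⊕ b => ℝ) =
      ((gaussianMeasure μa Sa).prod (gaussianMeasure μb Sb)).withDensity
        fun p => ENNReal.ofReal (Real.exp (gaussianInfoDensity μa μb Sa Sab Sb p.1 p.2)) := by
  have hm : Measurable fun p : (a → ℝ) × (b → ℝ) =>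
      ENNReal.ofReal (Real.exp (gaussianInfoDensity μa μb Sa Sab Sb p.1 p.2)) :=
    (Real.continuous_exp.comp (h.continuous_gaussianInfoDensity μa μb)).measurable.ennreal_ofReal
  have hφ := (MeasurableEquiv.sumPiEquivProdPi fun _ : a ⊕ b => ℝ).measurable
  rw [gaussianMeasure_prod μa μb h.posDef_Sa h.posDef_Sb, ← map_withDensity_comp _ hφ hm]
  congr 1
  unfold gaussianMeasure
  refine Eq.trans ?_ (withDensity_mul _ (measurable_ofReal_gaussianDensity _ _) (hm.comp hφ))
  congr 1
  ext z
  have hz : z = Sum.elim (fun i => z (Sum.inl i)) (fun i => z (Sum.inr i)) := by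
    ext (i | i) <;> rfl
  rw [Pi.mul_apply, ← ENNReal.ofReal_mul (gaussianDensity_pos _
    (h.posDef_Sa.fromBlocks_zero h.posDef_Sb) _).le]
  congr 1
  rw [hz, ← h.exp_gaussianInfoDensity, ← gaussianDensity_sumElim μa μb h.posDef_Sa h.posDef_Sb,
    mul_comm]
  rfl

namespace CorrelatedGaussianDatabases

variable (X : CorrelatedGaussianDatabases.{u, v, w})

theorem hasGaussianLaw_A (u : X.U) : HasGaussianLaw (X.A u) X.P :=
  X.gaussian.fst.eval u

theorem hasGaussianLaw_B (v : X.V) : HasGaussianLaw (X.B v) X.P :=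
  X.gaussian.snd.eval v

theorem hasLaw_A (hS : X.Sa.PosDef) (u : X.U) : HasLaw (X.A u) (gaussianMeasure X.μa X.Sa) X.P :=
  (X.hasGaussianLaw_A u).hasLaw_gaussianDensity hS (X.meanA u) (X.covA u)

theorem hasLaw_B (hS : X.Sb.PosDef) (v : X.V) : HasLaw (X.B v) (gaussianMeasure X.μb X.Sb) X.P :=
  (X.hasGaussianLaw_B v).hasLaw_gaussianDensity hS (X.meanB v) (X.covB v)

/-- The features of `v` and of the user mapped to it, the latter replaced by `0` if there is no such
user. -/
noncomputable def block (ι : X.U → X.V) (v : X.V) (ω : X.Ω) : (X.Da → ℝ) × (X.Db → ℝ) :=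
  (Function.extend ι (fun u => X.A u ω) 0 v, X.B v ω)

variable {X} {ι : X.U → X.V}

theorem block_apply (hinj : Function.Injective ι) (u : X.U) :
    X.block ι (ι u) = fun ω => (X.A u ω, X.B (ι u) ω) := by
  ext1 ω
  rw [block, hinj.extend_apply]

theorem injective_of_mem (hι : ∀ u, ι u ∈ X.M u) : Function.Injective ι := fun u u' h =>
  X.M.inj (hι u) (h ▸ hι u')

theorem not_mem_of_ne (hι : ∀ u, ι u ∈ X.M u) {u : X.U} {v : X.V} (h : v ≠ ι u) : v ∉ X.M u :=
  fun hv => h (Option.mem_unique hv (hι u))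

theorem hasGaussianLaw_block (hinj : Function.Injective ι) :
    HasGaussianLaw (fun ω v => (Sum.elim (X.block ι v ω).1 (X.block ι v ω).2 : X.Da ⊕ X.Db → ℝ))
      X.P := by
  let T : ((X.U → X.Da → ℝ) × (X.V → X.Db → ℝ)) →ₗ[ℝ] (X.V → X.Da ⊕ X.Db → ℝ) :=
    { toFun := fun p v => Sum.elim (Function.extend ι p.1 0 v) (p.2 v)
      map_add' := fun p q => by
        ext v (i | j)
        · by_cases hv : ∃ u, ι u = v
          · obtain ⟨u, rfl⟩ := hv
            simp [hinj.extend_apply]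
          · simp [Function.extend_apply' _ _ _ hv]
        · simp
      map_smul' := fun c p => by
        ext v (i | j)
        · by_cases hv : ∃ u, ι u = v
          · obtain ⟨u, rfl⟩ := hv
            simp [hinj.extend_apply]
          · simp [Function.extend_apply' _ _ _ hv]
        · simp }
  exact X.gaussian.map_fun (LinearMap.toContinuousLinearMap T)

theorem hasLaw_block (hι : ∀ u, ι u ∈ X.M u) {P R S}
    (h : PrecisionBlocks X.Sa X.Sab X.Sb P R S) (u : X.U) :
    HasLaw (X.block ι (ι u))
      (((gaussianMeasure X.μa X.Sa).prod (gaussianMeasure X.μb X.Sb)).withDensity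
        fun p => ENNReal.ofReal (Real.exp (gaussianInfoDensity X.μa X.μb X.Sa X.Sab X.Sb p.1 p.2)))
      X.P := by
  have hinj := injective_of_mem hι
  have h1 := (hasGaussianLaw_block hinj).eval (ι u)
  have h2 := h1.hasLaw_gaussianDensity (μ := Sum.elim X.μa X.μb) h.posDef
    (by
      rintro (i | i)
      · simpa [block_apply hinj] using X.meanA u i
      · simpa [block_apply hinj] using X.meanB _ i)
    (by
      rintro (i | i) (j | j)
      · simpa [block_apply hinj] using X.covA u i j
      · simpa [block_apply hinj] using X.cov_mapped u _ (hι u) i j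
      · simpa [block_apply hinj, covariance_comm] using X.cov_mapped u _ (hι u) j i
      · simpa [block_apply hinj] using X.covB _ i j)
  have hφ := (MeasurableEquiv.sumPiEquivProdPi fun _ : X.Da ⊕ X.Db => ℝ).measurable
  have h3 := (HasLaw.mk hφ.aemeasurable (h.map_gaussianMeasure X.μa X.μb)).comp h2
  exact h3

/-- The entries of all blocks are jointly Gaussian, so it is enough that distinct blocks are
uncorrelated. -/
theorem iIndepFun_block (hι : ∀ u, ι u ∈ X.M u) : iIndepFun (X.block ι) X.P := by
  have hinj := injective_of_mem hι
  have hA : ∀ u i, MemLp (fun ω => X.A u ω i) 2 X.P := fun u i =>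
    ((X.hasGaussianLaw_A u).eval i).memLp_two
  have hB : ∀ v i, MemLp (fun ω => X.B v ω i) 2 X.P := fun v i =>
    ((X.hasGaussianLaw_B v).eval i).memLp_two
  have hAA : ∀ u u', u ≠ u' → ∀ i j, covariance (fun ω => X.A u ω i) (fun ω => X.A u' ω j) X.P = 0 :=
    fun u u' huu i j => IndepFun.covariance_eq_zero
      ((X.indepA.indepFun huu).comp (measurable_pi_apply i) (measurable_pi_apply j)) (hA _ _) (hA _ _)
  have hBB : ∀ u u', u ≠ u' → ∀ i j, covariance (fun ω => X.B u ω i) (fun ω => X.B u' ω j) X.P = 0 :=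
    fun u u' huu i j => IndepFun.covariance_eq_zero
      ((X.indepB.indepFun huu).comp (measurable_pi_apply i) (measurable_pi_apply j)) (hB _ _) (hB _ _)
  have hAB : ∀ v v', v ≠ v' → ∀ i j, covariance (fun ω => (X.block ι v ω).1 i)
      (fun ω => X.B v' ω j) X.P = 0 := by
    intro v v' hvv i j
    by_cases hv : ∃ u, ι u = v
    · obtain ⟨u, rfl⟩ := hv
      simpa [block_apply hinj] using X.cov_unmapped u v' (not_mem_of_ne hι hvv.symm) i j
    -- For an unmapped v the first component of the block is the constant 0.
    · simp [block, Function.extend_apply' _ _ _ hv, covariance_const_left]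
  have h1 := HasGaussianLaw.iIndepFun_of_covariance_eval
    (X := fun (v : X.V) (k : X.Da ⊕ X.Db) ω => Sum.elim (X.block ι v ω).1 (X.block ι v ω).2 k)
    (hasGaussianLaw_block hinj) (by
      rintro v v' hvv (i | i) (j | j)
      · by_cases hv : ∃ u, ι u = v
        · obtain ⟨u, rfl⟩ := hv
          by_cases hv' : ∃ u, ι u = v'
          · obtain ⟨u', rfl⟩ := hv'
            simpa [block_apply hinj] using hAA u u' (fun h => hvv (h ▸ rfl)) i j
          · simp [block, Function.extend_apply' _ _ _ hv', covariance_const_right]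
        · simp [block, Function.extend_apply' _ _ _ hv, covariance_const_left]
      · exact hAB v v' hvv i j
      · rw [covariance_comm]
        exact hAB v' v hvv.symm j i
      · exact hBB v v' hvv i j)
  exact h1.comp (fun _ => MeasurableEquiv.sumPiEquivProdPi fun _ : X.Da ⊕ X.Db => ℝ)
    fun _ => (MeasurableEquiv.sumPiEquivProdPi fun _ : X.Da ⊕ X.Db => ℝ).measurable

theorem indepFun_A_B (hι : ∀ u, ι u ∈ X.M u) {u : X.U} {v : X.V} (h : v ≠ ι u) :
    IndepFun (fun ω => (X.A u ω, X.B (ι u) ω)) (X.B v) X.P := by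
  have h1 := (iIndepFun_block hι).indepFun h.symm
  rw [block_apply (injective_of_mem hι)] at h1
  exact h1.comp measurable_id measurable_snd

end CorrelatedGaussianDatabases

/-! ### The mutual information -/

theorem integral_quadratic_eq_trace {ι Ω : Type*} [Fintype ι] [MeasurableSpace Ω] {P : Measure Ω}
    {X : Ω → ι → ℝ} {μ : ι → ℝ} {S : Matrix ι ι ℝ} (hX : ∀ i, MemLp (fun ω => X ω i) 2 P)
    [IsProbabilityMeasure P]
    (hmean : ∀ i, ∫ ω, X ω i ∂P = μ i)
    (hcov : ∀ i j, covariance (fun ω => X ω i) (fun ω => X ω j) P = S i j) (M : Matrix ι ι ℝ) :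
    Integrable (fun ω => (X ω - μ) ⬝ᵥ M.mulVec (X ω - μ)) P ∧
      ∫ ω, (X ω - μ) ⬝ᵥ M.mulVec (X ω - μ) ∂P = (M * S).trace := by
  have hi : ∀ i j, Integrable (fun ω => M i j * ((X ω i - μ i) * (X ω j - μ j))) P := fun i j =>
    (((hX i).sub (memLp_const (μ i))).integrable_mul ((hX j).sub (memLp_const (μ j)))).const_mul _
  have he : (fun ω => (X ω - μ) ⬝ᵥ M.mulVec (X ω - μ)) =
      fun ω => ∑ i, ∑ j, M i j * ((X ω i - μ i) * (X ω j - μ j)) := by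
    ext ω
    simp only [dotProduct, Matrix.mulVec, Finset.mul_sum, Pi.sub_apply]
    exact Finset.sum_congr rfl fun i _ => Finset.sum_congr rfl fun j _ => by ring
  rw [he]
  refine ⟨integrable_finsetSum _ fun i _ => integrable_finsetSum _ fun j _ => hi i j, ?_⟩
  rw [integral_finsetSum _ fun i _ => integrable_finsetSum _ fun j _ => hi i j, Matrix.trace]
  refine Finset.sum_congr rfl fun i _ => ?_
  rw [integral_finsetSum _ fun j _ => hi i j, Matrix.diag_apply, Matrix.mul_apply]
  refine Finset.sum_congr rfl fun j _ => ?_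
  rw [integral_const_mul, ← hcov j i, covariance_comm, covariance, hmean, hmean]

theorem integral_prod_pi_eq {a b : Type*} [Fintype a] [Fintype b]
    (f : (a → ℝ) × (b → ℝ) → ℝ) :
    ∫ p, f p = ∫ z : a ⊕ b → ℝ, f (fun i => z (Sum.inl i), fun i => z (Sum.inr i)) :=
  ((volume_measurePreserving_sumPiEquivProdPi fun _ : a ⊕ b => ℝ).integral_comp' f).symm

theorem integral_const_sub_mul_sub_sub {Ω : Type*} [MeasurableSpace Ω] {P : Measure Ω}
    [IsProbabilityMeasure P] {f g k : Ω → ℝ} (hf : Integrable f P) (hg : Integrable g P)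
    (hk : Integrable k P) (c r : ℝ) :
    ∫ ω, (c - r * (f ω - g ω - k ω)) ∂P =
      c - r * (∫ ω, f ω ∂P - ∫ ω, g ω ∂P - ∫ ω, k ω ∂P) := by
  have hfg : Integrable (fun ω => f ω - g ω) P := hf.sub hg
  have hfgk : Integrable (fun ω => f ω - g ω - k ω) P := hfg.sub hk
  rw [integral_sub (integrable_const c) (hfgk.const_mul r), integral_const_mul,
    integral_sub hfg hk, integral_sub hf hg]
  simp

namespace CorrelatedGaussianDatabases

variable {X : CorrelatedGaussianDatabases.{u, v, w}} {ι : X.U → X.V}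

/-- Under the joint law each centred quadratic form in its own precision matrix has mean equal to
its dimension. The three dimensions cancel, leaving the logarithm of the determinant. -/
theorem signal_eq (hι : ∀ u, ι u ∈ X.M u) (u : X.U) {P R S}
    (h : PrecisionBlocks X.Sa X.Sab X.Sb P R S) :
    X.signal = -(1 / 2) * Real.log (1 - corrSq X.Sa X.Sab X.Sb).det := by
  have hinj := injective_of_mem hι
  obtain ⟨info, hinfo⟩ : ∃ f, f = gaussianInfoDensity X.μa X.μb X.Sa X.Sab X.Sb := ⟨_, rfl⟩
  have hcont : Continuous fun p : (X.Da → ℝ) × (X.Db → ℝ) => info p.1 p.2 :=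
    hinfo ▸ h.continuous_gaussianInfoDensity X.μa X.μb
  set K := Matrix.fromBlocks X.Sa X.Sab X.Sab.transpose X.Sb with hK
  set Z : X.Ω → X.Da ⊕ X.Db → ℝ := fun ω => Sum.elim (X.A u ω) (X.B (ι u) ω) with hZ
  have hZg : HasGaussianLaw Z X.P := by
    have h1 := (hasGaussianLaw_block hinj).eval (ι u)
    simpa [block_apply hinj] using h1
  have hZm : ∀ i, ∫ ω, Z ω i ∂X.P = Sum.elim X.μa X.μb i := by
    rintro (i | i)
    · exact X.meanA u i
    · exact X.meanB _ i
  have hZc : ∀ i j, covariance (fun ω => Z ω i) (fun ω => Z ω j) X.P = K i j := by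
    rintro (i | i) (j | j)
    · exact X.covA u i j
    · exact X.cov_mapped u _ (hι u) i j
    · rw [covariance_comm]
      exact X.cov_mapped u _ (hι u) j i
    · exact X.covB _ i j
  have hlaw := hZg.hasLaw_gaussianDensity h.posDef hZm hZc
  have hd := (measurable_ofReal_gaussianDensity (Sum.elim X.μa X.μb) K)
  have h1 : X.signal = ∫ ω, info (X.A u ω) (X.B (ι u) ω) ∂X.P := by
    rw [signal, integral_prod_pi_eq]
    have hcφ : Continuous fun z : X.Da ⊕ X.Db → ℝ =>
        info (fun i => z (Sum.inl i)) (fun i => z (Sum.inr i)) :=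
      hcont.comp (by fun_prop : Continuous fun z : X.Da ⊕ X.Db → ℝ =>
        ((fun i => z (Sum.inl i)), (fun i => z (Sum.inr i))))
    have h3 := hlaw.integral_comp (f := fun z : X.Da ⊕ X.Db → ℝ =>
        info (fun i => z (Sum.inl i)) (fun i => z (Sum.inr i))) hcφ.aestronglyMeasurable
    refine Eq.trans ?_ h3.symm
    rw [integral_withDensity_eq_integral_toReal_smul hd (by simp)]
    refine integral_congr_ae (Eventually.of_forall fun z => ?_)
    have hz : z = Sum.elim (fun i => z (Sum.inl i)) (fun i => z (Sum.inr i)) := by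
      ext (i | i) <;> rfl
    dsimp only
    rw [ENNReal.toReal_ofReal (gaussianDensity_pos _ h.posDef _).le, smul_eq_mul]
    congr 1
    · rw [fXY, ← hz]
    · rw [hinfo]
      rfl
  obtain ⟨i1, e1⟩ := integral_quadratic_eq_trace (X := Z) (fun i => (hZg.eval i).memLp_two) hZm hZc
    (Matrix.fromBlocks P R R.transpose S)
  obtain ⟨i2, e2⟩ := integral_quadratic_eq_trace
    (fun i => ((X.hasGaussianLaw_A u).eval i).memLp_two) (X.meanA u) (X.covA u) X.Sa⁻¹
  obtain ⟨i3, e3⟩ := integral_quadratic_eq_trace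
    (fun i => ((X.hasGaussianLaw_B (ι u)).eval i).memLp_two) (X.meanB _) (X.covB _) X.Sb⁻¹
  have hsub : ∀ ω, Z ω - Sum.elim X.μa X.μb = Sum.elim (X.A u ω - X.μa) (X.B (ι u) ω - X.μb) := by
    intro ω
    ext (i | i) <;> rfl
  simp only [hsub] at i1 e1
  rw [h1, hinfo]
  simp_rw [h.gaussianInfoDensity_eq]
  refine (integral_const_sub_mul_sub_sub i1 i2 i3 _ _).trans ?_
  rw [e1, e2, e3, ← h.inv_eq,
    Matrix.nonsing_inv_mul _ (isUnit_iff_ne_zero.2 h.posDef.det_pos.ne'),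
    Matrix.nonsing_inv_mul _ (isUnit_iff_ne_zero.2 h.posDef_Sa.det_pos.ne'),
    Matrix.nonsing_inv_mul _ (isUnit_iff_ne_zero.2 h.posDef_Sb.det_pos.ne'), Matrix.trace_one,
    Matrix.trace_one, Matrix.trace_one, Fintype.card_sum]
  simp

theorem det_eq_exp (hι : ∀ u, ι u ∈ X.M u) (u : X.U) {P R S}
    (h : PrecisionBlocks X.Sa X.Sab X.Sb P R S) :
    (1 - corrSq X.Sa X.Sab X.Sb).det = Real.exp (-2 * X.signal) := by
  rw [signal_eq hι u h, ← mul_assoc]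
  norm_num
  rw [Real.exp_log h.det_corr_pos]

end CorrelatedGaussianDatabases

/-! ### Exponential moment bounds for the scores -/

open Classical in
/-- Exponential moment bounds for log-likelihood ratios `G` between a hidden injection `ι` and
independence, in terms of a signal strength `z`. -/
structure ScoreBounds {U : Type*} {V : Type*} [Fintype U] {Ω : Type*} [MeasurableSpace Ω]
    (P : Measure Ω) (ι : U → V) (G : Ω → U → V → ℝ) (z : ℝ) : Prop where
  aemeasurable : ∀ u v, AEMeasurable (fun ω => G ω u v) P
  true_le : ∀ u, ∀ s : ℝ, 0 ≤ s → s ≤ 1 →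
    ∫⁻ ω, ENNReal.ofReal (Real.exp (-s * G ω u (ι u))) ∂P ≤
      ENNReal.ofReal (Real.exp (-(z * (s * (1 - s)))))
  false_le : ∀ u v, v ≠ ι u → ∀ t : ℝ, 0 ≤ t → t ≤ 1 →
    ∫⁻ ω, ENNReal.ofReal (Real.exp (t * G ω u v)) ∂P ≤
      ENNReal.ofReal (Real.exp (-(z * (t * (1 - t)))))
  row_le : ∀ u v, v ≠ ι u → ∀ t : ℝ, 1 / 2 ≤ t → t ≤ 1 →
    ∫⁻ ω, ENNReal.ofReal (Real.exp (t * G ω u v - (1 - t) * G ω u (ι u))) ∂P ≤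
      ENNReal.ofReal (Real.exp (-(2 * z * (t * (1 - t)))))
  swap_le : ∀ σ : U → V, Function.Injective σ →
    ∫⁻ ω, ENNReal.ofReal (Real.exp (1 / 2 * ∑ u, (G ω u (σ u) - G ω u (ι u)))) ∂P ≤
      ENNReal.ofReal (Real.exp (-(z / 2 * (Finset.univ.filter fun u => σ u ≠ ι u).card)))

/-! ### The exponential moment of the gain of an injection -/

theorem map_pi_eval_prod {V E : Type*} [Fintype V] [MeasurableSpace E] (γ : Measure E)
    [IsProbabilityMeasure γ] {v v' : V} (h : v ≠ v') :
    (Measure.pi fun _ : V => γ).map (fun y => (y v, y v')) = γ.prod γ := by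
  have h1 : iIndepFun (fun (v : V) (y : V → E) => y v) (Measure.pi fun _ : V => γ) :=
    iIndepFun_pi (X := fun _ => id) fun _ => aemeasurable_id
  have h2 := (indepFun_iff_map_prod_eq_prod_map_map (measurable_pi_apply v).aemeasurable
    (measurable_pi_apply v').aemeasurable).1 (h1.indepFun h)
  rw [h2]
  congr 1 <;> exact (measurePreserving_eval (fun _ : V => γ) _).map_eq

/-- The overlap of the square roots of two conditional likelihoods. -/
noncomputable def sqrtOverlap {E F : Type*} [MeasurableSpace E] (γ : Measure E) (g : E → F → ℝ)
    (y y' : F) : ENNReal :=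
  ∫⁻ x, ENNReal.ofReal (Real.exp (1 / 2 * g x y + 1 / 2 * g x y')) ∂γ

theorem measurable_sqrtOverlap {E F : Type*} [MeasurableSpace E] [MeasurableSpace F]
    (γ : Measure E) [SFinite γ] {g : E → F → ℝ} (hg : Measurable fun p : E × F => g p.1 p.2) :
    Measurable fun q : F × F => sqrtOverlap γ g q.1 q.2 := by
  unfold sqrtOverlap
  refine Measurable.lintegral_prod_left' (f := fun p : E × F × F =>
    ENNReal.ofReal (Real.exp (1 / 2 * g p.1 p.2.1 + 1 / 2 * g p.1 p.2.2))) ?_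
  have h1 : Measurable fun p : E × F × F => g p.1 p.2.1 :=
    hg.comp (by fun_prop : Measurable fun p : E × F × F => (p.1, p.2.1))
  have h2 : Measurable fun p : E × F × F => g p.1 p.2.2 :=
    hg.comp (by fun_prop : Measurable fun p : E × F × F => (p.1, p.2.2))
  fun_prop

/-- Writing the square with two independent copies of x turns it into the 4-cycle moment. -/
theorem lintegral_sqrtOverlap_sq {E F : Type*} [MeasurableSpace E] [MeasurableSpace F]
    (γ : Measure E) [SFinite γ] (δ : Measure F) [SFinite δ] {g : E → F → ℝ}
    (hg : Measurable fun p : E × F => g p.1 p.2) :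
    ∫⁻ q, sqrtOverlap γ g q.1 q.2 ^ 2 ∂δ.prod δ =
      ∫⁻ p, ENNReal.ofReal (Real.exp (1 / 2 * (g p.1.1 p.2.1 + g p.1.1 p.2.2 + g p.1.2 p.2.1 +
        g p.1.2 p.2.2))) ∂(γ.prod γ).prod (δ.prod δ) := by
  have h1 : Measurable fun p : (E × E) × F × F => g p.1.1 p.2.1 :=
    hg.comp (by fun_prop : Measurable fun p : (E × E) × F × F => (p.1.1, p.2.1))
  have h2 : Measurable fun p : (E × E) × F × F => g p.1.1 p.2.2 :=
    hg.comp (by fun_prop : Measurable fun p : (E × E) × F × F => (p.1.1, p.2.2))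
  have h3 : Measurable fun p : (E × E) × F × F => g p.1.2 p.2.1 :=
    hg.comp (by fun_prop : Measurable fun p : (E × E) × F × F => (p.1.2, p.2.1))
  have h4 : Measurable fun p : (E × E) × F × F => g p.1.2 p.2.2 :=
    hg.comp (by fun_prop : Measurable fun p : (E × E) × F × F => (p.1.2, p.2.2))
  have hm : Measurable fun p : (E × E) × F × F => ENNReal.ofReal (Real.exp (1 / 2 * (g p.1.1 p.2.1 +
      g p.1.1 p.2.2 + g p.1.2 p.2.1 + g p.1.2 p.2.2))) := by fun_prop
  refine Eq.trans ?_ (lintegral_prod_symm _ hm.aemeasurable).symm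
  refine lintegral_congr fun q => ?_
  have hq1 : Measurable fun x => g x q.1 := hg.comp (by fun_prop : Measurable fun x : E => (x, q.1))
  have hq2 : Measurable fun x => g x q.2 := hg.comp (by fun_prop : Measurable fun x : E => (x, q.2))
  rw [pow_two, sqrtOverlap, ← lintegral_prod_mul (by fun_prop) (by fun_prop)]
  refine lintegral_congr fun x => ?_
  rw [← ENNReal.ofReal_mul (Real.exp_pos _).le, ← Real.exp_add]
  congr 2
  ring

/-- View each u as an edge joining σ u and ι u. Both maps are injective, so every vertex meets at
most two edges and weight 1/2 per edge is admissible in Finner's inequality. An edge then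
contributes the square root of the 4-cycle moment; a loop σ u = ι u has weight one and contributes
at most 1. -/
theorem lintegral_pi_prod_sqrtOverlap_le {U V E F : Type*} [Fintype U] [Fintype V]
    [DecidableEq V] [MeasurableSpace E] [MeasurableSpace F] (γ : Measure E) [SFinite γ]
    (δ : Measure F) [IsProbabilityMeasure δ] {g : E → F → ℝ}
    (hg : Measurable fun p : E × F => g p.1 p.2) {c : ENNReal}
    (h1 : ∫⁻ p, ENNReal.ofReal (Real.exp (g p.1 p.2)) ∂γ.prod δ ≤ 1)
    (hc : ∫⁻ p, ENNReal.ofReal (Real.exp (1 / 2 * (g p.1.1 p.2.1 + g p.1.1 p.2.2 + g p.1.2 p.2.1 +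
        g p.1.2 p.2.2))) ∂(γ.prod γ).prod (δ.prod δ) ≤ c)
    {ι σ : U → V} (hι : Function.Injective ι) (hσ : Function.Injective σ) :
    ∫⁻ y, ∏ u, sqrtOverlap γ g (y (σ u)) (y (ι u)) ∂Measure.pi (fun _ : V => δ) ≤
      ∏ u, if σ u ≠ ι u then c ^ (1 / 2 : ℝ) else 1 := by
  have hm := measurable_sqrtOverlap γ hg
  have hmu : ∀ u, Measurable fun y : V → F => sqrtOverlap γ g (y (σ u)) (y (ι u)) := fun u =>
    hm.comp (by fun_prop : Measurable fun y : V → F => (y (σ u), y (ι u)))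
  have key := lintegral_pi_prod_rpow_le (fun _ : V => δ)
    (f := fun u y => sqrtOverlap γ g (y (σ u)) (y (ι u)) ^ (if σ u ≠ ι u then 2 else 1))
    (fun u => (hmu u).pow_const _) (fun u => {σ u, ι u})
    (fun u y y' hy => by
      simp only
      rw [hy (σ u) (by simp), hy (ι u) (by simp)])
    (p := fun u => if σ u ≠ ι u then 1 / 2 else 1) (fun u => by positivity) (by
      intro v s hs
      -- The weight of u is split between its σ-endpoint and its ι-endpoint; a loop at v counts in
      -- both.
      have hle : ∀ u ∈ s, (if σ u ≠ ι u then (1 / 2 : ℝ) else 1) ≤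
          (if σ u = v then 1 / 2 else 0) + (if ι u = v then 1 / 2 else 0) := by
        intro u hu
        have hv := hs u hu
        simp only [Set.mem_insert_iff, Set.mem_singleton_iff] at hv
        rcases hv with rfl | rfl
        · by_cases h : σ u = ι u
          · simp only [h]; norm_num
          · simp [h, Ne.symm h]
        · by_cases h : σ u = ι u
          · simp only [h]; norm_num
          · simp [h]
      have hone : ∀ τ : U → V, Function.Injective τ →
          ∑ u ∈ s, (if τ u = v then (1 / 2 : ℝ) else 0) ≤ 1 / 2 := by
        intro τ hτ
        rw [← Finset.sum_filter, Finset.sum_const, nsmul_eq_mul]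
        have : (s.filter fun u => τ u = v).card ≤ 1 := Finset.card_le_one.2 fun x hx y hy => by
          simp only [Finset.mem_filter] at hx hy
          exact hτ (hx.2.trans hy.2.symm)
        have : ((s.filter fun u => τ u = v).card : ℝ) ≤ 1 := by exact_mod_cast this
        linarith
      refine (Finset.sum_le_sum hle).trans ?_
      rw [Finset.sum_add_distrib]
      linarith [hone σ hσ, hone ι hι])
  have hL : ∀ (u : U) (y : V → F), (sqrtOverlap γ g (y (σ u)) (y (ι u)) ^
      (if σ u ≠ ι u then 2 else 1)) ^ (if σ u ≠ ι u then (1 / 2 : ℝ) else 1) =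
      sqrtOverlap γ g (y (σ u)) (y (ι u)) := by
    intro u y
    by_cases h : σ u = ι u
    · simp [h]
    · rw [if_pos h, if_pos h, ← ENNReal.rpow_natCast, ← ENNReal.rpow_mul]
      norm_num
  simp only [hL] at key
  refine key.trans (Finset.prod_le_prod' fun u _ => ?_)
  by_cases h : σ u = ι u
  · simp only [h, ne_eq, not_true_eq_false, if_false, ENNReal.rpow_one, pow_one]
    have h2 := (measurePreserving_eval (fun _ : V => δ) (ι u)).lintegral_comp
      (hm.comp (by fun_prop : Measurable fun y : F => (y, y)))
    refine (le_of_eq h2).trans ((le_of_eq ?_).trans h1)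
    rw [lintegral_prod_symm _ (by fun_prop)]
    refine lintegral_congr fun y => lintegral_congr fun x => ?_
    congr 2
    ring
  · simp only [ne_eq, h, not_false_eq_true, if_true]
    refine ENNReal.rpow_le_rpow (le_trans (le_of_eq ?_) hc) (by norm_num)
    rw [← lintegral_sqrtOverlap_sq γ δ hg, ← map_pi_eval_prod δ h,
      lintegral_map (hm.pow_const 2) (by fun_prop)]

theorem lintegral_pi_prod_comp_injective {U V E : Type*} [Fintype U] [Fintype V]
    [MeasurableSpace E] (μ : V → Measure E) [∀ v, IsProbabilityMeasure (μ v)] {ι : U → V}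
    (hι : Function.Injective ι) {f : U → E → ENNReal} (hf : ∀ u, Measurable (f u)) :
    ∫⁻ x, ∏ u, f u (x (ι u)) ∂Measure.pi μ = ∏ u, ∫⁻ x, f u x ∂μ (ι u) := by
  have hm : ∀ v, Measurable (Function.extend ι f (fun _ _ => 1) v) := by
    intro v
    by_cases hv : ∃ u, ι u = v
    · obtain ⟨u, rfl⟩ := hv
      rw [hι.extend_apply]
      exact hf u
    · rw [Function.extend_apply' _ _ _ hv]
      exact measurable_const
  rw [Fintype.prod_of_injective ι hι (fun u => ∫⁻ x, f u x ∂μ (ι u))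
    (fun v => ∫⁻ x, Function.extend ι f (fun _ _ => 1) v x ∂μ v)
    (fun v hv => by simp [Function.extend_apply' _ _ _ hv])
    (fun u => by rw [hι.extend_apply]), ← lintegral_pi_prod_eq μ hm]
  refine lintegral_congr fun x => Fintype.prod_of_injective ι hι _ _
    (fun v hv => by simp [Function.extend_apply' _ _ _ hv]) (fun u => by rw [hι.extend_apply])

/-- Passing to the independent law multiplies by exp of the true scores, so each −g/2 becomes +g/2.
The x variables then separate, and integrating them out leaves a product of overlaps in the y
variables alone. -/
theorem lintegral_exp_swap_le {Ω U V E F : Type*} [Fintype U] [Fintype V] [DecidableEq V]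
    [MeasurableSpace Ω] {P : Measure Ω} [MeasurableSpace E] [MeasurableSpace F]
    {γ : Measure E} [IsProbabilityMeasure γ] {δ : Measure F} [IsProbabilityMeasure δ]
    {g : E → F → ℝ} (hg : Measurable fun p : E × F => g p.1 p.2) {c : ENNReal}
    (h1 : ∫⁻ p, ENNReal.ofReal (Real.exp (g p.1 p.2)) ∂γ.prod δ ≤ 1)
    (hc : ∫⁻ p, ENNReal.ofReal (Real.exp (1 / 2 * (g p.1.1 p.2.1 + g p.1.1 p.2.2 + g p.1.2 p.2.1 +
        g p.1.2 p.2.2))) ∂(γ.prod γ).prod (δ.prod δ) ≤ c)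
    {ι σ : U → V} (hι : Function.Injective ι) (hσ : Function.Injective σ)
    {Z : V → Ω → E × F} (hZ : iIndepFun Z P)
    (hmap : ∀ u, HasLaw (Z (ι u)) ((γ.prod δ).withDensity
      fun p => ENNReal.ofReal (Real.exp (g p.1 p.2))) P) {x₀ : E}
    (hunmap : ∀ v, (¬∃ u, ι u = v) → HasLaw (Z v) ((Measure.dirac x₀).prod δ) P) :
    ∫⁻ ω, ENNReal.ofReal (Real.exp (1 / 2 * ∑ u, (g (Z (ι u) ω).1 (Z (σ u) ω).2 -
      g (Z (ι u) ω).1 (Z (ι u) ω).2))) ∂P ≤ ∏ u, if σ u ≠ ι u then c ^ (1 / 2 : ℝ) else 1 := by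
  have hP := hZ.isProbabilityMeasure
  have hell : Measurable fun p : E × F => ENNReal.ofReal (Real.exp (g p.1 p.2)) := by fun_prop
  -- Unmapped values carry a dummy constant first component and density 1, so that all blocks are
  -- indexed by V.
  obtain ⟨α, hα⟩ : ∃ α : V → Measure E,
      α = Function.extend ι (fun _ => γ) (fun _ => Measure.dirac x₀) := ⟨_, rfl⟩
  obtain ⟨L, hL⟩ : ∃ L : V → E × F → ENNReal, L = Function.extend ι
      (fun _ p => ENNReal.ofReal (Real.exp (g p.1 p.2))) (fun _ _ => 1) := ⟨_, rfl⟩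
  have hαι : ∀ u, α (ι u) = γ := fun u => by rw [hα, hι.extend_apply]
  have hLι : ∀ u, L (ι u) = fun p => ENNReal.ofReal (Real.exp (g p.1 p.2)) := fun u => by
    rw [hL, hι.extend_apply]
  have hα' : ∀ v, (¬∃ u, ι u = v) → α v = Measure.dirac x₀ := fun v hv => by
    rw [hα, Function.extend_apply' _ _ _ hv]
  have hL' : ∀ v, (¬∃ u, ι u = v) → L v = fun _ => 1 := fun v hv => by
    rw [hL, Function.extend_apply' _ _ _ hv]
  have hαp : ∀ v, IsProbabilityMeasure (α v) := by
    intro v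
    by_cases hv : ∃ u, ι u = v
    · obtain ⟨u, rfl⟩ := hv
      rw [hαι]
      infer_instance
    · rw [hα' v hv]
      infer_instance
  have hLm : ∀ v, Measurable (L v) := by
    intro v
    by_cases hv : ∃ u, ι u = v
    · obtain ⟨u, rfl⟩ := hv
      rw [hLι]
      exact hell
    · rw [hL' v hv]
      exact measurable_const
  have hlaw : ∀ v, HasLaw (Z v) (((α v).prod δ).withDensity (L v)) P := by
    intro v
    by_cases hv : ∃ u, ι u = v
    · obtain ⟨u, rfl⟩ := hv
      rw [hαι, hLι]
      exact hmap u
    · rw [hα' v hv, hL' v hv]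
      simpa using hunmap v hv
  have hprob : ∀ v, IsProbabilityMeasure (((α v).prod δ).withDensity (L v)) := fun v => by
    rw [← (hlaw v).map_eq]
    exact Measure.isProbabilityMeasure_map (hlaw v).aemeasurable
  have hjoint : P.map (fun ω v => Z v ω) = (Measure.pi fun v => (α v).prod δ).withDensity
      fun z => ∏ v, L v (z v) := by
    rw [(iIndepFun_iff_map_fun_eq_pi_map fun v => (hlaw v).aemeasurable).1 hZ,
      ← pi_withDensity _ hLm]
    congr 1
    ext1 v
    exact (hlaw v).map_eq
  have hgm : ∀ v v' : V, Measurable fun z : V → E × F => g (z v).1 (z v').2 := fun v v' =>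
    hg.comp (by fun_prop : Measurable fun z : V → E × F => ((z v).1, (z v').2))
  have hgm' : ∀ v v' : V, Measurable fun q : (V → E) × (V → F) => g (q.1 v) (q.2 v') := fun v v' =>
    hg.comp (by fun_prop : Measurable fun q : (V → E) × (V → F) => (q.1 v, q.2 v'))
  have hFm : Measurable fun z : V → E × F => ENNReal.ofReal (Real.exp (1 / 2 *
      ∑ u, (g (z (ι u)).1 (z (σ u)).2 - g (z (ι u)).1 (z (ι u)).2))) := by fun_prop
  have hZm : AEMeasurable (fun ω v => Z v ω) P := aemeasurable_pi_lambda _ fun v => (hlaw v).aemeasurable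
  have hHm : Measurable fun q : (V → E) × (V → F) => ∏ u, ENNReal.ofReal (Real.exp
      (1 / 2 * g (q.1 (ι u)) (q.2 (σ u)) + 1 / 2 * g (q.1 (ι u)) (q.2 (ι u)))) := by fun_prop
  calc ∫⁻ ω, ENNReal.ofReal (Real.exp (1 / 2 * ∑ u, (g (Z (ι u) ω).1 (Z (σ u) ω).2 -
      g (Z (ι u) ω).1 (Z (ι u) ω).2))) ∂P
      = ∫⁻ z, ENNReal.ofReal (Real.exp (1 / 2 *
      ∑ u, (g (z (ι u)).1 (z (σ u)).2 - g (z (ι u)).1 (z (ι u)).2))) ∂P.map (fun ω v => Z v ω) :=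
        (lintegral_map' hFm.aemeasurable hZm).symm
    _ = ∫⁻ z, ∏ u, ENNReal.ofReal (Real.exp
      (1 / 2 * g (z (ι u)).1 (z (σ u)).2 + 1 / 2 * g (z (ι u)).1 (z (ι u)).2))
        ∂Measure.pi fun v => (α v).prod δ := by
      have hLp : Measurable fun z : V → E × F => ∏ v, L v (z v) :=
        Finset.measurable_fun_prod _ fun v _ => (hLm v).comp (measurable_pi_apply v)
      rw [hjoint, lintegral_withDensity_eq_lintegral_mul _ hLp hFm]
      refine lintegral_congr fun z => ?_
      rw [Pi.mul_apply, ← Fintype.prod_of_injective ι hι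
        (fun u => ENNReal.ofReal (Real.exp (g (z (ι u)).1 (z (ι u)).2))) (fun v => L v (z v))
        (fun v hv => by rw [hL' v hv]) (fun u => by rw [hLι]), Finset.mul_sum, Real.exp_sum,
        ENNReal.ofReal_prod_of_nonneg fun _ _ => (Real.exp_pos _).le, ← Finset.prod_mul_distrib]
      refine Finset.prod_congr rfl fun u _ => ?_
      rw [← ENNReal.ofReal_mul (Real.exp_pos _).le, ← Real.exp_add]
      congr 2
      ring
    _ = ∫⁻ q, ∏ u, ENNReal.ofReal (Real.exp
      (1 / 2 * g (q.1 (ι u)) (q.2 (σ u)) + 1 / 2 * g (q.1 (ι u)) (q.2 (ι u))))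
        ∂(Measure.pi α).prod (Measure.pi fun _ => δ) :=
      (measurePreserving_arrowProdEquivProdArrow E F V α fun _ => δ).lintegral_comp hHm
    _ = ∫⁻ y, ∏ u, sqrtOverlap γ g (y (σ u)) (y (ι u)) ∂Measure.pi (fun _ : V => δ) := by
      rw [lintegral_prod_symm _ hHm.aemeasurable]
      refine lintegral_congr fun y => ?_
      have hm : ∀ u, Measurable fun x => ENNReal.ofReal (Real.exp
          (1 / 2 * g x (y (σ u)) + 1 / 2 * g x (y (ι u)))) := by
        intro u
        have hy : ∀ v, Measurable fun x => g x (y v) := fun v =>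
          hg.comp (by fun_prop : Measurable fun x : E => (x, y v))
        fun_prop
      rw [lintegral_pi_prod_comp_injective α hι hm]
      simp only [hαι, sqrtOverlap]
    _ ≤ _ := lintegral_pi_prod_sqrtOverlap_le γ δ hg h1 hc hι hσ

namespace CorrelatedGaussianDatabases

variable {X : CorrelatedGaussianDatabases.{u, v, w}} {ι : X.U → X.V}

theorem scoreBounds [Nonempty X.U] (hι : ∀ u, ι u ∈ X.M u) :
    ScoreBounds X.P ι X.score X.signal := by
  classical
  obtain ⟨P, R, S, h⟩ := X.posDef.exists_precisionBlocks
  have hinj := injective_of_mem hι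
  have hd := det_eq_exp hι (Classical.arbitrary X.U) h
  obtain ⟨g, hgdef⟩ : ∃ g, g = gaussianInfoDensity X.μa X.μb X.Sa X.Sab X.Sb := ⟨_, rfl⟩
  have hscore : ∀ ω u v, X.score ω u v = g (X.A u ω) (X.B v ω) := fun ω u v => by
    rw [hgdef]
    rfl
  have hg : Measurable fun p : (X.Da → ℝ) × (X.Db → ℝ) => g p.1 p.2 :=
    hgdef ▸ (h.continuous_gaussianInfoDensity X.μa X.μb).measurable
  have hA := X.hasLaw_A h.posDef_Sa
  have hB := X.hasLaw_B h.posDef_Sb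
  have := isProbabilityMeasure_gaussianMeasure X.μa h.posDef_Sa
  have := isProbabilityMeasure_gaussianMeasure X.μb h.posDef_Sb
  set γ := gaussianMeasure X.μa X.Sa
  set δ := gaussianMeasure X.μb X.Sb
  have hpair : ∀ u, HasLaw (fun ω => (X.A u ω, X.B (ι u) ω)) ((γ.prod δ).withDensity
      fun p => ENNReal.ofReal (Real.exp (g p.1 p.2))) X.P := fun u => by
    have := hasLaw_block hι h u
    rwa [block_apply hinj, ← hgdef] at this
  have hell : Measurable fun p : (X.Da → ℝ) × (X.Db → ℝ) =>
    ENNReal.ofReal (Real.exp (g p.1 p.2)) := by fun_prop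
  have hone : ∀ t : ℝ, 0 ≤ t → t ≤ 1 →
      ∫⁻ p, ENNReal.ofReal (Real.exp (t * g p.1 p.2)) ∂γ.prod δ ≤
        ENNReal.ofReal (Real.exp (-(X.signal * (t * (1 - t))))) := by
    intro t ht0 ht1
    have := h.lintegral_exp_mul_infoDensity_le X.μa X.μb ht0 ht1
    rw [← hgdef, hd, ← Real.exp_mul] at this
    refine this.trans (le_of_eq ?_)
    congr 2
    ring
  refine ⟨fun u v => ?_, fun u s hs0 hs1 => ?_, fun u v huv t ht0 ht1 => ?_,
    fun u v huv t ht0 ht1 => ?_, fun σ hσ => ?_⟩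
  · simp only [hscore]
    exact hg.comp_aemeasurable ((hA u).aemeasurable.prodMk (hB v).aemeasurable)
  · simp only [hscore]
    have h1 := (hpair u).lintegral_comp (f := fun p => ENNReal.ofReal (Real.exp (-s * g p.1 p.2)))
      (by fun_prop)
    refine (le_of_eq h1).trans ?_
    rw [lintegral_withDensity_eq_lintegral_mul _ hell (by fun_prop)]
    -- The density exp(g) of the true law turns the exponent −s into 1 − s, and the bound is
    -- symmetric under this exchange.
    have h2 := hone (1 - s) (by linarith) (by linarith)
    refine (le_of_eq (lintegral_congr fun p => ?_)).trans (h2.trans (le_of_eq ?_))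
    · rw [Pi.mul_apply, ← ENNReal.ofReal_mul (Real.exp_pos _).le, ← Real.exp_add]
      congr 2
      ring
    · congr 2
      ring
  · simp only [hscore]
    have hind : IndepFun (X.A u) (X.B v) X.P :=
      (indepFun_A_B hι huv).comp measurable_fst measurable_id
    have hlaw := ((indepFun_iff_hasLaw_prodMk_prod (hA u) (hB v)).1 hind)
    have h1 := hlaw.lintegral_comp (f := fun p => ENNReal.ofReal (Real.exp (t * g p.1 p.2)))
      (by fun_prop)
    exact (le_of_eq h1).trans (hone t ht0 ht1)
  · simp only [hscore]
    have hlaw := ((indepFun_iff_hasLaw_prodMk_prod (hpair u) (hB v)).1 (indepFun_A_B hι huv))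
    have hg1 : Measurable fun q : ((X.Da → ℝ) × (X.Db → ℝ)) × (X.Db → ℝ) => g q.1.1 q.2 :=
      hg.comp (by fun_prop :
        Measurable fun q : ((X.Da → ℝ) × (X.Db → ℝ)) × (X.Db → ℝ) => (q.1.1, q.2))
    have hg2 : Measurable fun q : ((X.Da → ℝ) × (X.Db → ℝ)) × (X.Db → ℝ) => g q.1.1 q.1.2 :=
      hg.comp measurable_fst
    have hg3 : Measurable fun q : (X.Da → ℝ) × (X.Db → ℝ) × (X.Db → ℝ) => g q.1 q.2.1 :=
      hg.comp (by fun_prop :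
        Measurable fun q : (X.Da → ℝ) × (X.Db → ℝ) × (X.Db → ℝ) => (q.1, q.2.1))
    have hg4 : Measurable fun q : (X.Da → ℝ) × (X.Db → ℝ) × (X.Db → ℝ) => g q.1 q.2.2 :=
      hg.comp (by fun_prop :
        Measurable fun q : (X.Da → ℝ) × (X.Db → ℝ) × (X.Db → ℝ) => (q.1, q.2.2))
    have hm1 : Measurable fun q : ((X.Da → ℝ) × (X.Db → ℝ)) × (X.Db → ℝ) =>
        ENNReal.ofReal (Real.exp (t * g q.1.1 q.2 - (1 - t) * g q.1.1 q.1.2)) := by fun_prop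
    have hm2 : Measurable fun q : (X.Da → ℝ) × (X.Db → ℝ) × (X.Db → ℝ) =>
        ENNReal.ofReal (Real.exp (t * g q.1 q.2.1 + t * g q.1 q.2.2)) := by fun_prop
    have h1 := hlaw.lintegral_comp hm1.aemeasurable
    refine (le_of_eq h1).trans ?_
    -- The same change of measure turns the weight −(1−t) on the true score into t.
    have h2 := h.lintegral_exp_path_le X.μa X.μb ht0 ht1
    rw [← hgdef, hd, ← Real.exp_mul] at h2
    refine le_trans (le_of_eq ?_) (h2.trans (le_of_eq ?_))
    · have hm3 : Measurable fun q : ((X.Da → ℝ) × (X.Db → ℝ)) × (X.Db → ℝ) =>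
          ENNReal.ofReal (Real.exp (g q.1.1 q.1.2)) := hell.comp measurable_fst
      rw [prod_withDensity_left hell, lintegral_withDensity_eq_lintegral_mul _ hm3 hm1,
        lintegral_prod _ (hm3.mul hm1).aemeasurable,
        lintegral_prod _ (Measurable.aemeasurable (by fun_prop)), lintegral_prod _ hm2.aemeasurable]
      refine lintegral_congr fun x => ?_
      rw [lintegral_prod _ (Measurable.aemeasurable (by fun_prop))]
      refine lintegral_congr fun y => lintegral_congr fun y' => ?_
      simp only [Pi.mul_apply]
      rw [← ENNReal.ofReal_mul (Real.exp_pos _).le, ← Real.exp_add]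
      congr 2
      ring
    · congr 2
      ring
  · simp only [hscore]
    have h1 : ∫⁻ p, ENNReal.ofReal (Real.exp (g p.1 p.2)) ∂γ.prod δ ≤ 1 := by
      simpa using hone 1 zero_le_one le_rfl
    have h2 := h.lintegral_exp_cycle_eq X.μa X.μb
    rw [← hgdef, hd, ← Real.exp_mul] at h2
    have h3 := lintegral_exp_swap_le hg h1 h2.le hinj hσ (iIndepFun_block hι)
      (fun u => by rw [hgdef]; exact hasLaw_block hι h u) (x₀ := 0) (fun v hv => by
        have e : X.block ι v = fun ω => ((0 : X.Da → ℝ), X.B v ω) := by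
          ext1 ω
          rw [block, Function.extend_apply' _ _ _ hv]
          rfl
        rw [e, Measure.dirac_prod]
        exact (HasLaw.mk (by fun_prop) rfl).comp (hB v))
    simp only [block_apply hinj] at h3
    refine h3.trans (le_of_eq ?_)
    rw [Finset.prod_ite, Finset.prod_const, Finset.prod_const_one, mul_one,
      ENNReal.ofReal_rpow_of_pos (Real.exp_pos _), ← ENNReal.ofReal_pow (by positivity),
      ← Real.exp_mul, ← Real.exp_nat_mul]
    congr 2
    ring

end CorrelatedGaussianDatabases

/-! ### The scores of the planted matching -/

theorem lintegral_exp_mul_gaussianReal (m c : ℝ) :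
    ∫⁻ x, ENNReal.ofReal (Real.exp (c * x)) ∂gaussianReal m 1 =
      ENNReal.ofReal (Real.exp (m * c + c ^ 2 / 2)) := by
  have h := mgf_id_gaussianReal (μ := m) (v := 1)
  have h2 := congrFun h c
  rw [← ofReal_integral_eq_lintegral_ofReal (integrable_exp_mul_gaussianReal c)
    (Eventually.of_forall fun x => (Real.exp_pos _).le)]
  rw [mgf] at h2
  simp only [id] at h2
  rw [h2]
  simp

theorem ProbabilityTheory.iIndepFun.lintegral_exp_sum_gaussianReal {κ Ω : Type*} [Fintype κ]
    [MeasurableSpace Ω] {P : Measure Ω} {W : κ → Ω → ℝ} (hW : iIndepFun W P) {m : κ → ℝ}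
    (hlaw : ∀ k, HasLaw (W k) (gaussianReal (m k) 1) P) (c : κ → ℝ) (r : ℝ) :
    ∫⁻ ω, ENNReal.ofReal (Real.exp (∑ k, c k * W k ω + r)) ∂P =
      ENNReal.ofReal (Real.exp (∑ k, (m k * c k + c k ^ 2 / 2) + r)) := by
  have hP := hW.isProbabilityMeasure
  have hm : Measurable fun x : κ → ℝ => ENNReal.ofReal (Real.exp (∑ k, c k * x k + r)) := by
    fun_prop
  have h1 : P.map (fun ω k => W k ω) = Measure.pi fun k => gaussianReal (m k) 1 := by
    rw [(iIndepFun_iff_map_fun_eq_pi_map fun k => (hlaw k).aemeasurable).1 hW]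
    congr 1
    ext1 k
    exact (hlaw k).map_eq
  have h2 := lintegral_map' hm.aemeasurable
    (aemeasurable_pi_lambda (fun ω k => W k ω) fun k => (hlaw k).aemeasurable)
  refine h2.symm.trans ?_
  rw [h1]
  have h3 : ∀ x : κ → ℝ, ENNReal.ofReal (Real.exp (∑ k, c k * x k + r)) =
      (∏ k, ENNReal.ofReal (Real.exp (c k * x k))) * ENNReal.ofReal (Real.exp r) := fun x => by
    rw [Real.exp_add, Real.exp_sum, ENNReal.ofReal_mul (Finset.prod_nonneg fun _ _ =>
      (Real.exp_pos _).le), ENNReal.ofReal_prod_of_nonneg fun _ _ => (Real.exp_pos _).le]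
  simp_rw [h3]
  rw [lintegral_mul_const' _ _ ENNReal.ofReal_ne_top,
    lintegral_pi_prod_eq (fun k => gaussianReal (m k) 1) (f := fun k y =>
      ENNReal.ofReal (Real.exp (c k * y))) (fun k => by fun_prop)]
  simp_rw [lintegral_exp_mul_gaussianReal]
  rw [Real.exp_add, Real.exp_sum, ENNReal.ofReal_mul (Finset.prod_nonneg fun _ _ =>
      (Real.exp_pos _).le), ENNReal.ofReal_prod_of_nonneg fun _ _ => (Real.exp_pos _).le]

namespace PlantedMatching

/-- Subtracting the signal turns μW into the log-likelihood ratio. The entries are independent, so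
all the moments are products of one-dimensional Gaussian moment generating functions. -/
theorem scoreBounds {X : PlantedMatching.{u, v}} {ι : X.U → X.V} (hι : ∀ u, ι u ∈ X.M u) :
    ScoreBounds X.P ι (fun ω u v => X.score ω u v - X.signal) X.signal := by
  classical
  have hT : ∀ u, HasLaw (X.W u (ι u)) (gaussianReal X.μ 1) X.P := fun u => X.law_mapped u _ (hι u)
  have hF : ∀ u v, v ≠ ι u → HasLaw (X.W u v) (gaussianReal 0 1) X.P := fun u v h =>
    X.law_unmapped u v fun hv => h (Option.mem_unique hv (hι u))
  have hz : X.signal = X.μ ^ 2 / 2 := rfl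
  have hlaw : ∀ (u : X.U) (v : X.V), v ≠ ι u → ∀ b : Bool,
      HasLaw (X.W u (if b then v else ι u)) (gaussianReal (if b then 0 else X.μ) 1) X.P := by
    rintro u v h (_ | _)
    · simpa using hT u
    · simpa using hF u v h
  refine ⟨fun u v => ?_, fun u s hs0 hs1 => ?_, fun u v huv t ht0 ht1 => ?_,
    fun u v huv t ht0 ht1 => ?_, fun σ hσ => ?_⟩
  · have h1 : AEMeasurable (X.W u v) X.P := by
      by_cases h : v = ι u
      · rw [h]
        exact (hT u).aemeasurable
      · exact (hF u v h).aemeasurable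
    exact (h1.const_mul _).sub_const _
  · have h1 := (X.indep.precomp (g := fun _ : Unit => (u, ι u))
      (fun _ _ _ => rfl)).lintegral_exp_sum_gaussianReal (fun _ => hT u) (fun _ => -s * X.μ)
      (s * X.signal)
    simp only [Finset.univ_unique, Finset.sum_singleton] at h1
    refine (le_of_eq (lintegral_congr fun ω => ?_)).trans (h1.le.trans (le_of_eq ?_))
    · simp only [score]
      congr 2
      ring
    · rw [hz]
      congr 2
      ring
  · have h1 := (X.indep.precomp (g := fun _ : Unit => (u, v))
      (fun _ _ _ => rfl)).lintegral_exp_sum_gaussianReal (fun _ => hF u v huv) (fun _ => t * X.μ)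
      (-t * X.signal)
    simp only [Finset.univ_unique, Finset.sum_singleton] at h1
    refine (le_of_eq (lintegral_congr fun ω => ?_)).trans (h1.le.trans (le_of_eq ?_))
    · simp only [score]
      congr 2
      ring
    · rw [hz]
      congr 2
      ring
  · have hinj : Function.Injective fun b : Bool => (u, if b then v else ι u) := by
      rintro (_ | _) (_ | _) h
      · rfl
      · exact absurd (congrArg Prod.snd h).symm huv
      · exact absurd (congrArg Prod.snd h) huv
      · rfl
    have h1 := (X.indep.precomp hinj).lintegral_exp_sum_gaussianReal (hlaw u v huv)
      (fun b => if b then t * X.μ else -(1 - t) * X.μ) ((1 - 2 * t) * X.signal)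
    simp only [Fintype.sum_bool, if_true, Bool.false_eq_true, if_false] at h1
    refine (le_of_eq (lintegral_congr fun ω => ?_)).trans (h1.le.trans (le_of_eq ?_))
    · simp only [score]
      congr 2
      ring
    · rw [hz]
      congr 2
      ring
  · set D := Finset.univ.filter fun u => σ u ≠ ι u with hD
    have hDm : ∀ u : D, σ u ≠ ι u := fun u => (Finset.mem_filter.1 u.2).2
    have hinj : Function.Injective fun k : D × Bool =>
        ((k.1 : X.U), if k.2 then σ k.1 else ι k.1) := by
      rintro ⟨u, b⟩ ⟨u', b'⟩ h
      obtain rfl : u = u' := Subtype.ext (congrArg Prod.fst h)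
      have h2 := congrArg Prod.snd h
      cases b <;> cases b'
      · rfl
      · exact absurd h2.symm (hDm u)
      · exact absurd h2 (hDm u)
      · rfl
    have h1 := (X.indep.precomp hinj).lintegral_exp_sum_gaussianReal
      (fun k => hlaw k.1 (σ k.1) (hDm k.1) k.2)
      (fun k => if k.2 then 1 / 2 * X.μ else -(1 / 2) * X.μ) 0
    simp only [Fintype.sum_prod_type, Fintype.sum_bool, if_true,
      Bool.false_eq_true, if_false, add_zero] at h1
    refine (le_of_eq (lintegral_congr fun ω => ?_)).trans (h1.le.trans (le_of_eq ?_))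
    -- Users with σ u = ι u contribute nothing. On the rest, the entries at σ u and at ι u are
    -- pairwise distinct, hence independent.
    · have h2 : ∑ u, (X.score ω u (σ u) - X.signal - (X.score ω u (ι u) - X.signal)) =
          ∑ u : D, (X.score ω u (σ u) - X.signal - (X.score ω u (ι u) - X.signal)) := by
        rw [Finset.sum_coe_sort D fun u => X.score ω u (σ u) - X.signal -
          (X.score ω u (ι u) - X.signal), hD, Finset.sum_filter_of_ne]
        intro u _ h3 h4
        exact h3 (by rw [h4, sub_self])
      rw [h2, Finset.mul_sum]
      congr 2
      refine Finset.sum_congr rfl fun u _ => ?_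
      simp only [score]
      ring
    · rw [Finset.sum_const, hz, Finset.card_univ, Fintype.card_coe, nsmul_eq_mul]
      congr 2
      ring

end PlantedMatching

/-! ### Outputs of the algorithms -/

namespace Algorithm

variable {U V : Type*} [Fintype U] [Fintype V] {S : Matrix U V ℝ} {τ : ℝ} {m : Matrix U V ℝ}

open Classical in
/-- The `0/1` matrix of a map. -/
noncomputable def mapMatrix (σ : U → V) : Matrix U V ℝ := fun u v => if v = σ u then 1 else 0

/-- Without coupling constraints the program decouples: changing a single entry stays feasible and
affects only its own term. -/
theorem IsOutput.threshold (h : thresholdTesting.IsOutput S τ m) (u : U) (v : V) :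
    (m u v = 1 → τ ≤ S u v) ∧ (m u v = 0 → S u v ≤ τ) := by
  classical
  have key : ∀ c : ℝ, 0 ≤ c → c ≤ 1 → (S u v - τ) * c ≤ (S u v - τ) * m u v := by
    intro c hc0 hc1
    have h1 := h.2.2 (fun u' v' => if u' = u ∧ v' = v then c else m u' v') (by
      refine ⟨fun u' v' => ?_, fun h => by simp at h, fun h => by simp at h⟩
      dsimp only
      split_ifs
      · exact ⟨hc0, hc1⟩
      · exact h.2.1.1 u' v')
    have h2 : objective S τ (fun u' v' => if u' = u ∧ v' = v then c else m u' v') =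
        objective S τ m + (S u v - τ) * (c - m u v) := by
      have h3 : ∀ u' v', (S u' v' - τ) * (if u' = u ∧ v' = v then c else m u' v') =
          (S u' v' - τ) * m u' v' +
            (if u' = u then (if v' = v then (S u v - τ) * (c - m u v) else 0) else 0) := by
        intro u' v'
        by_cases hu : u' = u
        · by_cases hv : v' = v
          · subst hu hv
            simp
            ring
          · simp [hv]
        · simp [hu]
      simp only [objective, h3, Finset.sum_add_distrib]
      simp
    rw [h2] at h1
    linarith
  constructor
  · intro hm
    have := key 0 le_rfl zero_le_one
    rw [hm] at this
    linarith
  · intro hm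
    have := key 1 zero_le_one le_rfl
    rw [hm] at this
    linarith

theorem objective_mapMatrix (σ : U → V) :
    objective S τ (mapMatrix σ) = ∑ u, (S u (σ u) - τ) := by
  classical
  simp [objective, mapMatrix, Finset.sum_ite_eq']

theorem feasible_mapMatrix {alg : Algorithm} {σ : U → V}
    (hσ : alg = maxLikelihood → Function.Injective σ) : alg.Feasible (mapMatrix σ) := by
  classical
  refine ⟨fun u v => ?_, fun _ u => by simp [mapMatrix], fun h v => ?_⟩
  · unfold mapMatrix
    split_ifs <;> simp
  · unfold mapMatrix
    by_cases hv : ∃ u, σ u = v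
    · obtain ⟨u, rfl⟩ := hv
      simp only [(hσ h).eq_iff]
      rw [Finset.sum_ite_eq, if_pos (Finset.mem_univ _)]
    · push Not at hv
      simp [fun u => (hv u).symm]

/-- An integral matrix with unit row sums is the graph of a map, injective when column sums are at
most one. The threshold contributes the same constant for every map and therefore disappears. -/
theorem IsOutput.exists_map {alg : Algorithm} (halg : alg = maxRow ∨ alg = maxLikelihood)
    (h : alg.IsOutput S τ m) : ∃ σ : U → V, m = mapMatrix σ ∧
      (alg = maxLikelihood → Function.Injective σ) ∧
      ∀ σ' : U → V, (alg = maxLikelihood → Function.Injective σ') →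
        ∑ u, S u (σ' u) ≤ ∑ u, S u (σ u) := by
  classical
  have h1 := h.2.1.2.1 halg
  have hnn : ∀ u v, 0 ≤ m u v := fun u v => (h.2.1.1 u v).1
  have h2 : ∀ u, ∃ v, m u v = 1 := by
    intro u
    by_contra! hu
    have := h1 u
    rw [Finset.sum_eq_zero fun v _ => (h.1 u v).resolve_right (hu v)] at this
    exact zero_ne_one this
  choose σ hσ using h2
  have h3 : m = mapMatrix σ := by
    ext u v
    rw [mapMatrix]
    split_ifs with hv
    · rw [hv, hσ]
    · refine (h.1 u v).resolve_right fun h4 => ?_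
      have h5 : ∑ v' ∈ {v, σ u}, m u v' ≤ ∑ v', m u v' :=
        Finset.sum_le_sum_of_subset_of_nonneg (Finset.subset_univ _) fun v' _ _ => hnn u v'
      rw [Finset.sum_pair hv, h1, h4, hσ] at h5
      norm_num at h5
  refine ⟨σ, h3, fun hml u u' huu => ?_, fun σ' hσ' => ?_⟩
  · by_contra hne
    have h5 : ∑ u' ∈ {u, u'}, m u' (σ u) ≤ ∑ u', m u' (σ u) :=
      Finset.sum_le_sum_of_subset_of_nonneg (Finset.subset_univ _) fun u' _ _ => hnn u' _
    have h6 := h.2.1.2.2 hml (σ u)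
    rw [Finset.sum_pair hne, hσ, huu, hσ] at h5
    rw [huu] at h6
    linarith
  · have h4 := h.2.2 _ (feasible_mapMatrix hσ')
    rw [h3, objective_mapMatrix, objective_mapMatrix, Finset.sum_sub_distrib,
      Finset.sum_sub_distrib] at h4
    linarith

/-- The number of wrong rows and columns of `m` as an estimate of the matrix of `ι`. -/
noncomputable def mismatch (ι : U → V) (m : Matrix U V ℝ) : ℕ :=
  Set.ncard {u : U | ∃ v, m u v ≠ mapMatrix ι u v} +
    Set.ncard {v : V | ∃ u, m u v ≠ mapMatrix ι u v}

theorem mismatch_le_two_mul (ι : U → V) (m : Matrix U V ℝ) :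
    mismatch ι m ≤ 2 * Set.ncard {p : U × V | m p.1 p.2 ≠ mapMatrix ι p.1 p.2} := by
  have h1 : {u : U | ∃ v, m u v ≠ mapMatrix ι u v} =
      Prod.fst '' {p : U × V | m p.1 p.2 ≠ mapMatrix ι p.1 p.2} := by
    ext u; simp
  have h2 : {v : V | ∃ u, m u v ≠ mapMatrix ι u v} =
      Prod.snd '' {p : U × V | m p.1 p.2 ≠ mapMatrix ι p.1 p.2} := by
    ext u; simp
  rw [mismatch, h1, h2, two_mul]
  exact add_le_add (Set.ncard_image_le (Set.toFinite _)) (Set.ncard_image_le (Set.toFinite _))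

open Classical in
-- A user u with σ u ≠ ι u spoils its own row and at most the two columns σ u and ι u.
theorem mismatch_mapMatrix_le (ι σ : U → V) :
    mismatch ι (mapMatrix σ) ≤ 3 * (Finset.univ.filter fun u => σ u ≠ ι u).card := by
  set D := Finset.univ.filter fun u => σ u ≠ ι u with hD
  have h1 : {u : U | ∃ v, mapMatrix σ u v ≠ mapMatrix ι u v} ⊆ D := by
    rintro u ⟨v, hv⟩
    simp only [hD, Finset.coe_filter, Finset.mem_univ, true_and, Set.mem_ofPred_eq]
    intro h
    exact hv (by simp [mapMatrix, h])
  have h2 : {v : V | ∃ u, mapMatrix σ u v ≠ mapMatrix ι u v} ⊆ ↑(D.image σ ∪ D.image ι) := by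
    rintro v ⟨u, hv⟩
    have hu : u ∈ D := h1 ⟨v, hv⟩
    simp only [Finset.coe_union, Finset.coe_image, Set.mem_union, Set.mem_image]
    by_cases h3 : v = σ u
    · exact Or.inl ⟨u, hu, h3.symm⟩
    · by_cases h4 : v = ι u
      · exact Or.inr ⟨u, hu, h4.symm⟩
      · simp [mapMatrix, h3, h4] at hv
  have h3 := Set.ncard_le_ncard h1 (Finset.finite_toSet _)
  have h4 := Set.ncard_le_ncard h2 (Finset.finite_toSet _)
  rw [Set.ncard_coe_finset] at h3 h4
  have h5 := Finset.card_union_le (D.image σ) (D.image ι)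
  have h6 : (D.image σ).card ≤ D.card := Finset.card_image_le
  have h7 : (D.image ι).card ≤ D.card := Finset.card_image_le
  unfold mismatch
  omega

end Algorithm

namespace AlignmentSetting

theorem misaligned_eq_mismatch {X : AlignmentSetting.{u, v}} {ι : X.U → X.V}
    (hι : ∀ u, ι u ∈ X.M u) (m : Matrix X.U X.V ℝ) :
    X.misaligned m = Algorithm.mismatch ι m := by
  classical
  have h : X.trueMatrix = Algorithm.mapMatrix ι := by
    ext u v
    have h1 : v ∈ X.M u ↔ v = ι u := ⟨fun hv => Option.mem_unique hv (hι u), fun hv => hv ▸ hι u⟩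
    simp only [trueMatrix, PEquiv.toMatrix_apply, Algorithm.mapMatrix, h1]
  rw [misaligned, h, Algorithm.mismatch]

theorem exists_forall_mem_of_sizeM_eq {X : AlignmentSetting.{u, v}} (h : X.sizeM = X.sizeU) :
    ∃ ι : X.U → X.V, ∀ u, ι u ∈ X.M u := by
  have h1 : Set.InjOn Prod.fst {p : X.U × X.V | p.2 ∈ X.M p.1} := by
    rintro ⟨u, v⟩ hp ⟨u', v'⟩ hp' (rfl : u = u')
    exact Prod.ext rfl (Option.mem_unique hp hp')
  have h2 : Prod.fst '' {p : X.U × X.V | p.2 ∈ X.M p.1} = Set.univ := by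
    refine Set.eq_of_subset_of_ncard_le (Set.subset_univ _) ?_ (Set.toFinite _)
    rw [h1.ncard_image, Set.ncard_univ, Nat.card_eq_fintype_card]
    exact h.ge
  have h3 : ∀ u, ∃ v, v ∈ X.M u := by
    intro u
    have hu : u ∈ Prod.fst '' {p : X.U × X.V | p.2 ∈ X.M p.1} := h2 ▸ Set.mem_univ u
    obtain ⟨⟨u', v⟩, hp, rfl⟩ := hu
    exact ⟨v, hp⟩
  exact ⟨fun u => (h3 u).choose, fun u => (h3 u).choose_spec⟩

end AlignmentSetting

/-! ### Bounds on expectations -/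

/-- A nonnegative random variable whose expectation is at most `c`. -/
structure MeanLE {Ω : Type*} [MeasurableSpace Ω] (P : Measure Ω) (f : Ω → ℝ) (c : ℝ) : Prop where
  aemeasurable : AEMeasurable f P
  nonneg : ∀ ω, 0 ≤ f ω
  bound_nonneg : 0 ≤ c
  lintegral_le : ∫⁻ ω, ENNReal.ofReal (f ω) ∂P ≤ ENNReal.ofReal c

namespace MeanLE

variable {Ω : Type*} [MeasurableSpace Ω] {P : Measure Ω} {f g : Ω → ℝ} {c d : ℝ}

theorem add (hf : MeanLE P f c) (hg : MeanLE P g d) : MeanLE P (fun ω => f ω + g ω) (c + d) where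
  aemeasurable := hf.aemeasurable.add hg.aemeasurable
  nonneg ω := add_nonneg (hf.nonneg ω) (hg.nonneg ω)
  bound_nonneg := add_nonneg hf.bound_nonneg hg.bound_nonneg
  lintegral_le := by
    simp_rw [fun ω => ENNReal.ofReal_add (hf.nonneg ω) (hg.nonneg ω)]
    rw [lintegral_add_left' hf.aemeasurable.ennreal_ofReal,
      ENNReal.ofReal_add hf.bound_nonneg hg.bound_nonneg]
    exact add_le_add hf.lintegral_le hg.lintegral_le

theorem const_mul (hf : MeanLE P f c) {r : ℝ} (hr : 0 ≤ r) :
    MeanLE P (fun ω => r * f ω) (r * c) where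
  aemeasurable := hf.aemeasurable.const_mul r
  nonneg ω := mul_nonneg hr (hf.nonneg ω)
  bound_nonneg := mul_nonneg hr hf.bound_nonneg
  lintegral_le := by
    simp_rw [ENNReal.ofReal_mul hr]
    rw [lintegral_const_mul' _ _ ENNReal.ofReal_ne_top]
    exact mul_le_mul_right hf.lintegral_le _

theorem sum {ι : Type*} {s : Finset ι} {f : ι → Ω → ℝ} {c : ι → ℝ}
    (h : ∀ i ∈ s, MeanLE P (f i) (c i)) : MeanLE P (fun ω => ∑ i ∈ s, f i ω) (∑ i ∈ s, c i) := by
  classical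
  induction s using Finset.induction_on with
  | empty => exact ⟨by simp, by simp, by simp, by simp⟩
  | insert i s hi ih =>
    simp only [Finset.sum_insert hi]
    exact (h i (by simp)).add (ih fun j hj => h j (by simp [hj]))

theorem exp {k : Ω → ℝ} (hk : AEMeasurable k P) {a : ℝ}
    (h : ∫⁻ ω, ENNReal.ofReal (Real.exp (k ω)) ∂P ≤ ENNReal.ofReal (Real.exp a)) :
    MeanLE P (fun ω => Real.exp (k ω)) (Real.exp a) :=
  ⟨Real.measurable_exp.comp_aemeasurable hk, fun _ => (Real.exp_pos _).le, (Real.exp_pos _).le, h⟩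

theorem exp_add {k : Ω → ℝ} {a : ℝ} (h : MeanLE P (fun ω => Real.exp (k ω)) (Real.exp a)) (r : ℝ) :
    MeanLE P (fun ω => Real.exp (k ω + r)) (Real.exp (a + r)) := by
  have h1 := h.const_mul (Real.exp_pos r).le
  simpa only [mul_comm (Real.exp r), ← Real.exp_add] using h1

/-- The dominated function need not be measurable, so the number of misaligned users can be inserted
directly. -/
theorem integral_le (hf : MeanLE P f c) (hg : ∀ ω, 0 ≤ g ω) (h : ∀ᵐ ω ∂P, g ω ≤ f ω) :
    ∫ ω, g ω ∂P ≤ c := by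
  by_cases hi : Integrable g P
  · rw [integral_eq_lintegral_of_nonneg_ae (Eventually.of_forall hg) hi.1]
    refine ENNReal.toReal_le_of_le_ofReal hf.bound_nonneg (le_trans (lintegral_mono_ae ?_)
      hf.lintegral_le)
    filter_upwards [h] with ω hω using ENNReal.ofReal_le_ofReal hω
  -- A function that is not integrable has integral 0 by convention.
  · rw [integral_undef hi]
    exact hf.bound_nonneg

end MeanLE

theorem sum_ite_eq_le {U V : Type*} [Fintype U] [Fintype V] [DecidableEq V] (ι : U → V) {a b : ℝ}
    (hb : 0 ≤ b) : ∑ u, ∑ v, (if v = ι u then a else b) ≤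
      Fintype.card U * a + Fintype.card U * Fintype.card V * b := by
  have h : ∀ u v, (if v = ι u then a else b) ≤ (if v = ι u then a else 0) + b := by
    intro u v
    split_ifs <;> linarith
  refine (Finset.sum_le_sum fun u _ => Finset.sum_le_sum fun v _ => h u v).trans (le_of_eq ?_)
  simp [Finset.sum_add_distrib, mul_assoc]

theorem add_le_sum_of_ne {V : Type*} [Fintype V] {f : V → ℝ} (hf : ∀ v, 0 ≤ f v) {v v' : V}
    (h : v ≠ v') : f v + f v' ≤ ∑ w, f w := by
  classical
  rw [← Finset.sum_pair h]
  exact Finset.sum_le_sum_of_subset_of_nonneg (Finset.subset_univ _) fun w _ _ => hf w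

/-! ### Expected number of errors of each algorithm -/

namespace ScoreBounds

variable {U V Ω : Type*} [Fintype U] [MeasurableSpace Ω] {P : Measure Ω} {ι : U → V}
  {G : Ω → U → V → ℝ} {z : ℝ}

/-- The exponential is at least 1 when the true score is below y = z(2t − 1): a Chernoff bound. At
this level, s = 1 − t minimizes the exponent of the true-score bound, and t that of the false-score
bound. -/
theorem meanLE_true (h : ScoreBounds P ι G z) (u : U) {t : ℝ} (ht0 : 0 ≤ t) (ht1 : t ≤ 1) :
    MeanLE P (fun ω => Real.exp ((1 - t) * (z * (2 * t - 1) - G ω u (ι u))))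
      (Real.exp (-(z * (1 - t) ^ 2))) := by
  have h1 := (MeanLE.exp ((h.aemeasurable u (ι u)).const_mul (-(1 - t)))
    (h.true_le u (1 - t) (by linarith) (by linarith))).exp_add ((1 - t) * (z * (2 * t - 1)))
  convert h1 using 2 with ω
  · congr 1
    ring
  · ring

theorem meanLE_false (h : ScoreBounds P ι G z) {u : U} {v : V} (huv : v ≠ ι u) {t : ℝ}
    (ht0 : 0 ≤ t) (ht1 : t ≤ 1) :
    MeanLE P (fun ω => Real.exp (t * (G ω u v - z * (2 * t - 1)))) (Real.exp (-(z * t ^ 2))) := by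
  have h1 := (MeanLE.exp ((h.aemeasurable u v).const_mul t)
    (h.false_le u v huv t ht0 ht1)).exp_add (-(t * (z * (2 * t - 1))))
  convert h1 using 2 with ω
  · congr 1
    ring
  · ring

theorem meanLE_row (h : ScoreBounds P ι G z) {u : U} {v : V} (huv : v ≠ ι u) {t : ℝ}
    (ht0 : 1 / 2 ≤ t) (ht1 : t ≤ 1) :
    MeanLE P (fun ω => Real.exp (t * G ω u v - (1 - t) * G ω u (ι u) -
      (2 * t - 1) * (z * (2 * t - 1)))) (Real.exp (-(z * (1 - t) ^ 2) + -(z * t ^ 2))) := by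
  have h1 := (MeanLE.exp (k := fun ω => t * G ω u v - (1 - t) * G ω u (ι u))
    (((h.aemeasurable u v).const_mul t).sub ((h.aemeasurable u (ι u)).const_mul (1 - t)))
    (h.row_le u v huv t ht0 ht1)).exp_add (-((2 * t - 1) * (z * (2 * t - 1))))
  have e : -(z * (1 - t) ^ 2) + -(z * t ^ 2) =
      -(2 * z * (t * (1 - t))) + -((2 * t - 1) * (z * (2 * t - 1))) := by ring
  rw [e]
  simp only [sub_eq_add_neg] at h1 ⊢
  exact h1

variable [Fintype V]

open Classical in
-- Every wrong entry is a true score below the level or a false score above it, and the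
-- corresponding exponential is then at least 1.
theorem integral_mismatch_threshold_le (h : ScoreBounds P ι G z) {S : Ω → Matrix U V ℝ} {r τ : ℝ}
    (hS : ∀ ω u v, S ω u v = G ω u v + r) {m : Ω → Matrix U V ℝ}
    (hm : ∀ᵐ ω ∂P, Algorithm.thresholdTesting.IsOutput (S ω) τ (m ω)) {t : ℝ} (ht0 : 0 ≤ t)
    (ht1 : t ≤ 1) (hτ : τ = z * (2 * t - 1) + r) :
    ∫ ω, (Algorithm.mismatch ι (m ω) : ℝ) ∂P ≤
      2 * (Fintype.card U * Real.exp (-(z * (1 - t) ^ 2)) +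
        Fintype.card U * Fintype.card V * Real.exp (-(z * t ^ 2))) := by
  have h1 : ∀ u v, MeanLE P (fun ω => if v = ι u then
      Real.exp ((1 - t) * (z * (2 * t - 1) - G ω u (ι u))) else
      Real.exp (t * (G ω u v - z * (2 * t - 1))))
      (if v = ι u then Real.exp (-(z * (1 - t) ^ 2)) else Real.exp (-(z * t ^ 2))) := by
    intro u v
    split_ifs with hv
    · exact h.meanLE_true u ht0 ht1
    · exact h.meanLE_false hv ht0 ht1
  have h2 := (MeanLE.sum (s := Finset.univ) fun u _ =>
    MeanLE.sum (s := Finset.univ) fun v _ => h1 u v).const_mul zero_le_two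
  refine (h2.integral_le (fun ω => Nat.cast_nonneg _) ?_).trans
    (mul_le_mul_of_nonneg_left (sum_ite_eq_le ι (Real.exp_pos _).le) zero_le_two)
  filter_upwards [hm] with ω hω
  have h3 : (Algorithm.mismatch ι (m ω) : ℝ) ≤
      2 * (Set.ncard {p : U × V | m ω p.1 p.2 ≠ Algorithm.mapMatrix ι p.1 p.2} : ℝ) := by
    exact_mod_cast Algorithm.mismatch_le_two_mul ι (m ω)
  refine h3.trans (mul_le_mul_of_nonneg_left ?_ zero_le_two)
  rw [Set.ncard_eq_toFinset_card', ← Fintype.sum_prod_type', Finset.card_eq_sum_ones]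
  push_cast
  rw [Set.toFinset_ofPred, Finset.sum_filter]
  refine Finset.sum_le_sum fun p _ => ?_
  split_ifs with h4 h5 h5
  · rw [h5] at h4
    have h6 : m ω p.1 (ι p.1) = 0 := (hω.1 _ _).resolve_right (by simpa [Algorithm.mapMatrix] using h4)
    have h7 := (hω.threshold p.1 (ι p.1)).2 h6
    rw [hS, hτ] at h7
    exact Real.one_le_exp (mul_nonneg (by linarith) (by linarith))
  · have h6 : m ω p.1 p.2 = 1 := (hω.1 _ _).resolve_left (by simpa [Algorithm.mapMatrix, h5] using h4)
    have h7 := (hω.threshold p.1 p.2).1 h6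
    rw [hS, hτ] at h7
    exact Real.one_le_exp (mul_nonneg ht0 (by linarith))
  · exact (Real.exp_pos _).le
  · exact (Real.exp_pos _).le

open Classical in
-- For each changed user, 1 + (1−t)(G u (σ u) − G u (ι u)) is at most the two exponentials of that
-- pair. Summed over users the gains are nonnegative, so they can be dropped. Only the comparison of
-- total scores with ι is used, which is why the bound serves both optimizing algorithms.
theorem card_ne_le_of_sum_nonneg {G : U → V → ℝ} {σ : U → V} {t y : ℝ} (ht0 : 1 / 2 ≤ t)
    (ht1 : t ≤ 1) (h : ∑ u, G u (ι u) ≤ ∑ u, G u (σ u)) :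
    ((Finset.univ.filter fun u => σ u ≠ ι u).card : ℝ) ≤
      ∑ u, ∑ v, if v = ι u then Real.exp ((1 - t) * (y - G u (ι u))) else
        Real.exp (t * (G u v - y)) := by
  have h1 : ∀ u, (if σ u ≠ ι u then (1 : ℝ) else 0) + (1 - t) * (G u (σ u) - G u (ι u)) ≤
      ∑ v, if v = ι u then Real.exp ((1 - t) * (y - G u (ι u))) else
        Real.exp (t * (G u v - y)) := by
    intro u
    by_cases hu : σ u = ι u
    · simp only [hu, sub_self, mul_zero, ne_eq, not_true_eq_false, if_false, add_zero]
      refine Finset.sum_nonneg fun v _ => ?_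
      split_ifs <;> exact (Real.exp_pos _).le
    · refine le_trans ?_ (add_le_sum_of_ne (fun v => ?_) (Ne.symm hu))
      · simp only [ne_eq, hu, not_false_eq_true, if_true, if_false]
        have e1 := Real.add_one_le_exp ((1 - t) * (y - G u (ι u)))
        -- Here 1 − t ≤ t makes the slope t of the exponential sufficient.
        have e2 : (1 - t) * (G u (σ u) - y) ≤ Real.exp (t * (G u (σ u) - y)) := by
          have e3 := Real.add_one_le_exp (t * (G u (σ u) - y))
          have e4 := (Real.exp_pos (t * (G u (σ u) - y))).le
          rcases le_total 0 (G u (σ u) - y) with h5 | h5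
          · nlinarith
          · nlinarith
        linarith
      · split_ifs <;> exact (Real.exp_pos _).le
  have h2 := Finset.sum_le_sum fun u (_ : u ∈ Finset.univ) => h1 u
  rw [Finset.sum_add_distrib, ← Finset.mul_sum, Finset.sum_sub_distrib] at h2
  have h3 : ((Finset.univ.filter fun u => σ u ≠ ι u).card : ℝ) =
      ∑ u, if σ u ≠ ι u then (1 : ℝ) else 0 := by
    rw [← Finset.sum_filter, Finset.sum_const, nsmul_eq_mul, mul_one]
  rw [h3]
  nlinarith

open Classical in
theorem integral_mismatch_le (h : ScoreBounds P ι G z) (hι : Function.Injective ι)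
    {S : Ω → Matrix U V ℝ} {r τ : ℝ} (hS : ∀ ω u v, S ω u v = G ω u v + r)
    {m : Ω → Matrix U V ℝ} {alg : Algorithm} (halg : alg = .maxRow ∨ alg = .maxLikelihood)
    (hm : ∀ᵐ ω ∂P, alg.IsOutput (S ω) τ (m ω)) {t : ℝ} (ht0 : 1 / 2 ≤ t) (ht1 : t ≤ 1) :
    ∫ ω, (Algorithm.mismatch ι (m ω) : ℝ) ∂P ≤
      3 * (Fintype.card U * Real.exp (-(z * (1 - t) ^ 2)) +
        Fintype.card U * Fintype.card V * Real.exp (-(z * t ^ 2))) := by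
  have h1 : ∀ u v, MeanLE P (fun ω => if v = ι u then
      Real.exp ((1 - t) * (z * (2 * t - 1) - G ω u (ι u))) else
      Real.exp (t * (G ω u v - z * (2 * t - 1))))
      (if v = ι u then Real.exp (-(z * (1 - t) ^ 2)) else Real.exp (-(z * t ^ 2))) := by
    intro u v
    split_ifs with hv
    · exact h.meanLE_true u (by linarith) ht1
    · exact h.meanLE_false hv (by linarith) ht1
  have h2 := (MeanLE.sum (s := Finset.univ) fun u _ =>
    MeanLE.sum (s := Finset.univ) fun v _ => h1 u v).const_mul zero_le_three
  refine (h2.integral_le (fun ω => Nat.cast_nonneg _) ?_).trans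
    (mul_le_mul_of_nonneg_left (sum_ite_eq_le ι (Real.exp_pos _).le) zero_le_three)
  filter_upwards [hm] with ω hω
  obtain ⟨σ, hσm, -, hopt⟩ := hω.exists_map halg
  have h3 : (Algorithm.mismatch ι (m ω) : ℝ) ≤
      3 * ((Finset.univ.filter fun u => σ u ≠ ι u).card : ℝ) := by
    rw [hσm]
    exact_mod_cast Algorithm.mismatch_mapMatrix_le ι σ
  refine h3.trans (mul_le_mul_of_nonneg_left ?_ zero_le_three)
  have h4 := hopt ι fun _ => hι
  simp only [hS, Finset.sum_add_distrib, add_le_add_iff_right] at h4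
  exact card_ne_le_of_sum_nonneg ht0 ht1 h4

open Classical in
-- Either the true score is at most y, or both scores exceed it, and then tG u v − (1−t)G u (ι u) ≥
-- (2t−1)G u (ι u) ≥ (2t−1)y. Treating the two scores jointly gains the factor exp(−z(1−t)²) over
-- the plain false-score bound.
theorem ite_ne_le_of_le {G : U → V → ℝ} {u : U} {v : V} {t y : ℝ} (ht0 : 1 / 2 ≤ t) (ht1 : t ≤ 1)
    (hv : v ≠ ι u) (h : G u (ι u) ≤ G u v) :
    1 ≤ ∑ v, if v = ι u then Real.exp ((1 - t) * (y - G u (ι u))) else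
        Real.exp (t * G u v - (1 - t) * G u (ι u) - (2 * t - 1) * y) := by
  refine le_trans ?_ (add_le_sum_of_ne (fun v => ?_) hv)
  · simp only [if_neg hv, if_true]
    rcases le_total (G u (ι u)) y with h1 | h1
    · have := Real.one_le_exp (mul_nonneg (sub_nonneg.2 ht1) (sub_nonneg.2 h1))
      linarith [Real.exp_pos (t * G u v - (1 - t) * G u (ι u) - (2 * t - 1) * y)]
    · have : 1 ≤ Real.exp (t * G u v - (1 - t) * G u (ι u) - (2 * t - 1) * y) :=
        Real.one_le_exp (by nlinarith)
      linarith [Real.exp_pos ((1 - t) * (y - G u (ι u)))]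
  · split_ifs <;> exact (Real.exp_pos _).le

open Classical in
theorem meanLE_sum_row (h : ScoreBounds P ι G z) {t : ℝ} (ht0 : 1 / 2 ≤ t) (ht1 : t ≤ 1) :
    MeanLE P (fun ω => ∑ u, ∑ v, if v = ι u then
        Real.exp ((1 - t) * (z * (2 * t - 1) - G ω u (ι u))) else
        Real.exp (t * G ω u v - (1 - t) * G ω u (ι u) - (2 * t - 1) * (z * (2 * t - 1))))
      (∑ u, ∑ v, if v = ι u then Real.exp (-(z * (1 - t) ^ 2)) else
        Real.exp (-(z * (1 - t) ^ 2) + -(z * t ^ 2))) := by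
  refine MeanLE.sum fun u _ => MeanLE.sum fun v _ => ?_
  split_ifs with hv
  · exact h.meanLE_true u (by linarith) ht1
  · exact h.meanLE_row hv ht0 ht1

open Classical in
theorem integral_mismatch_maxRow_le (h : ScoreBounds P ι G z)
    {S : Ω → Matrix U V ℝ} {r τ : ℝ} (hS : ∀ ω u v, S ω u v = G ω u v + r)
    {m : Ω → Matrix U V ℝ} (hm : ∀ᵐ ω ∂P, Algorithm.maxRow.IsOutput (S ω) τ (m ω)) {t : ℝ}
    (ht0 : 1 / 2 ≤ t) (ht1 : t ≤ 1) :
    ∫ ω, (Algorithm.mismatch ι (m ω) : ℝ) ∂P ≤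
      3 * (Fintype.card U * Real.exp (-(z * (1 - t) ^ 2)) +
        Fintype.card U * Fintype.card V * Real.exp (-(z * (1 - t) ^ 2) + -(z * t ^ 2))) := by
  have h2 := (h.meanLE_sum_row ht0 ht1).const_mul zero_le_three
  refine (h2.integral_le (fun ω => Nat.cast_nonneg _) ?_).trans
    (mul_le_mul_of_nonneg_left (sum_ite_eq_le ι (Real.exp_pos _).le) zero_le_three)
  filter_upwards [hm] with ω hω
  obtain ⟨σ, hσm, -, hopt⟩ := hω.exists_map (Or.inl rfl)
  have h3 : (Algorithm.mismatch ι (m ω) : ℝ) ≤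
      3 * ((Finset.univ.filter fun u => σ u ≠ ι u).card : ℝ) := by
    rw [hσm]
    exact_mod_cast Algorithm.mismatch_mapMatrix_le ι σ
  refine h3.trans (mul_le_mul_of_nonneg_left ?_ zero_le_three)
  have h4 : ∀ u, G ω u (ι u) ≤ G ω u (σ u) := by
    intro u
    -- Rows are maximized separately, so restoring one row is a legitimate competitor.
    have h5 := hopt (Function.update σ u (ι u)) (by simp)
    simp only [hS, Finset.sum_add_distrib, add_le_add_iff_right] at h5
    rw [← Finset.add_sum_erase _ _ (Finset.mem_univ u),
      ← Finset.add_sum_erase _ (fun u => G ω u (σ u)) (Finset.mem_univ u),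
      Function.update_self, Finset.sum_congr rfl fun x hx => by
        rw [Function.update_of_ne (Finset.ne_of_mem_erase hx)]] at h5
    linarith
  rw [Finset.card_eq_sum_ones, Finset.sum_filter]
  push_cast
  refine Finset.sum_le_sum fun u _ => ?_
  split_ifs with h5
  · exact ite_ne_le_of_le ht0 ht1 h5 (h4 u)
  · refine Finset.sum_nonneg fun v _ => ?_
    split_ifs <;> exact (Real.exp_pos _).le

end ScoreBounds

/-! ### Maximum likelihood estimation -/

open Classical in
/-- The injections that take the value of `ι` or an unmapped value at each point, with at most as
many unmapped values as changes to other mapped values. -/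
noncomputable def swapMaps {U V : Type*} [Fintype U] [Fintype V] (ι : U → V) : Finset (U → V) :=
  Finset.univ.filter fun σ => Function.Injective σ ∧
    (Finset.univ.filter fun u => σ u ∉ Set.range ι).card ≤
      (Finset.univ.filter fun u => σ u ≠ ι u ∧ σ u ∈ Set.range ι).card

section Combinatorics

variable {U V : Type*} [Fintype U] [Fintype V] {ι : U → V}

/-- The optimal σ is cut into two injections. On E a user takes an unmapped value while its true
value stays free, so it can be restored alone and its row must favour the wrong value. Off E, a user
u with an unmapped value has ι u taken by another user; charging u to that user yields the
inequality defining `swapMaps`. -/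
theorem exists_swapMaps (hι : Function.Injective ι) {σ : U → V} (hσ : Function.Injective σ)
    {S : U → V → ℝ}
    (hopt : ∀ σ' : U → V, Function.Injective σ' → ∑ u, S u (σ' u) ≤ ∑ u, S u (σ u)) :
    ∃ σ' ∈ swapMaps ι, 0 ≤ ∑ u, (S u (σ' u) - S u (ι u)) ∧
      ∀ u, σ u ≠ ι u → σ' u ≠ ι u ∨ (σ u ∉ Set.range ι ∧ S u (ι u) ≤ S u (σ u)) := by
  classical
  obtain ⟨E, hE⟩ : ∃ E : Set U, E = {u | σ u ≠ ι u ∧ σ u ∉ Set.range ι ∧ ι u ∉ Set.range σ} :=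
    ⟨_, rfl⟩
  have hEm : ∀ u, u ∈ E ↔ σ u ≠ ι u ∧ σ u ∉ Set.range ι ∧ ι u ∉ Set.range σ := fun u => by
    rw [hE]
    rfl
  obtain ⟨σ₁, hσ₁⟩ : ∃ σ₁ : U → V, σ₁ = fun u => if u ∈ E then ι u else σ u := ⟨_, rfl⟩
  obtain ⟨σ₂, hσ₂⟩ : ∃ σ₂ : U → V, σ₂ = fun u => if u ∈ E then σ u else ι u := ⟨_, rfl⟩
  have h1 : Function.Injective σ₁ := by
    intro u u' h
    simp only [hσ₁] at h
    split_ifs at h with h2 h3 h3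
    · exact hι h
    · exact absurd ⟨u', h.symm⟩ ((hEm u).1 h2).2.2
    · exact absurd ⟨u, h⟩ ((hEm u').1 h3).2.2
    · exact hσ h
  have h2 : Function.Injective σ₂ := by
    intro u u' h
    simp only [hσ₂] at h
    split_ifs at h with h2 h3 h3
    · exact hσ h
    · exact absurd ⟨u', h.symm⟩ ((hEm u).1 h2).2.1
    · exact absurd ⟨u, h⟩ ((hEm u').1 h3).2.1
    · exact hι h
  refine ⟨σ₁, ?_, ?_, ?_⟩
  · simp only [swapMaps, Finset.mem_filter, Finset.mem_univ, true_and]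
    refine ⟨h1, ?_⟩
    -- If ι u were free, u would belong to E and would already have been restored.
    have h3 : ∀ u, σ₁ u ∉ Set.range ι → ∃ u', σ u' = ι u := by
      intro u hu
      have hue : u ∉ E := fun hue => hu (by simp [hσ₁, hue])
      have h4 : σ₁ u = σ u := by simp [hσ₁, hue]
      rw [h4] at hu
      by_contra h5
      exact hue ((hEm u).2 ⟨fun h => hu ⟨u, h.symm⟩, hu, h5⟩)
    choose! f hf using h3
    refine Finset.card_le_card_of_injOn f (fun u hu => ?_) (fun u hu u' hu' h => ?_)
    · simp only [Finset.coe_filter, Finset.mem_univ, true_and, Set.mem_ofPred_eq] at hu ⊢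
      have h4 := hf u hu
      have h5 : f u ∉ E := fun h5 => ((hEm _).1 h5).2.1 ⟨u, h4.symm⟩
      have h6 : σ₁ (f u) = ι u := by simp [hσ₁, h5, h4]
      refine ⟨fun h7 => ?_, h6 ▸ ⟨u, rfl⟩⟩
      rw [h6] at h7
      have h8 := hι h7
      rw [← h8] at h6
      exact hu (h6 ▸ ⟨u, rfl⟩)
    · simp only [Finset.coe_filter, Finset.mem_univ, true_and, Set.mem_ofPred_eq] at hu hu'
      have h4 := hf u hu
      rw [h, hf u' hu'] at h4
      exact (hι h4).symm
  -- The gain of σ₁ over ι equals the gain of the optimal σ over the competitor σ₂, since the two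
  -- cuts are complementary.
  · have h3 := hopt σ₂ h2
    have h4 : ∑ u, (S u (σ₁ u) - S u (ι u)) = ∑ u, S u (σ u) - ∑ u, S u (σ₂ u) := by
      rw [← Finset.sum_sub_distrib]
      refine Finset.sum_congr rfl fun u _ => ?_
      by_cases hu : u ∈ E <;> simp [hσ₁, hσ₂, hu]
    linarith
  · intro u hu
    by_cases hue : u ∈ E
    · right
      have h3 := (hEm u).1 hue
      refine ⟨h3.2.1, ?_⟩
      have h4 : Function.Injective (Function.update σ u (ι u)) := by
        intro x y hxy
        by_cases hx : x = u <;> by_cases hy : y = u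
        · rw [hx, hy]
        · subst hx
          rw [Function.update_self, Function.update_of_ne hy] at hxy
          exact absurd ⟨y, hxy.symm⟩ h3.2.2
        · subst hy
          rw [Function.update_self, Function.update_of_ne hx] at hxy
          exact absurd ⟨x, hxy⟩ h3.2.2
        · rw [Function.update_of_ne hx, Function.update_of_ne hy] at hxy
          exact hσ hxy
      have h5 := hopt _ h4
      rw [← Finset.add_sum_erase _ _ (Finset.mem_univ u),
        ← Finset.add_sum_erase _ (fun u => S u (σ u)) (Finset.mem_univ u),
        Function.update_self, Finset.sum_congr rfl fun x hx => by
          rw [Function.update_of_ne (Finset.ne_of_mem_erase hx)]] at h5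
      linarith
    · left
      simpa [hσ₁, hue] using hu

open Classical in
-- Weighted counting: weight √κ for a mapped value and 1/√κ for an unmapped one. A map in `swapMaps`
-- has at least as many changes of the first kind, so its weight is at least 1, while the total
-- weight factorizes over A with factor at most (|A| + 1)√κ. Counting without weights would give κ
-- in place of √κ per change.
theorem card_swapMaps_filter_le (hι : Function.Injective ι) {κ : ℝ} (hκ1 : 1 ≤ κ)
    (hκ : (Fintype.card V : ℝ) - Fintype.card U ≤ κ) (A : Finset U) :
    (((swapMaps ι).filter fun σ => (Finset.univ.filter fun u => σ u ≠ ι u) = A).card : ℝ) ≤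
      (2 * A.card * √κ) ^ A.card := by
  obtain ⟨r, hr⟩ : ∃ r, r = √κ := ⟨_, rfl⟩
  have hr1 : 1 ≤ r := hr ▸ Real.one_le_sqrt.2 hκ1
  have hr0 : 0 < r := by linarith
  have hrr : r * r = κ := hr ▸ Real.mul_self_sqrt (by linarith)
  set W := Finset.univ.filter fun v => v ∉ Set.range ι with hW
  have hWc : (W.card : ℝ) ≤ κ := by
    have h1 : W = (Finset.univ.image ι)ᶜ := by
      ext v
      simp [hW]
    have h2 := Finset.card_le_univ (Finset.univ.image ι)
    rw [h1, Finset.card_compl, Nat.cast_sub h2, Finset.card_image_of_injective _ hι]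
    exact hκ
  obtain ⟨w, hw⟩ : ∃ w : V → ℝ, w = fun v => if v ∈ Set.range ι then r else r⁻¹ := ⟨_, rfl⟩
  have hwι : ∀ u, w (ι u) = r := fun u => by
    rw [hw]
    exact if_pos ⟨u, rfl⟩
  have hwW : ∀ v ∈ W, w v = r⁻¹ := fun v hv => by
    rw [hw]
    exact if_neg (Finset.mem_filter.1 hv).2
  have hw0 : ∀ v, 0 ≤ w v := fun v => by
    simp only [hw]
    split_ifs <;> positivity
  obtain ⟨T, hT⟩ : ∃ T : U → Finset V, T = fun u => if u ∈ A then A.image ι ∪ W else {ι u} :=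
    ⟨_, rfl⟩
  obtain ⟨F, hF⟩ : ∃ F : U → V → ℝ, F = fun u v => if u ∈ A then w v else 1 := ⟨_, rfl⟩
  have h1 : ∏ u, ∑ v ∈ T u, F u v = ∑ σ ∈ Fintype.piFinset T, ∏ u, F u (σ u) :=
    Finset.prod_univ_sum T F
  have h2 : ∏ u, ∑ v ∈ T u, F u v ≤ (2 * A.card * r) ^ A.card := by
    have h3 : ∀ u, ∑ v ∈ T u, F u v = if u ∈ A then ∑ v ∈ A.image ι ∪ W, w v else 1 := by
      intro u
      by_cases hu : u ∈ A <;> simp [hT, hF, hu]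
    simp_rw [h3]
    rw [Finset.prod_ite_mem, Finset.univ_inter, Finset.prod_const]
    rcases A.eq_empty_or_nonempty with rfl | hA
    · simp
    refine pow_le_pow_left₀ (Finset.sum_nonneg fun v _ => hw0 v) ?_ _
    have hA1 : (1 : ℝ) ≤ A.card := by exact_mod_cast hA.card_pos
    calc ∑ v ∈ A.image ι ∪ W, w v ≤ ∑ v ∈ A.image ι, w v + ∑ v ∈ W, w v := by
          rw [← Finset.sum_union_inter]
          exact le_add_of_nonneg_right (Finset.sum_nonneg fun v _ => hw0 v)
      _ = A.card * r + W.card * r⁻¹ := by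
          rw [Finset.sum_image fun x _ y _ h => hι h, Finset.sum_congr rfl fun u _ => hwι u,
            Finset.sum_congr rfl hwW, Finset.sum_const, Finset.sum_const, nsmul_eq_mul,
            nsmul_eq_mul]
      _ ≤ A.card * r + κ * r⁻¹ := by gcongr
      _ = (A.card + 1) * r := by rw [← hrr]; field_simp
      _ ≤ _ := by nlinarith
  rw [← hr]
  refine le_trans ?_ h2
  rw [h1, Finset.card_eq_sum_ones]
  push_cast
  have hnn : ∀ σ : U → V, 0 ≤ ∏ u, F u (σ u) := fun σ => Finset.prod_nonneg fun u _ => by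
    simp only [hF]
    split_ifs
    exacts [hw0 _, zero_le_one]
  refine (Finset.sum_le_sum (g := fun σ => ∏ u, F u (σ u)) fun σ hσ => ?_).trans
    (Finset.sum_le_sum_of_subset_of_nonneg (fun σ hσ => ?_) fun σ _ _ => hnn σ)
  · simp only [swapMaps, Finset.mem_filter, Finset.mem_univ, true_and] at hσ
    obtain ⟨⟨-, h3⟩, h4⟩ := hσ
    have h5 : ∏ u, F u (σ u) = ∏ u ∈ A, w (σ u) := by
      simp only [hF]
      rw [Finset.prod_ite_mem, Finset.univ_inter]
    rw [h5, hw, Finset.prod_ite, Finset.prod_const, Finset.prod_const, inv_pow]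
    have e1 : A.filter (fun u => σ u ∈ Set.range ι) =
        Finset.univ.filter fun u => σ u ≠ ι u ∧ σ u ∈ Set.range ι := by
      rw [← h4, Finset.filter_filter]
    have e2 : A.filter (fun u => σ u ∉ Set.range ι) =
        Finset.univ.filter fun u => σ u ∉ Set.range ι := by
      rw [← h4, Finset.filter_filter]
      refine Finset.filter_congr fun u _ => ⟨fun h => h.2, fun h => ⟨fun h' => h ⟨u, h'.symm⟩, h⟩⟩
    rw [e1, e2, ← div_eq_mul_inv, one_le_div (by positivity)]
    exact pow_le_pow_right₀ hr1 h3
  · simp only [swapMaps, Finset.mem_filter, Finset.mem_univ, true_and] at hσ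
    obtain ⟨⟨h3, -⟩, h4⟩ := hσ
    have hA : ∀ u, u ∈ A ↔ σ u ≠ ι u := fun u => by simp [← h4]
    rw [Fintype.mem_piFinset]
    intro u
    by_cases hu : u ∈ A
    · simp only [hT, hu, if_true, Finset.mem_union, Finset.mem_image]
      by_cases h5 : σ u ∈ Set.range ι
      · obtain ⟨u', h6⟩ := h5
        refine Or.inl ⟨u', ?_, h6⟩
        by_contra h7
        rw [hA, not_not, h6] at h7
        have h8 := h3 h7
        rw [h8] at h6
        exact (hA u).1 hu h6.symm
      · right
        simp only [hW, Finset.mem_filter, Finset.mem_univ, true_and]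
        exact h5
    · simp only [hT, hu, if_false, Finset.mem_singleton]
      simpa [hA] using hu

open Classical in
-- Grouping by the number d of changes and using dᵈ/d! ≤ eᵈ absorbs the choice of A and the count of
-- maps into xᵈ. The series Σ d·xᵈ = x/(1−x)² is at most 4x for x ≤ 1/2.
theorem sum_swapMaps_le (hι : Function.Injective ι) {κ : ℝ} (hκ1 : 1 ≤ κ)
    (hκ : (Fintype.card V : ℝ) - Fintype.card U ≤ κ) {q : ℝ} (hq : 0 ≤ q)
    (hx : 2 * Real.exp 1 * Fintype.card U * √κ * q ≤ 1 / 2) :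
    ∑ σ ∈ swapMaps ι, ((Finset.univ.filter fun u => σ u ≠ ι u).card : ℝ) *
        q ^ (Finset.univ.filter fun u => σ u ≠ ι u).card ≤
      4 * (2 * Real.exp 1 * Fintype.card U * √κ * q) := by
  set x := 2 * Real.exp 1 * Fintype.card U * √κ * q with hxdef
  set n := Fintype.card U with hn
  have hx0 : 0 ≤ x := by positivity
  have hs := Real.sqrt_nonneg κ
  have hterm : ∀ d : ℕ, (n.choose d : ℝ) * (d * q ^ d * (2 * d * √κ) ^ d) ≤ d * x ^ d := by
    intro d
    have h1 : (n.choose d : ℝ) ≤ n ^ d / d.factorial := Nat.choose_le_pow_div d n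
    have h2 : (d : ℝ) ^ d / d.factorial ≤ Real.exp d :=
      Real.pow_div_factorial_le_exp (d : ℝ) (Nat.cast_nonneg d) d
    calc (n.choose d : ℝ) * (d * q ^ d * (2 * d * √κ) ^ d)
        ≤ n ^ d / d.factorial * (d * q ^ d * (2 * d * √κ) ^ d) := by gcongr
      _ = d * (2 * n * √κ * q) ^ d * ((d : ℝ) ^ d / d.factorial) := by
          simp only [mul_pow]
          ring
      _ ≤ d * (2 * n * √κ * q) ^ d * Real.exp d := by gcongr
      _ = d * x ^ d := by
          rw [hxdef, show Real.exp (d : ℝ) = Real.exp 1 ^ d by rw [← Real.exp_nat_mul, mul_one]]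
          simp only [mul_pow]
          ring
  calc ∑ σ ∈ swapMaps ι, ((Finset.univ.filter fun u => σ u ≠ ι u).card : ℝ) *
        q ^ (Finset.univ.filter fun u => σ u ≠ ι u).card
      = ∑ A : Finset U, ∑ σ ∈ (swapMaps ι).filter fun σ =>
          (Finset.univ.filter fun u => σ u ≠ ι u) = A,
          ((Finset.univ.filter fun u => σ u ≠ ι u).card : ℝ) *
        q ^ (Finset.univ.filter fun u => σ u ≠ ι u).card :=
        (Finset.sum_fiberwise _ _ _).symm
    _ = ∑ A : Finset U, (A.card * q ^ A.card : ℝ) * ((swapMaps ι).filter fun σ =>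
          (Finset.univ.filter fun u => σ u ≠ ι u) = A).card := by
        refine Finset.sum_congr rfl fun A _ => ?_
        rw [Finset.sum_congr rfl fun σ hσ => by rw [(Finset.mem_filter.1 hσ).2], Finset.sum_const,
          nsmul_eq_mul, mul_comm]
    _ ≤ ∑ A : Finset U, (A.card * q ^ A.card : ℝ) * (2 * A.card * √κ) ^ A.card := by
        refine Finset.sum_le_sum fun A _ => mul_le_mul_of_nonneg_left
          (card_swapMaps_filter_le hι hκ1 hκ A) (by positivity)
    _ = ∑ d ∈ Finset.range (n + 1), (n.choose d : ℝ) * (d * q ^ d * (2 * d * √κ) ^ d) := by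
        have := Finset.sum_powerset_apply_card
          (fun d : ℕ => (d * q ^ d * (2 * d * √κ) ^ d : ℝ)) (x := (Finset.univ : Finset U))
        simpa only [Finset.powerset_univ, Finset.card_univ, nsmul_eq_mul] using this
    _ ≤ ∑ d ∈ Finset.range (n + 1), (d : ℝ) * x ^ d := Finset.sum_le_sum fun d _ => hterm d
    _ ≤ ∑' d : ℕ, (d : ℝ) * x ^ d := by
        have hs : Summable fun d : ℕ => (d : ℝ) * x ^ d :=
          (hasSum_coe_mul_geometric_of_norm_lt_one (by
            rw [Real.norm_of_nonneg hx0]; linarith)).summable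
        exact hs.sum_le_tsum _ fun d _ => by positivity
    _ = x / (1 - x) ^ 2 := tsum_coe_mul_geometric_of_norm_lt_one (by
          rw [Real.norm_of_nonneg hx0]; linarith)
    _ ≤ 4 * x := by
        rw [div_le_iff₀ (by nlinarith)]
        nlinarith [mul_nonneg hx0 (by nlinarith : 0 ≤ 4 * (1 - x) ^ 2 - 1)]

end Combinatorics

namespace ScoreBounds

variable {U V Ω : Type*} [Fintype U] [Fintype V] [MeasurableSpace Ω] {P : Measure Ω} {ι : U → V}
  {G : Ω → U → V → ℝ} {z : ℝ}

open Classical in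
-- The half-gain exponential is at least 1 whenever σ does no worse than ι, so this sum dominates
-- the number of changes of any such map.
theorem meanLE_swapMaps (h : ScoreBounds P ι G z) (hι : Function.Injective ι) {κ : ℝ}
    (hκ1 : 1 ≤ κ) (hκ : (Fintype.card V : ℝ) - Fintype.card U ≤ κ)
    (hx : 2 * Real.exp 1 * Fintype.card U * √κ * Real.exp (-(z / 2)) ≤ 1 / 2) :
    ∃ c ≤ 4 * (2 * Real.exp 1 * Fintype.card U * √κ * Real.exp (-(z / 2))),
      MeanLE P (fun ω => ∑ σ ∈ swapMaps ι, ((Finset.univ.filter fun u => σ u ≠ ι u).card : ℝ) *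
        Real.exp (1 / 2 * ∑ u, (G ω u (σ u) - G ω u (ι u)))) c := by
  refine ⟨_, sum_swapMaps_le hι hκ1 hκ (Real.exp_pos _).le hx, MeanLE.sum fun σ hσ => ?_⟩
  refine MeanLE.const_mul ?_ (Nat.cast_nonneg _)
  have hσi : Function.Injective σ := (Finset.mem_filter.1 hσ).2.1
  have hm : AEMeasurable (fun ω => 1 / 2 * ∑ u, (G ω u (σ u) - G ω u (ι u))) P :=
    (Finset.aemeasurable_fun_sum _ fun u _ =>
      (h.aemeasurable u (σ u)).sub (h.aemeasurable u (ι u))).const_mul _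
  have h1 := MeanLE.exp hm (h.swap_le σ hσi)
  rwa [← Real.exp_nat_mul, show ∀ k : ℝ, k * -(z / 2) = -(z / 2 * k) by intro k; ring]

open Classical in
-- Combines the two pieces of `exists_swapMaps`. The row part R is left open so that either the
-- two-exponential bound or a direct union bound can be inserted.
theorem integral_mismatch_maxLikelihood_le_of_row (h : ScoreBounds P ι G z)
    (hι : Function.Injective ι) {S : Ω → Matrix U V ℝ} {r τ : ℝ}
    (hS : ∀ ω u v, S ω u v = G ω u v + r) {m : Ω → Matrix U V ℝ}
    (hm : ∀ᵐ ω ∂P, Algorithm.maxLikelihood.IsOutput (S ω) τ (m ω)) {κ : ℝ}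
    (hκ1 : 1 ≤ κ) (hκ : (Fintype.card V : ℝ) - Fintype.card U ≤ κ)
    (hx : 2 * Real.exp 1 * Fintype.card U * √κ * Real.exp (-(z / 2)) ≤ 1 / 2)
    {R : Ω → U → ℝ} {c : ℝ} (hR : MeanLE P (fun ω => ∑ u, R ω u) c) (hR0 : ∀ ω u, 0 ≤ R ω u)
    (hR1 : ∀ ω u v, v ∉ Set.range ι → G ω u (ι u) ≤ G ω u v → 1 ≤ R ω u) :
    ∫ ω, (Algorithm.mismatch ι (m ω) : ℝ) ∂P ≤
      3 * (c + 4 * (2 * Real.exp 1 * Fintype.card U * √κ * Real.exp (-(z / 2)))) := by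
  obtain ⟨d, hd, hK⟩ := h.meanLE_swapMaps hι hκ1 hκ hx
  have h2 := (hR.add hK).const_mul zero_le_three
  refine (h2.integral_le (fun ω => Nat.cast_nonneg _) ?_).trans (by gcongr)
  filter_upwards [hm] with ω hω
  obtain ⟨σ, hσm, hσ, hopt⟩ := hω.exists_map (Or.inr rfl)
  have h3 : (Algorithm.mismatch ι (m ω) : ℝ) ≤
      3 * ((Finset.univ.filter fun u => σ u ≠ ι u).card : ℝ) := by
    rw [hσm]
    exact_mod_cast Algorithm.mismatch_mapMatrix_le ι σ
  refine h3.trans (mul_le_mul_of_nonneg_left ?_ zero_le_three)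
  obtain ⟨σ', hσ', h4, h5⟩ := exists_swapMaps (S := G ω) hι (hσ rfl) fun σ' h' => by
    have h5 := hopt σ' fun _ => h'
    simpa only [hS, Finset.sum_add_distrib, add_le_add_iff_right] using h5
  have h6 : ((Finset.univ.filter fun u => σ u ≠ ι u).card : ℝ) ≤
      ∑ u, R ω u + (Finset.univ.filter fun u => σ' u ≠ ι u).card := by
    rw [Finset.card_eq_sum_ones, Finset.card_eq_sum_ones, Finset.sum_filter, Finset.sum_filter]
    push_cast
    rw [← Finset.sum_add_distrib]
    refine Finset.sum_le_sum fun u _ => ?_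
    have h8 := hR0 ω u
    by_cases h7 : σ u = ι u
    · simp only [h7, ne_eq, not_true_eq_false, if_false]
      split_ifs <;> linarith
    · rw [if_pos h7]
      rcases h5 u h7 with h9 | h9
      · rw [if_pos h9]
        linarith
      · have := hR1 ω u _ h9.1 h9.2
        split_ifs <;> linarith
  refine h6.trans (add_le_add_right ?_ _)
  refine le_trans ?_ (Finset.single_le_sum (f := fun σ : U → V =>
    ((Finset.univ.filter fun u => σ u ≠ ι u).card : ℝ) *
      Real.exp (1 / 2 * ∑ u, (G ω u (σ u) - G ω u (ι u)))) (fun _ _ => by positivity) hσ')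
  exact le_mul_of_one_le_right (Nat.cast_nonneg _) (Real.one_le_exp (by positivity))

open Classical in
theorem integral_mismatch_maxLikelihood_le (h : ScoreBounds P ι G z)
    (hι : Function.Injective ι) {S : Ω → Matrix U V ℝ} {r τ : ℝ}
    (hS : ∀ ω u v, S ω u v = G ω u v + r) {m : Ω → Matrix U V ℝ}
    (hm : ∀ᵐ ω ∂P, Algorithm.maxLikelihood.IsOutput (S ω) τ (m ω)) {κ : ℝ}
    (hκ1 : 1 ≤ κ) (hκ : (Fintype.card V : ℝ) - Fintype.card U ≤ κ)
    (hx : 2 * Real.exp 1 * Fintype.card U * √κ * Real.exp (-(z / 2)) ≤ 1 / 2) {t : ℝ}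
    (ht0 : 1 / 2 ≤ t) (ht1 : t ≤ 1) :
    ∫ ω, (Algorithm.mismatch ι (m ω) : ℝ) ∂P ≤
      3 * (Fintype.card U * Real.exp (-(z * (1 - t) ^ 2)) +
        Fintype.card U * Fintype.card V * Real.exp (-(z * (1 - t) ^ 2) + -(z * t ^ 2)) +
        4 * (2 * Real.exp 1 * Fintype.card U * √κ * Real.exp (-(z / 2)))) := by
  refine (h.integral_mismatch_maxLikelihood_le_of_row hι hS hm hκ1 hκ hx (h.meanLE_sum_row ht0 ht1)
    (fun ω u => Finset.sum_nonneg fun v _ => ?_) (fun ω u v hv huv => ?_)).trans ?_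
  · split_ifs <;> exact (Real.exp_pos _).le
  · exact ite_ne_le_of_le ht0 ht1 (fun h => hv ⟨u, h.symm⟩) huv
  · have := sum_ite_eq_le ι (a := Real.exp (-(z * (1 - t) ^ 2)))
      (Real.exp_pos (-(z * (1 - t) ^ 2) + -(z * t ^ 2))).le
    gcongr

open Classical in
-- The row part is a union bound over unmapped values only, with t = 1/2. It scales with N − n and
-- therefore vanishes when N = n.
theorem integral_mismatch_maxLikelihood_le' (h : ScoreBounds P ι G z)
    (hι : Function.Injective ι) {S : Ω → Matrix U V ℝ} {r τ : ℝ}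
    (hS : ∀ ω u v, S ω u v = G ω u v + r) {m : Ω → Matrix U V ℝ}
    (hm : ∀ᵐ ω ∂P, Algorithm.maxLikelihood.IsOutput (S ω) τ (m ω)) {κ : ℝ}
    (hκ1 : 1 ≤ κ) (hκ : (Fintype.card V : ℝ) - Fintype.card U ≤ κ)
    (hx : 2 * Real.exp 1 * Fintype.card U * √κ * Real.exp (-(z / 2)) ≤ 1 / 2) :
    ∫ ω, (Algorithm.mismatch ι (m ω) : ℝ) ∂P ≤
      3 * (Fintype.card U * ((Fintype.card V : ℝ) - Fintype.card U) * Real.exp (-(z / 2)) +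
        4 * (2 * Real.exp 1 * Fintype.card U * √κ * Real.exp (-(z / 2)))) := by
  set W := Finset.univ.filter fun v => v ∉ Set.range ι with hW
  have hWc : (W.card : ℝ) = (Fintype.card V : ℝ) - Fintype.card U := by
    have h1 : W = (Finset.univ.image ι)ᶜ := by
      ext v
      simp [hW]
    have h2 := Finset.card_le_univ (Finset.univ.image ι)
    rw [h1, Finset.card_compl, Nat.cast_sub h2, Finset.card_image_of_injective _ hι,
      Finset.card_univ]
  have h1 : MeanLE P (fun ω => ∑ u, ∑ v ∈ W, Real.exp (1 / 2 * G ω u v -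
      (1 - 1 / 2) * G ω u (ι u))) (∑ _u : U, ∑ _v ∈ W, Real.exp (-(z / 2))) := by
    refine MeanLE.sum fun u _ => MeanLE.sum fun v hv => ?_
    have hvu : v ≠ ι u := fun h => (Finset.mem_filter.1 hv).2 ⟨u, h.symm⟩
    have h2 := h.row_le u v hvu (1 / 2) le_rfl (by norm_num)
    rw [show 2 * z * (1 / 2 * (1 - 1 / 2)) = z / 2 by ring] at h2
    exact MeanLE.exp (((h.aemeasurable u v).const_mul _).sub
      ((h.aemeasurable u (ι u)).const_mul _)) h2
  refine (h.integral_mismatch_maxLikelihood_le_of_row hι hS hm hκ1 hκ hx h1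
    (fun ω u => Finset.sum_nonneg fun v _ => (Real.exp_pos _).le) (fun ω u v hv huv => ?_)).trans ?_
  · refine le_trans (Real.one_le_exp ?_) (Finset.single_le_sum
      (f := fun v => Real.exp (1 / 2 * G ω u v - (1 - 1 / 2) * G ω u (ι u)))
      (fun v _ => (Real.exp_pos _).le) (Finset.mem_filter.2 ⟨Finset.mem_univ v, hv⟩))
    linarith
  · simp only [Finset.sum_const, nsmul_eq_mul, hWc, Finset.card_univ, mul_assoc]
    exact le_rfl

end ScoreBounds

/-! ### Choice of the threshold -/

/-- The proportion balancing missed pairs (weight `L`) against false pairs (weight `B`). -/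
noncomputable def balancedSplit (L B z : ℝ) : ℝ := (√z + √B - √L) / (2 * √z)

/-- With δ = √z − √L − √B, the split gives √z(1−t) = √L + δ/2 and √z·t = √B + δ/2. Squaring yields a
margin of at least √L·δ on both sides, as L ≤ B. -/
theorem balancedSplit_spec {L B z : ℝ} (hL : 0 ≤ L) (hLB : L ≤ B) (hz : 0 < z)
    (h : √L + √B ≤ √z) :
    1 / 2 ≤ balancedSplit L B z ∧ balancedSplit L B z ≤ 1 ∧
      L + √L * (√z - √L - √B) ≤ z * (1 - balancedSplit L B z) ^ 2 ∧
      B + √L * (√z - √L - √B) ≤ z * balancedSplit L B z ^ 2 := by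
  have hz' := Real.sqrt_pos.2 hz
  have h1 := Real.sqrt_le_sqrt hLB
  have h2 := Real.sqrt_nonneg L
  have ez := Real.mul_self_sqrt hz.le
  have eL := Real.mul_self_sqrt hL
  have eB := Real.mul_self_sqrt (hL.trans hLB)
  have e1 : z * (1 - balancedSplit L B z) ^ 2 = ((√z - √B + √L) / 2) ^ 2 := by
    rw [balancedSplit]
    nth_rw 1 [← ez]
    field_simp
    ring
  have e2 : z * balancedSplit L B z ^ 2 = ((√z + √B - √L) / 2) ^ 2 := by
    rw [balancedSplit]
    nth_rw 1 [← ez]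
    field_simp
  refine ⟨?_, ?_, ?_, ?_⟩
  · rw [balancedSplit, div_le_div_iff₀ two_pos (by positivity)]
    linarith
  · rw [balancedSplit, div_le_one (by positivity)]
    linarith
  · rw [e1]
    nlinarith [sq_nonneg (√z - √L - √B)]
  · rw [e2]
    nlinarith [sq_nonneg (√z - √L - √B),
      mul_nonneg (sub_nonneg.2 h1) (by linarith : 0 ≤ √z - √L - √B)]

/-- The proportion of the threshold in the range between the typical false and true scores. -/
noncomputable def thresholdSplit (n N : ℕ) (z : ℝ) : ℝ :=
  if √(Real.log n) + √(Real.log n + Real.log N) ≤ √z then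
    balancedSplit (Real.log n) (Real.log n + Real.log N) z
  else √((z + Real.log N) / (2 * z))

/-- For signals below the exact-alignment range, t is chosen so that zt² lies halfway between l and
z. The bound on 1 − t comes from 1 − t ≥ (1 − t²)/2. -/
theorem sqrt_split_spec {l z : ℝ} (hl : 0 ≤ l) (hz : 0 < z) (h : l ≤ z) :
    1 / 2 ≤ √((z + l) / (2 * z)) ∧ √((z + l) / (2 * z)) ≤ 1 ∧
      (z - l) ^ 2 / (16 * z) ≤ z * (1 - √((z + l) / (2 * z))) ^ 2 ∧
      l + (z - l) / 2 = z * √((z + l) / (2 * z)) ^ 2 := by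
  have e := Real.sq_sqrt (show 0 ≤ (z + l) / (2 * z) by positivity)
  set t := √((z + l) / (2 * z)) with ht
  have ht0 : 0 ≤ t := Real.sqrt_nonneg _
  have h1 : t ≤ 1 := by
    rw [ht, Real.sqrt_le_left zero_le_one, one_pow, div_le_one (by positivity)]
    linarith
  have h2 : (1 / 2 : ℝ) ≤ t ^ 2 := by
    rw [e, div_le_div_iff₀ two_pos (by positivity)]
    linarith
  refine ⟨by nlinarith, h1, ?_, ?_⟩
  · have h3 : (z - l) / (4 * z) ≤ 1 - t := by
      have : (z - l) / (4 * z) = (1 - t ^ 2) / 2 := by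
        rw [e]
        field_simp
        ring
      rw [this]
      nlinarith
    calc (z - l) ^ 2 / (16 * z) = z * ((z - l) / (4 * z)) ^ 2 := by
          field_simp
          ring
      _ ≤ _ := by
          have : 0 ≤ (z - l) / (4 * z) := div_nonneg (by linarith) (by positivity)
          gcongr
  · rw [e]
    field_simp
    ring

/-! ### The bounds on the expected number of misaligned users -/

/-- Bounds on the expected number `E` of misaligned users, in terms of `n`, `N` and the signal
strength `z`. -/
structure MismatchBounds (alg : Algorithm) (n N : ℕ) (z E : ℝ) : Prop where
  nonneg : 0 ≤ E
  threshold : alg = .thresholdTesting → 0 ≤ thresholdSplit n N z → thresholdSplit n N z ≤ 1 →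
    E ≤ 2 * (n * Real.exp (-(z * (1 - thresholdSplit n N z) ^ 2)) +
      n * N * Real.exp (-(z * thresholdSplit n N z ^ 2)))
  row : alg = .maxRow ∨ alg = .maxLikelihood → ∀ t : ℝ, 1 / 2 ≤ t → t ≤ 1 →
    E ≤ 3 * (n * Real.exp (-(z * (1 - t) ^ 2)) + n * N * Real.exp (-(z * t ^ 2)))
  maxRow : alg = .maxRow → ∀ t : ℝ, 1 / 2 ≤ t → t ≤ 1 →
    E ≤ 3 * (n * Real.exp (-(z * (1 - t) ^ 2)) +
      n * N * Real.exp (-(z * (1 - t) ^ 2) + -(z * t ^ 2)))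
  maxLikelihood : alg = .maxLikelihood → ∀ κ : ℝ, 1 ≤ κ → (N : ℝ) - n ≤ κ →
    2 * Real.exp 1 * n * √κ * Real.exp (-(z / 2)) ≤ 1 / 2 → ∀ t : ℝ, 1 / 2 ≤ t → t ≤ 1 →
    E ≤ 3 * (n * Real.exp (-(z * (1 - t) ^ 2)) +
        n * N * Real.exp (-(z * (1 - t) ^ 2) + -(z * t ^ 2)) +
        4 * (2 * Real.exp 1 * n * √κ * Real.exp (-(z / 2))))
  maxLikelihood' : alg = .maxLikelihood → ∀ κ : ℝ, 1 ≤ κ → (N : ℝ) - n ≤ κ →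
    2 * Real.exp 1 * n * √κ * Real.exp (-(z / 2)) ≤ 1 / 2 →
    E ≤ 3 * (n * ((N : ℝ) - n) * Real.exp (-(z / 2)) +
        4 * (2 * Real.exp 1 * n * √κ * Real.exp (-(z / 2))))

theorem ScoreBounds.mismatchBounds {X : AlignmentSetting.{u, v}} {ι : X.U → X.V}
    {G : X.Ω → X.U → X.V → ℝ} {z : ℝ} (h : ScoreBounds X.P ι G z) (hι : ∀ u, ι u ∈ X.M u)
    {S : X.Ω → Matrix X.U X.V ℝ} {r τ : ℝ} (hS : ∀ ω u v, S ω u v = G ω u v + r)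
    {alg : Algorithm} {m : X.Ω → Matrix X.U X.V ℝ} (hm : alg.IsEstimator X S τ m)
    (hτ : alg = .thresholdTesting → τ = z * (2 * thresholdSplit X.sizeU X.sizeV z - 1) + r) :
    MismatchBounds alg X.sizeU X.sizeV z (X.expectedMisaligned m) := by
  have hinj : Function.Injective ι := fun u u' h => X.M.inj (hι u) (h ▸ hι u')
  have hE : X.expectedMisaligned m = ∫ ω, (Algorithm.mismatch ι (m ω) : ℝ) ∂X.P := by
    simp only [AlignmentSetting.expectedMisaligned, AlignmentSetting.misaligned_eq_mismatch hι]
  rw [hE]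
  constructor
  · exact integral_nonneg fun ω => Nat.cast_nonneg _
  · rintro rfl h0 h1
    exact h.integral_mismatch_threshold_le hS hm.2 h0 h1 (hτ rfl)
  · intro halg t h0 h1
    exact h.integral_mismatch_le hinj hS halg hm.2 h0 h1
  · rintro rfl t h0 h1
    exact h.integral_mismatch_maxRow_le hS hm.2 h0 h1
  · rintro rfl κ h1 h2 h3 t h4 h5
    exact h.integral_mismatch_maxLikelihood_le hinj hS hm.2 h1 h2 h3 h4 h5
  · rintro rfl κ h1 h2 h3
    exact h.integral_mismatch_maxLikelihood_le' hinj hS hm.2 h1 h2 h3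

namespace MismatchBounds

variable {alg : Algorithm} {n N : ℕ} {z E : ℝ}

theorem exp_bound_sum {L l z t w : ℝ}
    (h1 : L + w ≤ z * (1 - t) ^ 2) (h2 : l ≤ z * t ^ 2) :
    Real.exp L * Real.exp (-(z * (1 - t) ^ 2)) +
        Real.exp L * Real.exp l * Real.exp (-(z * (1 - t) ^ 2) + -(z * t ^ 2)) ≤
      2 * Real.exp (-w) := by
  have e1 : Real.exp L * Real.exp (-(z * (1 - t) ^ 2)) ≤ Real.exp (-w) := by
    rw [← Real.exp_add]
    exact Real.exp_le_exp.2 (by linarith)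
  have e2 : Real.exp L * Real.exp l * Real.exp (-(z * (1 - t) ^ 2) + -(z * t ^ 2)) ≤
      Real.exp (-w) := by
    rw [← Real.exp_add, ← Real.exp_add]
    exact Real.exp_le_exp.2 (by linarith)
  linarith

theorem exact_threshold (h : MismatchBounds .thresholdTesting n N z E) (hn : 1 ≤ n) (hN : 1 ≤ N)
    (hz : 0 < z)
    (hs : √(Real.log n) + √(Real.log n + Real.log N) ≤ √z) :
    E ≤ 4 * Real.exp (-(√(Real.log n) *
      (√z - √(Real.log n) - √(Real.log n + Real.log N)))) := by
  have hn0 : (0 : ℝ) < n := by exact_mod_cast hn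
  have hN0 : (0 : ℝ) < N := by exact_mod_cast hN
  have hL : 0 ≤ Real.log n := Real.log_natCast_nonneg n
  have hl : 0 ≤ Real.log N := Real.log_natCast_nonneg N
  obtain ⟨h1, h2, h3, h4⟩ := balancedSplit_spec hL (le_add_of_nonneg_right hl) hz hs
  have e : thresholdSplit n N z = balancedSplit (Real.log n) (Real.log n + Real.log N) z :=
    if_pos hs
  have h5 := h.threshold rfl (by rw [e]; linarith) (by rw [e]; exact h2)
  rw [e] at h5
  set t := balancedSplit (Real.log n) (Real.log n + Real.log N) z
  set w := √(Real.log n) * (√z - √(Real.log n) - √(Real.log n + Real.log N))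
  have e1 : (n : ℝ) * Real.exp (-(z * (1 - t) ^ 2)) ≤ Real.exp (-w) := by
    nth_rw 1 [← Real.exp_log hn0]
    rw [← Real.exp_add]
    exact Real.exp_le_exp.2 (by linarith)
  have e2 : (n : ℝ) * N * Real.exp (-(z * t ^ 2)) ≤ Real.exp (-w) := by
    nth_rw 1 [← Real.exp_log hn0]
    nth_rw 1 [← Real.exp_log hN0]
    rw [← Real.exp_add, ← Real.exp_add]
    exact Real.exp_le_exp.2 (by linarith)
  linarith

theorem exact_maxRow (h : MismatchBounds .maxRow n N z E) (hn : 1 ≤ n) (hnN : n ≤ N)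
    (hz : 0 < z) (hs : √(Real.log n) + √(Real.log N) ≤ √z) :
    E ≤ 6 * Real.exp (-(√(Real.log n) * (√z - √(Real.log n) - √(Real.log N)))) := by
  have hn0 : (0 : ℝ) < n := by exact_mod_cast hn
  have hN0 : (0 : ℝ) < N := by exact_mod_cast hn.trans hnN
  have hL : 0 ≤ Real.log n := Real.log_natCast_nonneg n
  have hl : Real.log n ≤ Real.log N := Real.log_le_log hn0 (by exact_mod_cast hnN)
  obtain ⟨h1, h2, h3, h4⟩ := balancedSplit_spec hL hl hz hs
  have hw : 0 ≤ √(Real.log n) * (√z - √(Real.log n) - √(Real.log N)) :=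
    mul_nonneg (Real.sqrt_nonneg _) (by linarith)
  have h5 := h.maxRow rfl _ h1 h2
  have h6 := exp_bound_sum h3 (by linarith : Real.log N ≤ _)
  rw [Real.exp_log hn0, Real.exp_log hN0] at h6
  linarith

theorem exact_maxLikelihood (h : MismatchBounds .maxLikelihood n N z E) (hn : 1 ≤ n) (hnN : n ≤ N)
    (hz : 0 < z) (hs : √(Real.log n) + √(Real.log N) ≤ √z) {κ : ℝ} (hκ : 1 ≤ κ)
    (hκ' : (N : ℝ) - n ≤ κ)
    (hx : 2 * Real.exp 1 * n * √κ * Real.exp (-(z / 2)) ≤ 1 / 2) :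
    E ≤ 6 * Real.exp (-(√(Real.log n) * (√z - √(Real.log n) - √(Real.log N)))) +
      12 * (2 * Real.exp 1 * n * √κ * Real.exp (-(z / 2))) := by
  have hn0 : (0 : ℝ) < n := by exact_mod_cast hn
  have hN0 : (0 : ℝ) < N := by exact_mod_cast hn.trans hnN
  have hL : 0 ≤ Real.log n := Real.log_natCast_nonneg n
  have hl : Real.log n ≤ Real.log N := Real.log_le_log hn0 (by exact_mod_cast hnN)
  obtain ⟨h1, h2, h3, h4⟩ := balancedSplit_spec hL hl hz hs
  have hw : 0 ≤ √(Real.log n) * (√z - √(Real.log n) - √(Real.log N)) :=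
    mul_nonneg (Real.sqrt_nonneg _) (by linarith)
  have h5 := h.maxLikelihood rfl κ hκ hκ' hx _ h1 h2
  have h6 := exp_bound_sum h3 (by linarith : Real.log N ≤ _)
  rw [Real.exp_log hn0, Real.exp_log hN0] at h6
  linarith

theorem le_of_split (h : MismatchBounds alg n N z E) (h1 : 1 / 2 ≤ thresholdSplit n N z)
    (h2 : thresholdSplit n N z ≤ 1) (hn : 1 ≤ n) (hN : 1 ≤ N) {w : ℝ}
    (h3 : w ≤ z * (1 - thresholdSplit n N z) ^ 2)
    (h4 : Real.log N + w ≤ z * thresholdSplit n N z ^ 2) : E / n ≤ 6 * Real.exp (-w) := by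
  have hn0 : (0 : ℝ) < n := by exact_mod_cast hn
  have hN0 : (0 : ℝ) < N := by exact_mod_cast hN
  set t := thresholdSplit n N z
  have h5 : E ≤ 3 * (n * Real.exp (-(z * (1 - t) ^ 2)) + n * N * Real.exp (-(z * t ^ 2))) := by
    cases alg
    · refine (h.threshold rfl (by linarith) h2).trans ?_
      have : 0 ≤ n * Real.exp (-(z * (1 - t) ^ 2)) + n * N * Real.exp (-(z * t ^ 2)) := by
        positivity
      linarith
    · exact h.row (Or.inl rfl) t h1 h2
    · exact h.row (Or.inr rfl) t h1 h2
  rw [div_le_iff₀ hn0]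
  have e1 : Real.exp (-(z * (1 - t) ^ 2)) ≤ Real.exp (-w) := Real.exp_le_exp.2 (by linarith)
  have e2 : N * Real.exp (-(z * t ^ 2)) ≤ Real.exp (-w) := by
    nth_rw 1 [← Real.exp_log hN0]
    rw [← Real.exp_add]
    exact Real.exp_le_exp.2 (by linarith)
  nlinarith [mul_le_mul_of_nonneg_left e1 hn0.le, mul_le_mul_of_nonneg_left e2 hn0.le]

/-- The threshold must not depend on which guarantee is sought, so both branches of `thresholdSplit`
are needed. In the balanced branch the errors per user are already at most of order 1/n. -/
theorem almost_exact (h : MismatchBounds alg n N z E) (hn : 1 ≤ n) (hnN : n ≤ N) {K q : ℝ}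
    (hK : 1 ≤ K) (hL : 1 ≤ Real.log n)
    (hq : 1 ≤ q) (hz : Real.log N + q * √(Real.log n) ≤ z)
    (hNK : 2 * (2 * Real.log n + Real.log N) ≤ K * Real.log n) :
    E / n ≤ 6 * Real.exp (-(min (Real.log n) (q / (16 * K)))) := by
  have hn0 : (0 : ℝ) < n := by exact_mod_cast hn
  have hN0 : (0 : ℝ) < N := by exact_mod_cast hn.trans hnN
  have hl : Real.log n ≤ Real.log N := Real.log_le_log hn0 (by exact_mod_cast hnN)
  have hl0 : 0 ≤ Real.log N := by linarith
  set L := Real.log n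
  set l := Real.log N
  have hs1 : 1 ≤ √L := Real.one_le_sqrt.2 hL
  have hsL := Real.mul_self_sqrt (by linarith : 0 ≤ L)
  have hz0 : 0 < z := by nlinarith
  have hlz : l ≤ z := by nlinarith
  by_cases hs : √L + √(L + l) ≤ √z
  · have e : thresholdSplit n N z = balancedSplit L (L + l) z := if_pos hs
    obtain ⟨h1, h2, h3, h4⟩ := balancedSplit_spec (by linarith) (by linarith : L ≤ L + l) hz0 hs
    have hw : 0 ≤ √L * (√z - √L - √(L + l)) := mul_nonneg (by linarith) (by linarith)
    rw [← e] at h1 h2 h3 h4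
    exact h.le_of_split h1 h2 hn (hn.trans hnN) ((min_le_left _ _).trans (by linarith))
      (by linarith [min_le_left L (q / (16 * K))])
  · have e : thresholdSplit n N z = √((z + l) / (2 * z)) := if_neg hs
    obtain ⟨h1, h2, h3, h4⟩ := sqrt_split_spec hl0 hz0 hlz
    rw [← e] at h1 h2 h3 h4
    -- Being below the exact range bounds z by a multiple of log n, which makes (z − l)²/(16z) at
    -- least q/(16K).
    have hzK : z ≤ K * L := by
      have hb := Real.mul_self_sqrt (by linarith : 0 ≤ L + l)
      have hzz := Real.mul_self_sqrt hz0.le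
      have h5 : √z ≤ √L + √(L + l) := le_of_not_ge hs
      have h6 : √z * √z ≤ (√L + √(L + l)) * (√L + √(L + l)) :=
        mul_self_le_mul_self (Real.sqrt_nonneg _) h5
      nlinarith [sq_nonneg (√L - √(L + l))]
    have hqz : q * √L ≤ z - l := by linarith
    have hmin := min_le_right L (q / (16 * K))
    refine h.le_of_split h1 h2 hn (hn.trans hnN) (hmin.trans (le_trans ?_ h3)) ?_
    · rw [div_le_div_iff₀ (by positivity) (by positivity)]
      have h7 : (q * √L) ^ 2 ≤ (z - l) ^ 2 := pow_le_pow_left₀ (by positivity) hqz 2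
      have h8 : q * L ≤ (z - l) ^ 2 := by
        rw [mul_pow, sq √L, hsL] at h7
        nlinarith [mul_nonneg (mul_nonneg (by linarith : 0 ≤ q) (by linarith : 0 ≤ L))
          (by linarith : 0 ≤ q - 1)]
      have h9 : q * z ≤ q * (K * L) := by gcongr
      nlinarith
    · have h7 : q / (16 * K) ≤ q / 2 := by gcongr; linarith
      nlinarith

end MismatchBounds

/-! ### Asymptotics -/

/-- To first order, an excess w in z raises √z by w/√L and an excess c in B raises √B by c/√L, up to
constants; the factor √L restores both. The assumption w ≤ L keeps the square root in its nearly
linear range. -/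
theorem sqrt_mul_sub_ge {L β B z w C c : ℝ} (hL : 0 < L) (hβ : 1 / 2 ≤ β) (hβC : β ≤ C)
    (hB : B ≤ β * L + c) (hc : 0 ≤ c) (hw : 0 ≤ w) (hwL : w ≤ L)
    (hz : (1 + √β) ^ 2 * L + w ≤ z) :
    w / (4 * (2 + √C)) - c ≤ √L * (√z - √L - √B) := by
  have ea := Real.sq_sqrt (by linarith : 0 ≤ β)
  have el := Real.sq_sqrt hL.le
  have ha : √β ≤ √C := Real.sqrt_le_sqrt hβC
  have ha0 := Real.sqrt_nonneg β
  have hl := Real.sqrt_pos.2 hL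
  set a := √β
  set l := √L
  set k := 4 * (2 + √C) with hk
  have hk1 : 4 * (1 + a) ≤ k := by linarith
  have hk0 : 0 < k := by linarith
  have ha1 : 1 ≤ 2 * a := by nlinarith
  have h1 : √B ≤ a * l + c / l := by
    refine Real.sqrt_le_iff.2 ⟨by positivity, ?_⟩
    have e : (a * l + c / l) ^ 2 = a ^ 2 * l ^ 2 + 2 * a * c + (c / l) ^ 2 := by
      field_simp
      ring
    rw [e, ea, el]
    nlinarith [sq_nonneg (c / l)]
  have h2 : (1 + a) * l + w / (k * l) ≤ √z := by
    refine Real.le_sqrt_of_sq_le (le_trans ?_ hz)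
    have e : ((1 + a) * l + w / (k * l)) ^ 2 =
        (1 + a) ^ 2 * l ^ 2 + w * (2 * (1 + a) / k) + w * (w / (k ^ 2 * l ^ 2)) := by
      field_simp
      ring
    rw [e, el]
    have h3 : 2 * (1 + a) / k ≤ 1 / 2 := by
      rw [div_le_div_iff₀ hk0 two_pos]
      linarith
    have h4 : w / (k ^ 2 * L) ≤ 1 / 2 := by
      rw [div_le_div_iff₀ (by positivity) two_pos]
      nlinarith [mul_le_mul_of_nonneg_left (show (4 : ℝ) ≤ k ^ 2 by nlinarith) hL.le]
    nlinarith [mul_le_mul_of_nonneg_left h3 hw, mul_le_mul_of_nonneg_left h4 hw]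
  have h5 : l * (√z - l - √B) ≥ l * ((1 + a) * l + w / (k * l) - l - (a * l + c / l)) :=
    mul_le_mul_of_nonneg_left (by linarith) hl.le
  have h6 : l * ((1 + a) * l + w / (k * l) - l - (a * l + c / l)) = w / k - c := by
    field_simp
    ring
  linarith

theorem tendsto_sqrt_mul_sub {L β B z : ℕ → ℝ} {C c : ℝ} (hL : Tendsto L atTop atTop)
    (hβ : ∀ᶠ k in atTop, 1 / 2 ≤ β k) (hβC : ∀ᶠ k in atTop, β k ≤ C)
    (hB : ∀ᶠ k in atTop, B k ≤ β k * L k + c) (hc : 0 ≤ c)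
    (hz : Tendsto (fun k => z k - (1 + √(β k)) ^ 2 * L k) atTop atTop) :
    Tendsto (fun k => √(L k) * (√(z k) - √(L k) - √(B k))) atTop atTop := by
  -- The excess is truncated at log n, which also tends to infinity.
  have h1 : Tendsto (fun k => min (z k - (1 + √(β k)) ^ 2 * L k) (L k)) atTop atTop :=
    tendsto_atTop.2 fun b => by
      filter_upwards [tendsto_atTop.1 hz b, tendsto_atTop.1 hL b] with k h1 h2 using le_min h1 h2
  have h2 : Tendsto (fun k => min (z k - (1 + √(β k)) ^ 2 * L k) (L k) / (4 * (2 + √C)) - c)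
      atTop atTop := by
    refine tendsto_atTop_add_const_right _ (-c) (h1.atTop_div_const (by positivity))
  refine tendsto_atTop_mono' _ ?_ h2
  filter_upwards [hL.eventually_gt_atTop 0, hβ, hβC, hB, h1.eventually_ge_atTop 0]
    with k h3 h4 h5 h6 h7
  exact sqrt_mul_sub_ge h3 h4 h5 h6 hc h7 (min_le_right _ _)
    (by linarith [min_le_left (z k - (1 + √(β k)) ^ 2 * L k) (L k)])

theorem tendsto_zero_of_le_mul_exp_neg {E w : ℕ → ℝ} {c : ℝ} (h0 : ∀ᶠ k in atTop, 0 ≤ E k)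
    (h : ∀ᶠ k in atTop, E k ≤ c * Real.exp (-w k)) (hw : Tendsto w atTop atTop) :
    Tendsto E atTop (𝓝 0) := by
  have h1 : Tendsto (fun k => c * Real.exp (-w k)) atTop (𝓝 0) := by
    simpa using (Real.tendsto_exp_neg_atTop_nhds_zero.comp hw).const_mul c
  exact tendsto_of_tendsto_of_tendsto_of_le_of_le' tendsto_const_nhds h1 h0 h

section Sequences

variable {n N : ℕ → ℕ} {z E α : ℕ → ℝ} {alg : Algorithm}

theorem tendsto_log_cast (hn : Tendsto n atTop atTop) :
    Tendsto (fun k => Real.log (n k)) atTop atTop :=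
  Real.tendsto_log_atTop.comp (tendsto_natCast_atTop_atTop.comp hn)

theorem mul_log_eq {a b : ℝ} (hb : 0 < Real.log b) :
    Real.log a / Real.log b * Real.log b = Real.log a := by
  field_simp

theorem eventually_pos_of_sub_mul_log {c : ℕ → ℝ} (hc : ∀ᶠ k in atTop, 0 ≤ c k)
    (hz : Tendsto (fun k => z k - c k * Real.log (n k)) atTop atTop) : ∀ᶠ k in atTop, 0 < z k := by
  filter_upwards [hz.eventually_gt_atTop 0, hc] with k h1 h2
  have := mul_nonneg h2 (Real.log_natCast_nonneg (n k))
  linarith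

theorem tendsto_exact_threshold (hn : Tendsto n atTop atTop) (hnN : ∀ᶠ k in atTop, n k ≤ N k)
    (hE : ∀ᶠ k in atTop, MismatchBounds .thresholdTesting (n k) (N k) (z k) (E k))
    {β : ℕ → ℝ} {C c : ℝ} (hβ : ∀ᶠ k in atTop, 1 / 2 ≤ β k) (hβC : ∀ᶠ k in atTop, β k ≤ C)
    (hc : 0 ≤ c) (hN : ∀ᶠ k in atTop, Real.log (N k) ≤ β k * Real.log (n k) + c)
    (hz : Tendsto (fun k => z k - (1 + √(1 + β k)) ^ 2 * Real.log (n k)) atTop atTop) :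
    Tendsto E atTop (𝓝 0) := by
  have hL := tendsto_log_cast hn
  have h1 := tendsto_sqrt_mul_sub (β := fun k => 1 + β k)
    (B := fun k => Real.log (n k) + Real.log (N k)) (C := 1 + C) (c := c) hL
    (by filter_upwards [hβ] with k hk using by linarith)
    (by filter_upwards [hβC] with k hk using by linarith)
    (by filter_upwards [hN] with k hk using by linarith) hc hz
  refine tendsto_zero_of_le_mul_exp_neg (hE.mono fun k h => h.nonneg) ?_ h1 (c := 4)
  filter_upwards [hE, hnN, hn.eventually_ge_atTop 1, h1.eventually_gt_atTop 0,
    eventually_pos_of_sub_mul_log (Eventually.of_forall fun k => by positivity) hz]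
    with k h2 h3 h4 h5 h6
  refine h2.exact_threshold h4 (h4.trans h3) h6 ?_
  have := pos_of_mul_pos_right h5 (Real.sqrt_nonneg _)
  linarith

theorem tendsto_exact_maxRow (hn : Tendsto n atTop atTop) (hnN : ∀ᶠ k in atTop, n k ≤ N k)
    (hE : ∀ᶠ k in atTop, MismatchBounds .maxRow (n k) (N k) (z k) (E k))
    {β : ℕ → ℝ} {C c : ℝ} (hβ : ∀ᶠ k in atTop, 1 / 2 ≤ β k) (hβC : ∀ᶠ k in atTop, β k ≤ C)
    (hc : 0 ≤ c) (hN : ∀ᶠ k in atTop, Real.log (N k) ≤ β k * Real.log (n k) + c)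
    (hz : Tendsto (fun k => z k - (1 + √(β k)) ^ 2 * Real.log (n k)) atTop atTop) :
    Tendsto E atTop (𝓝 0) := by
  have h1 := tendsto_sqrt_mul_sub (tendsto_log_cast hn) hβ hβC hN hc hz
  refine tendsto_zero_of_le_mul_exp_neg (hE.mono fun k h => h.nonneg) ?_ h1 (c := 6)
  filter_upwards [hE, hnN, hn.eventually_ge_atTop 1, h1.eventually_gt_atTop 0,
    eventually_pos_of_sub_mul_log (Eventually.of_forall fun k => by positivity) hz]
    with k h2 h3 h4 h5 h6
  refine h2.exact_maxRow h4 h3 h6 ?_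
  have := pos_of_mul_pos_right h5 (Real.sqrt_nonneg _)
  linarith

/-- Exhibits (2 + a) log n as the borderline for the swap terms. -/
theorem swap_bound_eq {n : ℕ} (hn : 1 ≤ n) {κ a z : ℝ} (hκ : 0 < κ)
    (ha : a * Real.log n = Real.log κ) :
    2 * Real.exp 1 * n * √κ * Real.exp (-(z / 2)) =
      2 * Real.exp 1 * Real.exp (-((z - (2 + a) * Real.log n) / 2)) := by
  have hn0 : (0 : ℝ) < n := by exact_mod_cast hn
  have e1 : √κ = Real.exp (a * Real.log n / 2) := by
    rw [ha, Real.exp_half, Real.exp_log hκ]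
  rw [e1]
  nth_rw 1 [← Real.exp_log hn0]
  rw [mul_assoc, mul_assoc, ← Real.exp_add, ← Real.exp_add]
  congr 2
  ring

theorem eventually_swap_bound_le {κ : ℕ → ℝ} (hn : Tendsto n atTop atTop)
    (hκ : ∀ᶠ k in atTop, 1 ≤ κ k) (hα : ∀ᶠ k in atTop, α k * Real.log (n k) = Real.log (κ k))
    (hz : Tendsto (fun k => z k - (2 + α k) * Real.log (n k)) atTop atTop) :
    ∀ᶠ k in atTop, 2 * Real.exp 1 * n k * √(κ k) * Real.exp (-(z k / 2)) ≤ 1 / 2 := by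
  have h1 : Tendsto (fun k => 2 * Real.exp 1 * Real.exp (-((z k - (2 + α k) * Real.log (n k)) / 2)))
      atTop (𝓝 0) := by
    simpa using (Real.tendsto_exp_neg_atTop_nhds_zero.comp
      (hz.atTop_div_const two_pos)).const_mul (2 * Real.exp 1)
  filter_upwards [hκ, hα, hn.eventually_ge_atTop 1,
    h1.eventually_le_const (by norm_num : (0 : ℝ) < 1 / 2)] with k h2 h3 h4 h5
  rwa [swap_bound_eq h4 (by linarith) h3]

theorem tendsto_exact_maxLikelihood_larger (hn : Tendsto n atTop atTop)
    (hnN : ∀ᶠ k in atTop, n k < N k)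
    (hα : ∀ᶠ k in atTop, α k * Real.log (n k) = Real.log ((N k : ℝ) - n k))
    (hE : ∀ᶠ k in atTop, MismatchBounds .maxLikelihood (n k) (N k) (z k) (E k))
    {C c : ℝ} (hβ : ∀ᶠ k in atTop, 1 / 2 ≤ α k) (hβC : ∀ᶠ k in atTop, α k ≤ C)
    (hc : 0 ≤ c) (hN : ∀ᶠ k in atTop, Real.log (N k) ≤ α k * Real.log (n k) + c)
    (hz : Tendsto (fun k => z k - (1 + √(α k)) ^ 2 * Real.log (n k)) atTop atTop) :
    Tendsto E atTop (𝓝 0) := by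
  have h1 := tendsto_sqrt_mul_sub (tendsto_log_cast hn) hβ hβC hN hc hz
  have hκ : ∀ᶠ k in atTop, (1 : ℝ) ≤ (N k : ℝ) - n k := by
    filter_upwards [hnN] with k hk
    have : (n k : ℝ) + 1 ≤ N k := by exact_mod_cast hk
    linarith
  -- Since (1 + √α)² = 1 + α + 2√α and α ≥ 1/2, the row condition dominates the swap condition.
  have hz' : Tendsto (fun k => z k - (2 + α k) * Real.log (n k)) atTop atTop := by
    refine tendsto_atTop_mono' _ ?_ hz
    filter_upwards [hβ] with k hk
    have e := Real.sq_sqrt (by linarith : 0 ≤ α k)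
    have h2 : 1 / 2 ≤ √(α k) := Real.le_sqrt_of_sq_le (by linarith)
    have h3 : 2 + α k ≤ (1 + √(α k)) ^ 2 := by nlinarith
    nlinarith [mul_le_mul_of_nonneg_right h3 (Real.log_natCast_nonneg (n k))]
  have hx := eventually_swap_bound_le hn hκ hα hz'
  have h7 : Tendsto (fun k => 6 * Real.exp (-(√(Real.log (n k)) *
      (√(z k) - √(Real.log (n k)) - √(Real.log (N k))))) +
      12 * (2 * Real.exp 1 * Real.exp (-((z k - (2 + α k) * Real.log (n k)) / 2)))) atTop (𝓝 0) := by
    have h8 := (Real.tendsto_exp_neg_atTop_nhds_zero.comp h1).const_mul 6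
    have h9 := ((Real.tendsto_exp_neg_atTop_nhds_zero.comp
      (hz'.atTop_div_const two_pos)).const_mul (2 * Real.exp 1)).const_mul 12
    simpa using h8.add h9
  refine tendsto_of_tendsto_of_tendsto_of_le_of_le' tendsto_const_nhds h7
    (hE.mono fun k h => h.nonneg) ?_
  filter_upwards [hE, hnN, hn.eventually_ge_atTop 1, h1.eventually_gt_atTop 0,
    eventually_pos_of_sub_mul_log (Eventually.of_forall fun k => by positivity) hz, hx, hκ, hα]
    with k h2 h3 h4 h5 h6 h8 h9 h10
  have h11 := h2.exact_maxLikelihood h4 h3.le h6 (by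
    have := pos_of_mul_pos_right h5 (Real.sqrt_nonneg _)
    linarith) h9 le_rfl h8
  rwa [swap_bound_eq h4 (by linarith) h10] at h11

theorem tendsto_exact_maxLikelihood_equal (hn : Tendsto n atTop atTop)
    (hnN : ∀ᶠ k in atTop, N k = n k)
    (hE : ∀ᶠ k in atTop, MismatchBounds .maxLikelihood (n k) (N k) (z k) (E k))
    (hz : Tendsto (fun k => z k - 2 * Real.log (n k)) atTop atTop) :
    Tendsto E atTop (𝓝 0) := by
  have hz' : Tendsto (fun k => z k - (2 + (0 : ℝ)) * Real.log (n k)) atTop atTop := by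
    simpa using hz
  -- There are no unmapped values, but the counting bound needs κ ≥ 1; hence κ = 1 with exponent 0.
  have hx := eventually_swap_bound_le (κ := fun _ => 1) hn (by simp) (by simp) hz'
  refine tendsto_zero_of_le_mul_exp_neg (c := 12 * (2 * Real.exp 1)) (hE.mono fun k h => h.nonneg) ?_
    (hz'.atTop_div_const two_pos)
  filter_upwards [hE, hnN, hn.eventually_ge_atTop 1, hx] with k h2 h3 h4 h5
  have h6 := h2.maxLikelihood' rfl 1 le_rfl (by rw [h3]; simp) h5
  rw [swap_bound_eq h4 one_pos (a := 0) (by simp), h3, sub_self] at h6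
  linarith

theorem tendsto_exact_maxLikelihood_slightlyLarger (hn : Tendsto n atTop atTop)
    (hnN : ∀ᶠ k in atTop, n k < N k)
    (hα : ∀ᶠ k in atTop, α k * Real.log (n k) = Real.log ((N k : ℝ) - n k))
    (hE : ∀ᶠ k in atTop, MismatchBounds .maxLikelihood (n k) (N k) (z k) (E k))
    (hz : Tendsto (fun k => z k - 2 * (α k + 1) * Real.log (n k)) atTop atTop) :
    Tendsto E atTop (𝓝 0) := by
  have hκ : ∀ᶠ k in atTop, (1 : ℝ) ≤ (N k : ℝ) - n k := by
    filter_upwards [hnN] with k hk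
    have : (n k : ℝ) + 1 ≤ N k := by exact_mod_cast hk
    linarith
  -- At least one value is unmapped, so α log n ≥ 0 and 2(α + 1) dominates 2 + α.
  have hz' : Tendsto (fun k => z k - (2 + α k) * Real.log (n k)) atTop atTop := by
    refine tendsto_atTop_mono' _ ?_ hz
    filter_upwards [hα, hκ] with k hk h1
    have := Real.log_nonneg h1
    nlinarith
  have hx := eventually_swap_bound_le hn hκ hα hz'
  have h7 : Tendsto (fun k => 3 * Real.exp (-((z k - 2 * (α k + 1) * Real.log (n k)) / 2)) +
      12 * (2 * Real.exp 1 * Real.exp (-((z k - (2 + α k) * Real.log (n k)) / 2)))) atTop (𝓝 0) := by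
    have h8 := (Real.tendsto_exp_neg_atTop_nhds_zero.comp (hz.atTop_div_const two_pos)).const_mul 3
    have h9 := ((Real.tendsto_exp_neg_atTop_nhds_zero.comp
      (hz'.atTop_div_const two_pos)).const_mul (2 * Real.exp 1)).const_mul 12
    simpa using h8.add h9
  refine tendsto_of_tendsto_of_tendsto_of_le_of_le' tendsto_const_nhds h7
    (hE.mono fun k h => h.nonneg) ?_
  filter_upwards [hE, hn.eventually_ge_atTop 1, hx, hκ, hα] with k h2 h4 h8 h9 h10
  have h11 := h2.maxLikelihood' rfl _ h9 le_rfl h8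
  have hn0 : (0 : ℝ) < n k := by exact_mod_cast h4
  have e : (n k : ℝ) * ((N k : ℝ) - n k) * Real.exp (-(z k / 2)) =
      Real.exp (-((z k - 2 * (α k + 1) * Real.log (n k)) / 2)) := by
    nth_rw 1 [← Real.exp_log hn0]
    rw [← Real.exp_log (by linarith : 0 < (N k : ℝ) - n k), ← h10, ← Real.exp_add, ← Real.exp_add]
    congr 1
    ring
  rw [swap_bound_eq h4 (by linarith) h10, e] at h11
  linarith

/-- N is at most twice the larger of n and N − n. The case N = n falls under the first alternative.
-/
theorem log_le_max_mul_add {n N : ℕ} (hn : 1 ≤ n) (hnN : n ≤ N) {a : ℝ}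
    (ha : a * Real.log n = Real.log ((N : ℝ) - n)) :
    Real.log N ≤ max a 1 * Real.log n + Real.log 2 := by
  have hn0 : (0 : ℝ) < n := by exact_mod_cast hn
  have hL := Real.log_natCast_nonneg n
  have h2 := Real.log_nonneg one_le_two
  have hnN' : (n : ℝ) ≤ N := by exact_mod_cast hnN
  rcases le_total ((N : ℝ) - n) n with h | h
  · have h3 : Real.log N ≤ Real.log (2 * n) := Real.log_le_log (by linarith) (by linarith)
    rw [Real.log_mul two_ne_zero hn0.ne'] at h3
    nlinarith [mul_le_mul_of_nonneg_right (le_max_right a 1) hL]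
  · have h3 : Real.log N ≤ Real.log (2 * (N - n)) := Real.log_le_log (by linarith) (by linarith)
    rw [Real.log_mul two_ne_zero (by linarith), ← ha] at h3
    nlinarith [mul_le_mul_of_nonneg_right (le_max_left a 1) hL]

theorem tendsto_almost_exact (hn : Tendsto n atTop atTop) (hnN : ∀ᶠ k in atTop, n k ≤ N k)
    (hα : ∀ᶠ k in atTop, α k * Real.log (n k) = Real.log ((N k : ℝ) - n k)) {C : ℝ}
    (hC : ∀ᶠ k in atTop, α k ≤ C)
    (hE : ∀ᶠ k in atTop, MismatchBounds alg (n k) (N k) (z k) (E k))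
    (hz : Tendsto (fun k => (z k - max (α k) 1 * Real.log (n k)) / √(Real.log (n k)))
      atTop atTop) :
    Tendsto (fun k => E k / n k) atTop (𝓝 0) := by
  have hL := tendsto_log_cast hn
  -- The subtracted log 2 pays for the additive log 2 in the bound on log N, as √log n ≥ 1
  -- eventually.
  set q := fun k => (z k - max (α k) 1 * Real.log (n k)) / √(Real.log (n k)) - Real.log 2 with hq
  have hq' : Tendsto q atTop atTop := tendsto_atTop_add_const_right _ _ hz
  set K := 2 * (3 + max C 1) with hK
  have hK1 : 1 ≤ K := by linarith [le_max_right C 1]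
  have hw : Tendsto (fun k => min (Real.log (n k)) (q k / (16 * K))) atTop atTop :=
    tendsto_atTop.2 fun b => by
      filter_upwards [tendsto_atTop.1 hL b,
        tendsto_atTop.1 (hq'.atTop_div_const (by positivity : 0 < 16 * K)) b] with k h1 h2
        using le_min h1 h2
  refine tendsto_zero_of_le_mul_exp_neg (c := 6)
    (hE.mono fun k h => div_nonneg h.nonneg (Nat.cast_nonneg _)) ?_ hw
  filter_upwards [hE, hnN, hn.eventually_ge_atTop 1, hL.eventually_ge_atTop 1,
    hq'.eventually_ge_atTop 1, hα, hC] with k h1 h2 h3 h4 h5 h6 h7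
  have h8 := log_le_max_mul_add h3 h2 h6
  have h9 : max (α k) 1 ≤ max C 1 := max_le_max_right 1 h7
  have hs := Real.one_le_sqrt.2 h4
  have hl2 := Real.log_two_lt_d9
  have hl2' := Real.log_nonneg one_le_two
  refine h1.almost_exact h3 h2 hK1 h4 h5 ?_ ?_
  · have e : q k * √(Real.log (n k)) = z k - max (α k) 1 * Real.log (n k) -
        Real.log 2 * √(Real.log (n k)) := by
      simp only [hq]
      field_simp
    rw [e]
    nlinarith
  · have h10 := mul_le_mul_of_nonneg_right h9 (by linarith : 0 ≤ Real.log (n k))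
    rw [hK]
    nlinarith

/-- In the two regimes with N ≤ 2n, the threshold and row bounds are applied with log N ≤ log n +
log 2, i.e. β = 1. In the larger regime β = α, because N is comparable to N − n. -/
theorem tendsto_exact (hn : Tendsto n atTop atTop) (hnN : ∀ᶠ k in atTop, n k ≤ N k)
    (hα : ∀ᶠ k in atTop, α k * Real.log (n k) = Real.log ((N k : ℝ) - n k)) {C : ℝ}
    (hC : ∀ᶠ k in atTop, α k ≤ C)
    (hE : ∀ᶠ k in atTop, MismatchBounds alg (n k) (N k) (z k) (E k)) {r : SizeRegime}
    (hr : r.Holds n N)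
    (hz : Tendsto (fun k => z k - exactConstant alg r (α k) * Real.log (n k)) atTop atTop) :
    Tendsto E atTop (𝓝 0) := by
  have hlog2 := Real.log_nonneg one_le_two
  have hsmall : (∀ᶠ k in atTop, (N k : ℝ) ≤ 2 * n k) → ∀ᶠ k in atTop,
      Real.log (N k) ≤ (fun _ : ℕ => (1 : ℝ)) k * Real.log (n k) + Real.log 2 := by
    intro h
    filter_upwards [h, hnN, hn.eventually_ge_atTop 1] with k h1 h2 h3
    have hn0 : (0 : ℝ) < n k := by exact_mod_cast h3
    have hN0 : (0 : ℝ) < N k := by exact_mod_cast h3.trans h2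
    have h4 := Real.log_le_log hN0 h1
    rw [Real.log_mul two_ne_zero hn0.ne'] at h4
    linarith
  have hthr : (∀ᶠ k in atTop, (N k : ℝ) ≤ 2 * n k) → alg = .thresholdTesting →
      Tendsto (fun k => z k - (1 + √2) ^ 2 * Real.log (n k)) atTop atTop →
      Tendsto E atTop (𝓝 0) := by
    rintro h rfl hz
    refine tendsto_exact_threshold (β := fun _ => 1) (C := 1) hn hnN hE
      (Eventually.of_forall fun _ => by norm_num) (Eventually.of_forall fun _ => le_rfl) hlog2
      (hsmall h) ?_
    norm_num
    exact hz
  have hrow : (∀ᶠ k in atTop, (N k : ℝ) ≤ 2 * n k) → alg = .maxRow →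
      Tendsto (fun k => z k - 4 * Real.log (n k)) atTop atTop → Tendsto E atTop (𝓝 0) := by
    rintro h rfl hz
    refine tendsto_exact_maxRow (β := fun _ => 1) (C := 1) hn hnN hE
      (Eventually.of_forall fun _ => by norm_num) (Eventually.of_forall fun _ => le_rfl) hlog2
      (hsmall h) ?_
    norm_num
    exact hz
  cases r with
  | equal =>
    have h1 : ∀ᶠ k in atTop, (N k : ℝ) ≤ 2 * n k := by
      filter_upwards [hr] with k hk
      rw [hk]
      linarith [(Nat.cast_nonneg (n k) : (0 : ℝ) ≤ n k)]
    cases alg with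
    | thresholdTesting => exact hthr h1 rfl hz
    | maxRow => exact hrow h1 rfl hz
    | maxLikelihood => exact tendsto_exact_maxLikelihood_equal hn hr hE hz
  | slightlyLarger =>
    have h1 : ∀ᶠ k in atTop, (N k : ℝ) ≤ 2 * n k := by
      filter_upwards [hr.2.bound one_pos] with k hk
      rw [one_mul, Real.norm_eq_abs, Real.norm_eq_abs, Nat.abs_cast] at hk
      linarith [le_abs_self ((N k : ℝ) - n k)]
    cases alg with
    | thresholdTesting => exact hthr h1 rfl hz
    | maxRow => exact hrow h1 rfl hz
    | maxLikelihood => exact tendsto_exact_maxLikelihood_slightlyLarger hn hr.1 hα hE hz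
  | larger =>
    obtain ⟨ε, hε, hr⟩ := hr
    have hL := tendsto_log_cast hn
    have hlt : ∀ᶠ k in atTop, n k < N k := by
      filter_upwards [hr, hn.eventually_ge_atTop 1] with k h1 h2
      have hn0 : (0 : ℝ) < n k := by exact_mod_cast h2
      have : (n k : ℝ) < N k := by nlinarith [mul_pos hε hn0]
      exact_mod_cast this
    -- From N − n ≥ εn, α log n ≥ log n + log ε; any lower bound below 1 would be available, and 1/2
    -- suffices.
    have hβ : ∀ᶠ k in atTop, 1 / 2 ≤ α k := by
      filter_upwards [hr, hn.eventually_ge_atTop 1, hα, hL.eventually_gt_atTop 0,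
        hL.eventually_ge_atTop (-2 * Real.log ε)] with k h1 h2 h3 h4 h5
      have hn0 : (0 : ℝ) < n k := by exact_mod_cast h2
      have h6 : Real.log (ε * n k) ≤ Real.log ((N k : ℝ) - n k) :=
        Real.log_le_log (by positivity) (by linarith)
      rw [Real.log_mul hε.ne' hn0.ne', ← h3] at h6
      by_contra! h7
      nlinarith
    have hc : 0 ≤ Real.log (1 + 1 / ε) := Real.log_nonneg (by
      have : 0 < 1 / ε := by positivity
      linarith)
    have hN : ∀ᶠ k in atTop, Real.log (N k) ≤ α k * Real.log (n k) + Real.log (1 + 1 / ε) := by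
      filter_upwards [hr, hα, hlt] with k h1 h3 h4
      have h5 : (0 : ℝ) < (N k : ℝ) - n k := by
        have : (n k : ℝ) < N k := by exact_mod_cast h4
        linarith
      have hN0 : (0 : ℝ) < N k := by exact_mod_cast (Nat.zero_le _).trans_lt h4
      rw [h3, ← Real.log_mul h5.ne' (by positivity)]
      refine Real.log_le_log hN0 ?_
      have h6 : (n k : ℝ) ≤ ((N k : ℝ) - n k) * (1 / ε) := by
        rw [mul_one_div, le_div_iff₀ hε]
        linarith
      linarith
    cases alg with
    | thresholdTesting => exact tendsto_exact_threshold hn hnN hE hβ hC hc hN hz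
    | maxRow => exact tendsto_exact_maxRow hn hnN hE hβ hC hc hN hz
    | maxLikelihood => exact tendsto_exact_maxLikelihood_larger hn hlt hα hE hβ hC hc hN hz

end Sequences

theorem tendsto_expectedMisaligned {X : ℕ → AlignmentSetting.{u, v}} {z : ℕ → ℝ}
    (hn : Tendsto (fun k => (X k).sizeU) atTop atTop)
    (hC : ∃ C : ℝ, ∀ᶠ k in atTop, (X k).alpha ≤ C) {alg : Algorithm}
    {m : ∀ k, (X k).Ω → Matrix (X k).U (X k).V ℝ}
    (hM : ∀ k, (X k).sizeM = (X k).sizeU)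
    (hE : ∀ k, Nonempty (X k).U → MismatchBounds alg (X k).sizeU (X k).sizeV (z k)
      ((X k).expectedMisaligned (m k))) :
    (∀ r : SizeRegime, r.Holds (fun k => (X k).sizeU) (fun k => (X k).sizeV) →
      Tendsto (fun k => z k - exactConstant alg r (X k).alpha * Real.log (X k).sizeU) atTop atTop →
      Tendsto (fun k => (X k).expectedMisaligned (m k)) atTop (𝓝 0)) ∧
    (Tendsto (fun k => (z k - max (X k).alpha 1 * Real.log (X k).sizeU) /
        √(Real.log (X k).sizeU)) atTop atTop →
      Tendsto (fun k => (X k).expectedMisaligned (m k) / (X k).sizeU) atTop (𝓝 0)) := by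
  obtain ⟨C, hC⟩ := hC
  have hnN : ∀ᶠ k in atTop, (X k).sizeU ≤ (X k).sizeV := Eventually.of_forall fun k => by
    obtain ⟨ι, hι⟩ := AlignmentSetting.exists_forall_mem_of_sizeM_eq (hM k)
    exact Fintype.card_le_of_injective ι fun u u' h => (X k).M.inj (hι u) (h ▸ hι u')
  have hE' : ∀ᶠ k in atTop, MismatchBounds alg (X k).sizeU (X k).sizeV (z k)
      ((X k).expectedMisaligned (m k)) := by
    -- The moment bounds for databases need an actual mapped pair; U is eventually nonempty.
    filter_upwards [hn.eventually_ge_atTop 1] with k hk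
    exact hE k (Fintype.card_pos_iff.1 hk)
  have hα : ∀ᶠ k in atTop, (X k).alpha * Real.log (X k).sizeU =
      Real.log (((X k).sizeV : ℝ) - (X k).sizeU) := by
    filter_upwards [(tendsto_log_cast hn).eventually_gt_atTop 0] with k hk using mul_log_eq hk
  exact ⟨fun r hr hz => tendsto_exact hn hnN hα hC hE' hr hz,
    fun hz => tendsto_almost_exact hn hnN hα hC hE' hz⟩

theorem theorem1 :
    -- planted matching on a Gaussian bigraph
    (∃ τ₀ : ℕ → ℕ → ℝ → ℝ, ∀ X : ℕ → PlantedMatching.{u, v},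
      (∀ k, (X k).sizeM = (X k).sizeU) →
      Tendsto (fun k => (X k).sizeU) atTop atTop →
      (∃ C : ℝ, ∀ᶠ k in atTop, (X k).alpha ≤ C) →
      ∀ (alg : Algorithm) (τ : ℕ → ℝ),
        (alg = .thresholdTesting →
          ∀ k, τ k = τ₀ (X k).sizeU (X k).sizeV (X k).signal) →
        ∀ m : ∀ k, (X k).Ω → Matrix (X k).U (X k).V ℝ,
          (∀ k, alg.IsEstimator (X k).toAlignmentSetting (X k).score (τ k) (m k)) →
          -- exact alignment
          (∀ r : SizeRegime, r.Holds (fun k => (X k).sizeU) (fun k => (X k).sizeV) →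
            Tendsto (fun k => (X k).signal -
              exactConstant alg r (X k).alpha * Real.log (X k).sizeU) atTop atTop →
            Tendsto (fun k => (X k).expectedMisaligned (m k)) atTop (𝓝 0)) ∧
          -- almost-exact alignment
          (Tendsto (fun k => ((X k).signal - max (X k).alpha 1 * Real.log (X k).sizeU) /
              √(Real.log (X k).sizeU)) atTop atTop →
            Tendsto (fun k => (X k).expectedMisaligned (m k) / (X k).sizeU) atTop (𝓝 0))) ∧
    -- alignment of correlated Gaussian databases
    (∃ τ₀ : ℕ → ℕ → ℝ → ℝ, ∀ X : ℕ → CorrelatedGaussianDatabases.{u, v, w},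
      (∀ k, (X k).sizeM = (X k).sizeU) →
      Tendsto (fun k => (X k).sizeU) atTop atTop →
      (∃ C : ℝ, ∀ᶠ k in atTop, (X k).alpha ≤ C) →
      ∀ (alg : Algorithm) (τ : ℕ → ℝ),
        (alg = .thresholdTesting →
          ∀ k, τ k = τ₀ (X k).sizeU (X k).sizeV (X k).signal) →
        ∀ m : ∀ k, (X k).Ω → Matrix (X k).U (X k).V ℝ,
          (∀ k, alg.IsEstimator (X k).toAlignmentSetting (X k).score (τ k) (m k)) →
          -- exact alignment
          (∀ r : SizeRegime, r.Holds (fun k => (X k).sizeU) (fun k => (X k).sizeV) →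
            Tendsto (fun k => (X k).signal -
              exactConstant alg r (X k).alpha * Real.log (X k).sizeU) atTop atTop →
            Tendsto (fun k => (X k).expectedMisaligned (m k)) atTop (𝓝 0)) ∧
          -- almost-exact alignment
          (Tendsto (fun k => ((X k).signal - max (X k).alpha 1 * Real.log (X k).sizeU) /
              √(Real.log (X k).sizeU)) atTop atTop →
            Tendsto (fun k => (X k).expectedMisaligned (m k) / (X k).sizeU) atTop (𝓝 0))) := by
  -- The level z(2t − 1) refers to the log-likelihood ratio. The planted score μW exceeds it by the
  -- signal, hence the shift z; the database score is the ratio itself.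
  refine ⟨⟨fun n N z => z * (2 * thresholdSplit n N z - 1) + z, ?_⟩,
    ⟨fun n N z => z * (2 * thresholdSplit n N z - 1) + 0, ?_⟩⟩
  · intro X hM hn hC alg τ hτ m hm
    refine tendsto_expectedMisaligned (X := fun k => (X k).toAlignmentSetting) hn hC hM fun k _ => ?_
    obtain ⟨ι, hι⟩ := AlignmentSetting.exists_forall_mem_of_sizeM_eq (hM k)
    exact (PlantedMatching.scoreBounds hι).mismatchBounds hι
      (fun ω u v => (sub_add_cancel ((X k).score ω u v) (X k).signal).symm) (hm k)
      fun h => hτ h k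
  · intro X hM hn hC alg τ hτ m hm
    refine tendsto_expectedMisaligned (X := fun k => (X k).toAlignmentSetting) hn hC hM fun k _ => ?_
    obtain ⟨ι, hι⟩ := AlignmentSetting.exists_forall_mem_of_sizeM_eq (hM k)
    exact (CorrelatedGaussianDatabases.scoreBounds hι).mismatchBounds hι
      (fun ω u v => (add_zero ((X k).score ω u v)).symm) (hm k) fun h => hτ h k
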